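/- Let $\Psi$ be the distribution function of a probability law on $(0,1]$, continuously differentiable on $[0,1]$, and put $\psi=\Psi'$. *The $\Psi$-process.* Start at time $0$ from a partition of $[0,1]$ into finitely many intervals. Points arrive at the times of a Poisson process of intensity $e^t\,dt$. When a point arrives and the current interval lengths are $I_1,\dots,I_N$, let $\tilde A(x)=\sum_i I_i\mathbf 1\{I_i\le x\}$, sample $u$ from the law with distribution function $\Psi$, choose an interval of length $\tilde A^{-1}(u)=\inf\{x:\tilde A(x)\ge u\}$, and split it at a uniformly chosen point; all the random choices are independent. Let $A_t(x)=\sum_i I_i^{(t)}\mathbf 1\{I_i^{(t)}\le e^{-t}x\}$, where $I_i^{(t)}$ are the lengths at time $t$. Let $\hat F$ be the limiting distribution of the process: a (deterministic) probability distribution function on $[0,\infty)$ such that almost surely $A_t(x)\to\hat F(x)$ as $t\to\infty$ for all $x\ge 0$. *Norms and operator.* For $\delta\in(0,1]$ let $\|f\|_\delta=\int_0^\infty x^{-1-\delta}|f(x)|\,dx$. Let $\mathcal D$ be the set of càdlàg increasing functions $F:[0,\infty)\to[0,1]$. For a measurable family $\mathbf F=(F_t)_{t\ge0}$ in $\mathcal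 D$ put $$\mathscr C^*(\mathbf F)_t(x)=F_0(e^{-t}x)+\int_0^t (e^{s-t}x)^2\int_{(e^{s-t}x,\infty)}\frac{\psi(\hat F(z))}{z}\,dF_s(z)\,ds .$$ For $\alpha\in[0,1]$ let $\mathfrak F^\alpha$ be the set of measurable families $\mathbf F=(F_t)_{t\ge 0}$ in $\mathcal D$ such that $\|F_t\|_1\le 1$ and $\lim_{x\to\infty}F_t(x)=\alpha$ for all $t\ge0$, $\mathbf F=\mathscr C^*(\mathbf F)$, and $(\alpha^{-1}F_t)_{t\ge0}$ is tight, that is, for every $\varepsilon>0$ there is $N$ with $F_t(N)\ge\alpha(1-\varepsilon)$ for all $t\ge0$. **Proposition.** Suppose that for some $\delta\in(0,1]$ the inequality $$|z\,\psi'(\hat F(z))\,\hat F'(z)-\psi(\hat F(z))|\le(2-\delta)\,\psi(\hat F(z))$$ holds for all $z\ge0$, where $\psi$ is differentiable at $\hat F(z)$ for every $z>0$ (at $z=0$ the first term is read as $0$). Then for every $\alpha\in[0,1]$, every $\mathbf F\in\mathfrak F^\alpha$ and every $t\ge0$, $$\|F_t-\alpha\hat F\|_\delta\le 2(1+\delta^{-1})e^{-\delta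 t}.$$ -/

import Mathlib

open Set Filter Topology MeasureTheory ProbabilityTheory
open scoped NNReal ENNReal

noncomputable section

/-! ### The law of the selection variable -/

/-- `Ψ` is the distribution function of a law on `(0,1]` and is continuously differentiable on
`[0,1]` (one-sidedly at the end points). -/
structure IsC1Law (Ψ : ℝ → ℝ) : Prop where
  contDiffOn : ContDiffOn ℝ 1 Ψ (Icc 0 1)
  monotoneOn : MonotoneOn Ψ (Icc 0 1)
  map_zero : Ψ 0 = 0
  map_one : Ψ 1 = 1

/-- The density `ψ = Ψ'` on `[0,1]`. -/
def dens (Ψ : ℝ → ℝ) (u : ℝ) : ℝ := derivWithin Ψ (Icc 0 1) u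

/-- The derivative `ψ'` on `[0,1]`. -/
def densDeriv (Ψ : ℝ → ℝ) (u : ℝ) : ℝ := derivWithin (dens Ψ) (Icc 0 1) u

/-! ### The interval splitting process

A configuration is the multiset of the lengths of the intervals of the current partition. -/

/-- Size-biased empirical distribution function `x ↦ ∑ I_i 1{I_i ≤ x}` of a configuration. -/
def sizeBiased (I : Multiset ℝ) (x : ℝ) : ℝ := (I.filter (fun l => l ≤ x)).sum

/-- Generalized inverse of the size-biased distribution function: the length selected by `u`. -/
def selectedLength (I : Multiset ℝ) (u : ℝ) : ℝ := sInf {x : ℝ | u ≤ sizeBiased I x}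

/-- An interval of the length selected by `u` is cut at the fraction `v` of its length. -/
def splitStep (I : Multiset ℝ) (u v : ℝ) : Multiset ℝ :=
  (v * selectedLength I u) ::ₘ ((1 - v) * selectedLength I u) ::ₘ I.erase (selectedLength I u)

/-- The configuration after `n` arrivals, driven by the selections `u` and the cuts `v`. -/
def splitChain (I₀ : Multiset ℝ) (u v : ℕ → ℝ) : ℕ → Multiset ℝ
  | 0 => I₀
  | n + 1 => splitStep (splitChain I₀ u v n) (u n) (v n)

/-- The `Ψ`-process: an initial partition of `[0,1]` into finitely many intervals, and mutually
independent inputs. The selections have distribution function `Ψ`, the cuts are uniform on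
`[0,1]`, and the gaps are the standard exponential gaps between arrivals in the clock
`τ = e^t - 1 = ∫₀ᵗ e^s ds`, which makes the arrivals a Poisson process of intensity `e^t dt`. -/
structure PsiProcess (Ψ : ℝ → ℝ) {Ω : Type*} [MeasurableSpace Ω] (P : Measure Ω) where
  init : Multiset ℝ
  init_pos : ∀ l ∈ init, 0 < l
  init_sum : init.sum = 1
  gap : ℕ → Ω → ℝ
  sel : ℕ → Ω → ℝ
  cut : ℕ → Ω → ℝ
  measurable_gap : ∀ n, Measurable (gap n)
  measurable_sel : ∀ n, Measurable (sel n)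
  measurable_cut : ∀ n, Measurable (cut n)
  gap_law : ∀ n, P.map (gap n) = expMeasure 1
  sel_law : ∀ n, ∀ u ∈ Icc (0 : ℝ) 1, P {ω | sel n ω ≤ u} = ENNReal.ofReal (Ψ u)
  cut_law : ∀ n, P.map (cut n) = volume.restrict (Icc 0 1)
  indep : iIndepFun (Sum.elim gap (Sum.elim sel cut)) P

namespace PsiProcess

variable {Ψ : ℝ → ℝ} {Ω : Type*} [MeasurableSpace Ω] {P : Measure Ω}

/-- Time of the arrival with index `n` (the first arrival has index `0`). -/
def arrivalTime (X : PsiProcess Ψ P) (n : ℕ) (ω : Ω) : ℝ :=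
  Real.log (1 + ∑ i ∈ Finset.range (n + 1), X.gap i ω)

/-- Number of arrivals up to time `t`. -/
def arrivals (X : PsiProcess Ψ P) (t : ℝ) (ω : Ω) : ℕ := {n : ℕ | X.arrivalTime n ω ≤ t}.ncard

/-- The lengths of the intervals present at time `t`. -/
def lengths (X : PsiProcess Ψ P) (t : ℝ) (ω : Ω) : Multiset ℝ :=
  splitChain X.init (fun n => X.sel n ω) (fun n => X.cut n ω) (X.arrivals t ω)

/-- The rescaled size-biased empirical distribution function
`A_t(x) = ∑ I_i 1{I_i ≤ e^{-t} x}`. -/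
def A (X : PsiProcess Ψ P) (t : ℝ) (ω : Ω) (x : ℝ) : ℝ :=
  sizeBiased (X.lengths t ω) (Real.exp (-t) * x)

end PsiProcess

/-! ### Profiles and norms -/

/-- Right-continuous increasing functions `[0,∞) → [0,1]`, extended by `0` to the negative
half-line. (Left limits are automatic for a monotone function.) -/
structure Profile extends StieltjesFunction ℝ where
  zero_of_neg : ∀ x < 0, toFun x = 0
  le_one : ∀ x, toFun x ≤ 1

instance : CoeFun Profile (fun _ => ℝ → ℝ) := ⟨fun F => F.toFun⟩

/-- The norm `‖f‖_δ = ∫₀^∞ x^{-1-δ} |f x| dx`, with values in `[0,∞]`. -/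
def wnorm (δ : ℝ) (f : ℝ → ℝ) : ℝ≥0∞ :=
  ∫⁻ x in Ioi (0 : ℝ), ENNReal.ofReal (x ^ (-1 - δ) * |f x|)

/-- `Fhat` is the limiting distribution of the `Ψ`-process `X`: a probability distribution
function on `[0,∞)` to which `A_t` converges pointwise, almost surely, as `t → ∞`. -/
structure IsLimitingDistribution {Ψ : ℝ → ℝ} {Ω : Type*} [MeasurableSpace Ω] {P : Measure Ω}
    (X : PsiProcess Ψ P) (Fhat : Profile) : Prop where
  tendsto_one : Tendsto Fhat atTop (𝓝 1)
  tendsto_A : ∀ᵐ ω ∂P, ∀ x, 0 ≤ x → Tendsto (fun t : ℝ => X.A t ω x) atTop (𝓝 (Fhat x))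

/-- The inequality `|z ψ'(F̂ z) F̂'(z) - ψ(F̂ z)| ≤ (2 - δ) ψ(F̂ z)` for all `z ≥ 0`, including the
existence of `ψ'` at the points `F̂ z`, `z > 0` (at `z = 0` the factor `z` removes the term). -/
structure DensityInequality (Ψ : ℝ → ℝ) (Fhat : Profile) (δ : ℝ) : Prop where
  differentiable : ∀ z, 0 < z → DifferentiableWithinAt ℝ (dens Ψ) (Icc 0 1) (Fhat z)
  ineq : ∀ z, 0 ≤ z →
    |z * densDeriv Ψ (Fhat z) * deriv Fhat z - dens Ψ (Fhat z)| ≤ (2 - δ) * dens Ψ (Fhat z)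

/-! ### The operator and its fixed points -/

/-- The operator
`𝒞*(F)_t(x) = F_0(e^{-t} x) + ∫₀ᵗ (e^{s-t} x)² ∫_{(e^{s-t} x, ∞)} ψ(F̂ z) / z dF_s(z) ds`. -/
def opCStar (Ψ : ℝ → ℝ) (Fhat : Profile) (F : ℝ≥0 → Profile) (t : ℝ≥0) (x : ℝ) : ℝ :=
  F 0 (Real.exp (-(t : ℝ)) * x) +
    ∫ s in (0 : ℝ)..t, (Real.exp (s - t) * x) ^ 2 *
      ∫ z in Ioi (Real.exp (s - t) * x), dens Ψ (Fhat z) / z ∂(F s.toNNReal).measure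

/-- The set `𝔉^α` of fixed points of `𝒞*`. -/
structure IsFixedPoint (Ψ : ℝ → ℝ) (Fhat : Profile) (α : ℝ) (F : ℝ≥0 → Profile) : Prop where
  /-- Since profiles are right-continuous, this is measurability of `t ↦ F_t` as a map to
  `L¹_loc`. -/
  measurable : ∀ x, Measurable (fun t => F t x)
  norm_le : ∀ t, wnorm 1 (F t) ≤ 1
  fixed : ∀ t x, 0 ≤ x → F t x = opCStar Ψ Fhat F t x
  mass : ∀ t, Tendsto (F t) atTop (𝓝 α)
  /-- Tightness of `α⁻¹ F_t`, multiplied through by `α` so as to make sense for `α = 0`. -/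
  tight : ∀ ε : ℝ, 0 < ε → ∃ N : ℝ, ∀ t, α * (1 - ε) ≤ F t N

end

/-! Put `w(z) = ψ(F̂ z) / z`. Integration by parts replaces the measures `dF_s` by their tails, so
the difference `G = F - α F̂` of two fixed points solves a linear equation. Along the characteristic
`y = e^s x` it reads `d/ds G_s(y) = -y² (w(y) G_s(y) + ∫_y^∞ w'(z) G_s(z) dz)`. Multiplication by
the sign of `G_s(y)` makes the first term a loss `y² w |G|` and bounds the second by a gain. The
density inequality says exactly that `|w'| ≤ (2-δ) w / z`. Integrated against `x^{-1-δ} dx`, the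
gain is at most a multiple of `(2-δ) ∫ (w(z)/z) |G(z)| ∫_0^z y^{1-δ} dy dz = ∫ z^{1-δ} w |G| dz`,
and the loss is the same multiple of the same integral. Hence `∫ x^{-1-δ} |G_t(e^t x)| dx = e^{δt}
‖G_t‖_δ` never exceeds `‖G_0‖_δ ≤ 2(1+δ⁻¹)`; this is `IsFlow.wnorm_sub_le`.

Gain and loss can be cancelled only if they are finite. The balance is therefore integrated over `x
< X` (`IsWeight.energy_truncated`), which leaves an error coming from lengths beyond `e^s X`. The
fixed point equation itself bounds the time integral of the moments `∫ v^{2-δ} w dF_s`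
(`IsFlow.lintegral_moment_lt_top`), and this forces the error to vanish as `X → ∞`
(`IsFlow.tendsto_lintegral_tail`).

It remains to see that `F̂` is itself a fixed point, of mass one and norm at most one; here the
process enters. A uniform cut of a length `ℓ > y` raises the size-biased distribution function at
`y` by `y²/ℓ` on average, and the selected length is at most `z` with probability the mean of `Ψ` at
the current distribution function at `z`. Summed over the first `k` arrivals at the level `y = x/k`,
the mean increments form a Riemann sum. By the law of large numbers `e^t` is asymptotic to the
number of arrivals, so the limit is `F̂(x) = ∫_0^x r ∫_{(r,∞)} z⁻¹ dΨ(F̂ z) dr`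
(`PsiProcess.isStationaryProfile`). This equation makes `F̂` differentiable on `(0,∞)` and yields
the fixed point property (`IsStationaryProfile.isFlow`) and the norm
(`IsStationaryProfile.wnorm_one_le`). -/

noncomputable section

/-! ### Weights, integration by parts, and a differential inequality for moduli -/

/-- A nonnegative weight on `(0,∞)`, bounded by a multiple of `1/z`, whose logarithmic derivative
is at most `(2-δ)/z` in absolute value. -/
structure IsWeight (w : ℝ → ℝ) (δ C : ℝ) : Prop where
  measurable : Measurable w
  differentiableAt : ∀ z, 0 < z → DifferentiableAt ℝ w z
  nonneg : ∀ z, 0 < z → 0 ≤ w z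
  le : ∀ z, 0 < z → w z ≤ C / z
  abs_deriv_le : ∀ z, 0 < z → |deriv w z| ≤ (2 - δ) * (w z / z)

namespace Profile

lemma monotone (F : Profile) : Monotone F := F.mono

lemma nonneg (F : Profile) (x : ℝ) : 0 ≤ F x := by
  have h := F.monotone (min_le_left x (-1))
  rwa [F.zero_of_neg _ (lt_of_le_of_lt (min_le_right x (-1)) (by norm_num))] at h

lemma measurable (F : Profile) : Measurable F := F.monotone.measurable

lemma le_of_tendsto {F : Profile} {α : ℝ} (h : Tendsto F atTop (𝓝 α)) (x : ℝ) : F x ≤ α :=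
  F.monotone.ge_of_tendsto h x

lemma measure_Ioi {F : Profile} {α : ℝ} (h : Tendsto F atTop (𝓝 α)) (x : ℝ) :
    F.measure (Ioi x) = ENNReal.ofReal (α - F x) :=
  StieltjesFunction.measure_Ioi _ h x

lemma isFiniteMeasure_restrict {F : Profile} {α : ℝ} (h : Tendsto F atTop (𝓝 α)) (x : ℝ) :
    IsFiniteMeasure (F.measure.restrict (Ioi x)) := by
  constructor
  simp [measure_Ioi h]

end Profile

namespace IsWeight

variable {w : ℝ → ℝ} {δ C : ℝ}

lemma const_nonneg (hw : IsWeight w δ C) : 0 ≤ C := by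
  have h1 := hw.nonneg 1 one_pos
  have h2 := hw.le 1 one_pos
  linarith

lemma abs_deriv_le_sq (hw : IsWeight w δ C) (hδ : δ ≤ 2) {z : ℝ} (hz : 0 < z) :
    |deriv w z| ≤ (2 - δ) * C * (z ^ 2)⁻¹ := by
  refine (hw.abs_deriv_le z hz).trans ?_
  rw [mul_assoc]
  refine mul_le_mul_of_nonneg_left ?_ (by linarith)
  calc w z / z ≤ C / z / z := by gcongr; exact hw.le z hz
    _ = C * (z ^ 2)⁻¹ := by field_simp

lemma integrableOn_inv_sq {y : ℝ} (hy : 0 < y) :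
    IntegrableOn (fun z : ℝ => (z ^ 2)⁻¹) (Ioi y) := by
  have := integrableOn_Ioi_rpow_of_lt (a := -2) (by norm_num) hy
  refine this.congr_fun (fun z hz => ?_) measurableSet_Ioi
  have hz : 0 < z := hy.trans hz
  simp only
  rw [Real.rpow_neg hz.le]; norm_cast

lemma integrableOn_deriv (hw : IsWeight w δ C) (hδ : δ ≤ 2) {y : ℝ} (hy : 0 < y) :
    IntegrableOn (deriv w) (Ioi y) := by
  refine Integrable.mono' ((integrableOn_inv_sq hy).const_mul ((2 - δ) * C))
    (measurable_deriv w).aestronglyMeasurable ?_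
  filter_upwards [ae_restrict_mem measurableSet_Ioi] with z hz
  exact hw.abs_deriv_le_sq hδ (hy.trans hz)

lemma integral_deriv (hw : IsWeight w δ C) (hδ : δ ≤ 2) {y v : ℝ} (hy : 0 < y) (hyv : y ≤ v) :
    ∫ z in Ioo y v, deriv w z = w v - w y := by
  rw [← integral_Ioc_eq_integral_Ioo, ← intervalIntegral.integral_of_le hyv]
  refine intervalIntegral.integral_eq_sub_of_hasDerivAt (fun z hz => ?_) ?_
  · rw [uIcc_of_le hyv] at hz
    exact (hw.differentiableAt z (hy.trans_le hz.1)).hasDerivAt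
  · rw [intervalIntegrable_iff_integrableOn_Ioc_of_le hyv]
    exact (hw.integrableOn_deriv hδ hy).mono_set Ioc_subset_Ioi_self

lemma integrableOn_stieltjes (hw : IsWeight w δ C) {F : Profile} {α : ℝ}
    (h : Tendsto F atTop (𝓝 α)) {y : ℝ} (hy : 0 < y) :
    IntegrableOn w (Ioi y) F.measure := by
  have := Profile.isFiniteMeasure_restrict h y
  refine Integrable.mono' (integrable_const (C / y)) hw.measurable.aestronglyMeasurable ?_
  filter_upwards [ae_restrict_mem measurableSet_Ioi] with z hz
  have hz0 : 0 < z := hy.trans hz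
  rw [Real.norm_of_nonneg (hw.nonneg z hz0)]
  refine (hw.le z hz0).trans ?_
  have := hw.const_nonneg
  gcongr
  exact le_of_lt hz

/-- Integration by parts for the measure of a profile. -/
theorem integral_stieltjes (hw : IsWeight w δ C) (hδ : δ ≤ 2) {F : Profile} {α : ℝ}
    (h : Tendsto F atTop (𝓝 α)) {y : ℝ} (hy : 0 < y) :
    ∫ z in Ioi y, w z ∂F.measure =
      w y * (α - F y) + ∫ z in Ioi y, deriv w z * (α - F z) := by
  have hfin := Profile.isFiniteMeasure_restrict h y
  set μ := F.measure.restrict (Ioi y) with hμ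
  -- Fubini for `1{z < v} w'(z)` over `(y,∞)²`: the measure in `v` is finite and `w'` is `O(z⁻²)`.
  have hint : Integrable (Function.uncurry fun v z : ℝ => if z < v then deriv w z else 0)
      (μ.prod (volume.restrict (Ioi y))) := by
    have hb : Integrable (fun p : ℝ × ℝ => (1 : ℝ) * deriv w p.2)
        (μ.prod (volume.restrict (Ioi y))) :=
      (integrable_const (1 : ℝ)).mul_prod (hw.integrableOn_deriv hδ hy)
    refine hb.mono ?_ (Eventually.of_forall fun p => ?_)
    · refine Measurable.aestronglyMeasurable ?_
      exact Measurable.ite (measurableSet_lt measurable_snd measurable_fst)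
        ((measurable_deriv w).comp measurable_snd) measurable_const
    · simp only [Function.uncurry]
      split_ifs <;> simp
  have h1 : ∀ v ∈ Ioi y, w v = w y + ∫ z in Ioi y, if z < v then deriv w z else 0 := by
    intro v hv
    have : ∫ z in Ioi y, (if z < v then deriv w z else 0) = ∫ z in Ioo y v, deriv w z := by
      rw [← Ioi_inter_Iio, ← setIntegral_indicator measurableSet_Iio]
      rfl
    rw [this, hw.integral_deriv hδ hy (le_of_lt hv)]
    ring
  have hint' : Integrable (fun v => ∫ z in Ioi y, if z < v then deriv w z else 0) μ :=
    hint.integral_prod_left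
  rw [setIntegral_congr_fun measurableSet_Ioi h1, ← hμ,
    integral_add (integrable_const _) hint', integral_const,
    integral_integral_swap hint]
  congr 1
  · rw [smul_eq_mul, mul_comm, hμ, measureReal_restrict_apply_univ, measureReal_def,
      Profile.measure_Ioi h,
      ENNReal.toReal_ofReal (sub_nonneg.2 (Profile.le_of_tendsto h y))]
  · refine setIntegral_congr_fun measurableSet_Ioi fun z hz => ?_
    have : (fun v => if z < v then deriv w z else 0) = (Ioi z).indicator fun _ => deriv w z := by
      ext v; simp [indicator]
    rw [this, integral_indicator measurableSet_Ioi, hμ, Measure.restrict_restrict measurableSet_Ioi,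
      Ioi_inter_Ioi, sup_of_le_left (le_of_lt hz), setIntegral_const, measureReal_def,
      Profile.measure_Ioi h,
      ENNReal.toReal_ofReal (sub_nonneg.2 (Profile.le_of_tendsto h z)), smul_eq_mul, mul_comm]

end IsWeight

/-- An upper bound for the modulus of a function with prescribed derivative, in terms of a bound
for the derivative multiplied by the sign of the function. -/
theorem abs_le_abs_add_integral {g k m : ℝ → ℝ} {t M : ℝ} (ht : 0 ≤ t) 
    (hg : ∀ s ∈ Icc 0 t, g s = g 0 + ∫ r in (0 : ℝ)..s, k r)
    (hk : Measurable k) (hkM : ∀ s ∈ Icc 0 t, |k s| ≤ M)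
    (hm : IntervalIntegrable m volume 0 t)
    (hpos : ∀ s ∈ Icc 0 t, 0 < g s → k s ≤ m s) (hneg : ∀ s ∈ Icc 0 t, g s < 0 → -k s ≤ m s)
    (hzero : ∀ s ∈ Icc 0 t, g s = 0 → 0 ≤ m s) :
    |g t| ≤ |g 0| + ∫ s in (0 : ℝ)..t, m s := by
  have hki : IntervalIntegrable k volume 0 t := by
    rw [intervalIntegrable_iff_integrableOn_Ioc_of_le ht]
    refine Integrable.mono' (integrable_const M) hk.aestronglyMeasurable ?_
    filter_upwards [ae_restrict_mem measurableSet_Ioc] with s hs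
    exact hkM s (Ioc_subset_Icc_self hs)
  have hM : 0 ≤ M := (abs_nonneg _).trans (hkM 0 (by simp [ht]))
  -- `G` equals `g` on `[0,t]`, but is a primitive for every argument, so that its two-sided
  -- derivative does not depend on `g` outside `[0,t]`.
  set G : ℝ → ℝ := fun s => g 0 + ∫ r in (0 : ℝ)..s, k r with hG
  have hac : AbsolutelyContinuousOnInterval (fun s => |G s|) 0 t := by
    have : LipschitzOnWith M.toNNReal (fun s => |G s|) (uIcc 0 t) := by
      refine LipschitzOnWith.of_dist_le_mul fun x hx y hy => ?_
      rw [Real.coe_toNNReal _ hM, Real.dist_eq, Real.dist_eq]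
      refine (abs_abs_sub_abs_le_abs_sub _ _).trans ?_
      have hsub : G x - G y = ∫ r in y..x, k r := by
        have := intervalIntegral.integral_interval_sub_left
          (hki.mono_set (uIcc_subset_uIcc left_mem_uIcc hx))
          (hki.mono_set (uIcc_subset_uIcc left_mem_uIcc hy))
        simp only [hG]; rw [← this]; ring
      rw [hsub, ← Real.norm_eq_abs]
      refine intervalIntegral.norm_integral_le_of_norm_le_const fun r hr => ?_
      refine hkM r ?_
      rw [← uIcc_of_le ht]
      exact uIcc_subset_uIcc hy hx (uIoc_subset_uIcc hr)
    exact this.absolutelyContinuousOnInterval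
  have h1 := hac.integral_deriv_eq_sub
  have hGg : ∀ s ∈ Icc 0 t, G s = g s := fun s hs => (hg s hs).symm
  rw [hGg t (by simp [ht]), hGg 0 (by simp [ht])] at h1
  have h2 : ∫ s in (0 : ℝ)..t, deriv (fun s => |G s|) s ≤ ∫ s in (0 : ℝ)..t, m s := by
    refine intervalIntegral.integral_mono_ae_restrict ht hac.intervalIntegrable_deriv hm ?_
    rw [EventuallyLE, ae_restrict_iff' measurableSet_Icc]
    filter_upwards [hki.ae_hasDerivAt_integral, hac.ae_differentiableAt] with s hs hs2 hst
    rw [uIcc_of_le ht] at hs hs2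
    have hd : HasDerivAt G (k s) s := (hs hst 0 (by simp [ht])).const_add (g 0)
    rcases lt_trichotomy (G s) 0 with hlt | heq | hgt
    · have := ((hasDerivAt_abs_neg hlt).comp s hd).deriv
      simp only [Function.comp_def] at this
      rw [this, neg_one_mul]; exact hneg s hst (hGg s hst ▸ hlt)
    -- At a zero of `G` the modulus has a minimum, so its derivative vanishes; no bound on `k` is
    -- needed there, only `0 ≤ m`.
    · have : IsLocalMin (fun s => |G s|) s := by
        refine Eventually.of_forall fun r => ?_
        simp [heq]
      rw [this.deriv_eq_zero]; exact hzero s hst (hGg s hst ▸ heq)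
    · have := ((hasDerivAt_abs_pos hgt).comp s hd).deriv
      simp only [Function.comp_def] at this
      rw [this, one_mul]; exact hpos s hst (hGg s hst ▸ hgt)
  linarith

end

/-! ### Tonelli on the region `y < z`, dilations, and moments of the weight -/

noncomputable section

/-- Tonelli on `{y < z}`. The measure in `z` is left general because it is the measure of a profile
for the moments and Lebesgue measure for the energy balance. -/
lemma lintegral_mul_lintegral_Ioi_swap {μ : Measure ℝ} [SFinite μ] (S : Set ℝ)
    {φ h : ℝ → ℝ≥0∞} (hφ : Measurable φ) (hh : Measurable h) :
    ∫⁻ y in S, φ y * ∫⁻ z in Ioi y, h z ∂μ = ∫⁻ z, (∫⁻ y in S ∩ Iio z, φ y) * h z ∂μ := by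
  have h1 : ∀ y, φ y * ∫⁻ z in Ioi y, h z ∂μ = ∫⁻ z, (if y < z then φ y * h z else 0) ∂μ := by
    intro y
    rw [← lintegral_indicator measurableSet_Ioi, ← lintegral_const_mul _ 
      (hh.indicator measurableSet_Ioi)]
    refine lintegral_congr fun z => ?_
    by_cases hz : y < z <;> simp [hz]
  have hm : Measurable (Function.uncurry fun y z : ℝ => if y < z then φ y * h z else 0) :=
    Measurable.ite (measurableSet_lt measurable_fst measurable_snd)
      ((hφ.comp measurable_fst).mul (hh.comp measurable_snd)) measurable_const
  simp_rw [h1]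
  rw [lintegral_lintegral_swap hm.aemeasurable]
  refine lintegral_congr fun z => ?_
  rw [inter_comm, ← Measure.restrict_restrict measurableSet_Iio, 
    ← lintegral_indicator measurableSet_Iio,
    ← lintegral_mul_const _ (hφ.indicator measurableSet_Iio)]
  refine lintegral_congr fun y => ?_
  by_cases hz : y < z <;> simp [hz]

lemma lintegral_Ioi_comp_mul {c : ℝ} (hc : 0 < c) (f : ℝ → ℝ≥0∞) :
    ENNReal.ofReal c * ∫⁻ x in Ioi 0, f (c * x) = ∫⁻ y in Ioi 0, f y := by
  have hmap := Real.smul_map_volume_mul_left hc.ne'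
  have he : MeasurableEmbedding (c * · : ℝ → ℝ) :=
    (Homeomorph.mulLeft₀ c hc.ne').measurableEmbedding
  conv_rhs => rw [← hmap]
  rw [Measure.restrict_smul, lintegral_smul_measure, he.restrict_map, he.lintegral_map,
    abs_of_pos hc, smul_eq_mul]
  congr 4
  ext x
  simp [hc]

lemma lintegral_Ioo_comp_mul {c : ℝ} (hc : 0 < c) (X : ℝ) (f : ℝ → ℝ≥0∞) :
    ENNReal.ofReal c * ∫⁻ x in Ioo 0 X, f (c * x) = ∫⁻ y in Ioo 0 (c * X), f y := by
  have h : ∀ Y : ℝ, ∀ g : ℝ → ℝ≥0∞, ∫⁻ x in Ioo 0 Y, g x = ∫⁻ x in Ioi 0, (Iio Y).indicator g x := by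
    intro Y g
    rw [lintegral_indicator measurableSet_Iio, Measure.restrict_restrict measurableSet_Iio,
      inter_comm, Ioi_inter_Iio]
  rw [h, h, ← lintegral_Ioi_comp_mul hc ((Iio (c * X)).indicator f)]
  congr 1
  refine lintegral_congr fun x => ?_
  simp [indicator, hc]

lemma lintegral_Ioo_rpow {p z : ℝ} (hp : -1 < p) (hz : 0 ≤ z) :
    ∫⁻ y in Ioo 0 z, ENNReal.ofReal (y ^ p) = ENNReal.ofReal (z ^ (p + 1) / (p + 1)) := by
  rw [restrict_Ioo_eq_restrict_Ioc, ← ofReal_integral_eq_lintegral_ofReal,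
    ← intervalIntegral.integral_of_le hz,
    integral_rpow (Or.inl hp), Real.zero_rpow (by linarith), sub_zero]
  · exact (intervalIntegrable_iff_integrableOn_Ioc_of_le hz).1 
      (intervalIntegral.intervalIntegrable_rpow' hp)
  · filter_upwards [ae_restrict_mem measurableSet_Ioc] with y hy
    exact Real.rpow_nonneg hy.1.le _

lemma lintegral_Ioi_rpow {p R : ℝ} (hp : p < -1) (hR : 0 < R) :
    ∫⁻ y in Ioi R, ENNReal.ofReal (y ^ p) = ENNReal.ofReal (-R ^ (p + 1) / (p + 1)) := by
  rw [← ofReal_integral_eq_lintegral_ofReal, integral_Ioi_rpow_of_lt hp hR]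
  · exact integrableOn_Ioi_rpow_of_lt hp hR
  · filter_upwards [ae_restrict_mem measurableSet_Ioi] with y hy
    exact Real.rpow_nonneg (hR.trans hy).le _

namespace IsWeight

variable {w : ℝ → ℝ} {δ C : ℝ}

/-- The derivative is `z^{2-δ} (w' + (2-δ) w / z)`, nonnegative by the lower half of `|w'| ≤ (2-δ) w
/ z`. -/
lemma mul_rpow_monotoneOn (hw : IsWeight w δ C) :
    MonotoneOn (fun z => w z * z ^ (2 - δ)) (Ioi 0) := by
  have hd : ∀ z : ℝ, 0 < z → HasDerivAt (fun z => w z * z ^ (2 - δ))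
      (deriv w z * z ^ (2 - δ) + w z * ((2 - δ) * z ^ (2 - δ - 1))) z := fun z hz =>
    (hw.differentiableAt z hz).hasDerivAt.mul (Real.hasDerivAt_rpow_const (Or.inl hz.ne'))
  refine monotoneOn_of_deriv_nonneg (convex_Ioi 0)
    (fun z hz => (hd z hz).continuousAt.continuousWithinAt)
    (fun z hz => (hd z (by simpa using hz)).differentiableAt.differentiableWithinAt)
    fun z hz => ?_
  have hz : 0 < z := by simpa using hz
  rw [(hd z hz).deriv]
  have h1 := neg_le_of_abs_le (hw.abs_deriv_le z hz)
  have h2 : z ^ (2 - δ) = z ^ (2 - δ - 1) * z := by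
    rw [← Real.rpow_add_one hz.ne']; ring_nf
  rw [h2]
  have h3 : deriv w z * (z ^ (2 - δ - 1) * z) + w z * ((2 - δ) * z ^ (2 - δ - 1))
      = z ^ (2 - δ - 1) * z * (deriv w z + (2 - δ) * (w z / z)) := by field_simp
  rw [h3]
  have := Real.rpow_nonneg hz.le (2 - δ - 1)
  have : 0 ≤ deriv w z + (2 - δ) * (w z / z) := by linarith
  positivity

/-- The weighted tail of a profile is controlled by a truncated moment of its measure. -/
lemma tail_le_moment (hw : IsWeight w δ C) (hδ : δ < 2) {F : Profile} {α : ℝ}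
    (h : Tendsto F atTop (𝓝 α)) {R : ℝ} (hR : 0 < R) :
    ENNReal.ofReal (R ^ (2 - δ)) * ∫⁻ z in Ioi R, ENNReal.ofReal (w z / z * (α - F z)) ≤
      ∫⁻ v in Ioi R, ENNReal.ofReal (w v * (v ^ (2 - δ) / (2 - δ))) ∂F.measure := by
  have hm : Measurable fun z => ENNReal.ofReal (w z / z) :=
    (hw.measurable.div measurable_id).ennreal_ofReal
  -- With `α - F z` written as the mass of `(z,∞)`, Tonelli reduces the claim to a bound for `∫_R^v
  -- w(z)/z dz`.
  have h1 : ∫⁻ z in Ioi R, ENNReal.ofReal (w z / z * (α - F z)) =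
      ∫⁻ z in Ioi R, ENNReal.ofReal (w z / z) * ∫⁻ _v in Ioi z, 1 ∂F.measure := by
    refine setLIntegral_congr_fun measurableSet_Ioi fun z hz => ?_
    have hz : 0 < z := hR.trans hz
    have := hw.nonneg z hz
    rw [setLIntegral_one, Profile.measure_Ioi h, ENNReal.ofReal_mul (by positivity)]
  rw [h1, lintegral_mul_lintegral_Ioi_swap _ hm measurable_const,
    ← lintegral_const_mul' _ _ ENNReal.ofReal_ne_top, ← lintegral_indicator measurableSet_Ioi]
  refine lintegral_mono fun v => ?_
  simp only [mul_one, Ioi_inter_Iio]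
  by_cases hv : R < v
  · rw [indicator_of_mem (by exact hv)]
    have hv0 : 0 < v := hR.trans hv
    -- Monotonicity of `w z^{2-δ}` gives `w(z)/z ≤ w(v) v^{2-δ} z^{δ-3}` for `z < v`; the power is
    -- then integrated over all of `(R,∞)`.
    have h2 : ∫⁻ z in Ioo R v, ENNReal.ofReal (w z / z) ≤
        ∫⁻ z in Ioi R, ENNReal.ofReal (w v * v ^ (2 - δ)) * ENNReal.ofReal (z ^ (δ - 3)) := by
      refine (setLIntegral_mono' measurableSet_Ioo fun z hz => ?_).trans
        (lintegral_mono_set Ioo_subset_Ioi_self)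
      have hz0 : 0 < z := hR.trans hz.1
      rw [← ENNReal.ofReal_mul (mul_nonneg (hw.nonneg v hv0) (by positivity))]
      refine ENNReal.ofReal_le_ofReal ?_
      have h3 := hw.mul_rpow_monotoneOn (mem_Ioi.2 hz0) (mem_Ioi.2 hv0) hz.2.le
      have h4 : w z / z = w z * z ^ (2 - δ) * z ^ (δ - 3) := by
        rw [mul_assoc, ← Real.rpow_add hz0, show 2 - δ + (δ - 3) = -1 by ring, Real.rpow_neg_one]
        rfl
      rw [h4]
      exact mul_le_mul_of_nonneg_right h3 (Real.rpow_nonneg hz0.le _)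
    have hwv := hw.nonneg v hv0
    rw [lintegral_const_mul' _ _ ENNReal.ofReal_ne_top, lintegral_Ioi_rpow (by linarith) hR,
      ← ENNReal.ofReal_mul (by positivity)] at h2
    refine (mul_le_mul_right h2 _).trans ?_
    rw [← ENNReal.ofReal_mul (by positivity)]
    refine ENNReal.ofReal_le_ofReal (le_of_eq ?_)
    have h5 : R ^ (2 - δ) * R ^ (δ - 3 + 1) = 1 := by
      rw [← Real.rpow_add hR]; ring_nf; simp
    have h6 : (2 - δ) ≠ 0 := by linarith
    have h7 : δ - 3 + 1 = -(2 - δ) := by ring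
    calc _ = w v * v ^ (2 - δ) * (R ^ (2 - δ) * R ^ (δ - 3 + 1)) * (-1 / (δ - 3 + 1)) := by ring
      _ = _ := by rw [h5, h7]; field_simp
  · have : Ioo R v = ∅ := Ioo_eq_empty hv
    simp [this]

/-- Tonelli and `∫_0^v y^{1-δ} dy = v^{2-δ}/(2-δ)`. The left side is what integration along
characteristics produces, the right side is the moment that dominates the tails in `tail_le_moment`.
-/
lemma moment_eq (hw : IsWeight w δ C) (hδ : δ < 2) (μ : Measure ℝ) [SFinite μ] :
    ∫⁻ y in Ioi 0, ENNReal.ofReal (y ^ (1 - δ)) * ∫⁻ v in Ioi y, ENNReal.ofReal (w v) ∂μ =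
      ∫⁻ v in Ioi 0, ENNReal.ofReal (w v * (v ^ (2 - δ) / (2 - δ))) ∂μ := by
  rw [lintegral_mul_lintegral_Ioi_swap _ (by fun_prop)
    hw.measurable.ennreal_ofReal, ← lintegral_indicator measurableSet_Ioi]
  refine lintegral_congr fun v => ?_
  rw [Ioi_inter_Iio]
  by_cases hv : 0 < v
  · rw [indicator_of_mem (by exact hv), lintegral_Ioo_rpow (by linarith) hv.le, mul_comm (w v),
      ENNReal.ofReal_mul, show 1 - δ + 1 = 2 - δ by ring]
    have : 0 < 2 - δ := by linarith
    positivity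
  · simp [hv]

end IsWeight
end

/-! ### Solutions of the fixed point equation and their tail functional -/

noncomputable section

/-- Measurable families of profiles of mass `α` that solve `F = 𝒞*(F)` for the weight `w`. -/
structure IsFlow (w : ℝ → ℝ) (α : ℝ) (F : ℝ≥0 → Profile) : Prop where
  measurable : ∀ x, Measurable fun t => F t x
  mass : ∀ t, Tendsto (F t) atTop (𝓝 α)
  norm_le : ∀ t, wnorm 1 (F t) ≤ 1
  fixed : ∀ t x, 0 ≤ x → F t x = F 0 (Real.exp (-(t : ℝ)) * x) +
    ∫ s in (0 : ℝ)..t, (Real.exp (s - t) * x) ^ 2 *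
      ∫ z in Ioi (Real.exp (s - t) * x), w z ∂(F s.toNNReal).measure

/-- The integral of the weight over `(y,∞)` against the measure with tail `T`. -/
def tailOp (w T : ℝ → ℝ) (y : ℝ) : ℝ := w y * T y + ∫ z in Ioi y, deriv w z * T z

/-- On `(0,1]` the weight `x^{-1-δ}` is at most `x^{-2}`, which contributes at most `1`; on `(1,∞)`
the profile is at most one and the weight integrates to `δ⁻¹`. -/
lemma wnorm_one_bound {δ : ℝ} (hδ0 : 0 < δ) (hδ1 : δ ≤ 1) {F : Profile} (h : wnorm 1 F ≤ 1) :
    wnorm δ F ≤ ENNReal.ofReal (1 + δ⁻¹) := by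
  have hsplit : Ioi (0 : ℝ) = Ioc 0 1 ∪ Ioi 1 := (Ioc_union_Ioi_eq_Ioi zero_le_one).symm
  rw [wnorm, hsplit, lintegral_union measurableSet_Ioi (Set.Ioc_disjoint_Ioi le_rfl),
    ENNReal.ofReal_add zero_le_one (by positivity), ENNReal.ofReal_one]
  refine add_le_add ?_ ?_
  · refine le_trans ?_ h
    refine (setLIntegral_mono' measurableSet_Ioc fun x hx => ?_).trans
      (lintegral_mono_set Ioc_subset_Ioi_self)
    refine ENNReal.ofReal_le_ofReal (mul_le_mul_of_nonneg_right ?_ (abs_nonneg _))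
    exact Real.rpow_le_rpow_of_exponent_ge hx.1 hx.2 (by linarith)
  · have h1 : ∫⁻ x in Ioi (1 : ℝ), ENNReal.ofReal (x ^ (-1 - δ)) = ENNReal.ofReal δ⁻¹ := by
      rw [lintegral_Ioi_rpow (by linarith) one_pos]
      congr 1
      rw [Real.one_rpow, show -1 - δ + 1 = -δ by ring, neg_div_neg_eq, one_div]
    rw [← h1]
    refine setLIntegral_mono' measurableSet_Ioi fun x hx => ENNReal.ofReal_le_ofReal ?_
    refine mul_le_of_le_one_right (Real.rpow_nonneg (zero_le_one.trans (le_of_lt hx)) _) ?_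
    rw [abs_of_nonneg (F.nonneg x)]
    exact F.le_one x

/-- A family of right-continuous functions that is measurable in the parameter is jointly
measurable. -/
lemma measurable_uncurry_profile {F : ℝ≥0 → Profile} (hF : ∀ x, Measurable fun t => F t x) :
    Measurable fun p : ℝ × ℝ => F p.1.toNNReal p.2 := by
  -- The second argument is moved to a grid point strictly to its right, at distance at most
  -- `1/(n+1)`: right-continuity gives the limit, and only countably many arguments occur for each
  -- `n`.
  have hlim : Tendsto (fun (n : ℕ) (p : ℝ × ℝ) =>
      F p.1.toNNReal ((⌊p.2 * (n + 1 : ℝ)⌋ + 1 : ℝ) / (n + 1))) atTop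
      (𝓝 fun p => F p.1.toNNReal p.2) := by
    rw [tendsto_pi_nhds]
    rintro ⟨s, x⟩
    have hr := (F s.toNNReal).right_continuous x
    refine hr.tendsto.comp (tendsto_nhdsWithin_iff.2 ⟨?_, Eventually.of_forall fun n => ?_⟩)
    · have h1 : Tendsto (fun n : ℕ => x + 1 / ((n : ℝ) + 1)) atTop (𝓝 x) := by
        simpa using tendsto_const_nhds.add (tendsto_one_div_add_atTop_nhds_zero_nat (𝕜 := ℝ))
      refine tendsto_of_tendsto_of_tendsto_of_le_of_le tendsto_const_nhds h1 (fun n => ?_)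
        fun n => ?_
      · have hn : (0 : ℝ) < n + 1 := by positivity
        simp only
        rw [le_div_iff₀ hn]
        exact (Int.lt_floor_add_one _).le
      · have hn : (0 : ℝ) < n + 1 := by positivity
        simp only
        rw [div_le_iff₀ hn, add_mul, one_div, inv_mul_cancel₀ hn.ne']
        gcongr
        exact Int.floor_le _
    · have hn : (0 : ℝ) < n + 1 := by positivity
      simp only [mem_Ici]
      rw [le_div_iff₀ hn]
      exact (Int.lt_floor_add_one _).le
  refine measurable_of_tendsto_metrizable (fun n => ?_) hlim
  have h2 : Measurable (Function.uncurry fun (s : ℝ) (k : ℤ) =>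
      F s.toNNReal ((k + 1 : ℝ) / (n + 1))) := by
    refine measurable_from_prod_countable_left fun k => ?_
    exact (hF ((k + 1 : ℝ) / (n + 1))).comp measurable_real_toNNReal
  have h3 : Measurable fun p : ℝ × ℝ => (p.1, ⌊p.2 * (n + 1 : ℝ)⌋) :=
    measurable_fst.prodMk (Int.measurable_floor.comp (measurable_snd.mul_const _))
  exact h2.comp h3

lemma measurable_setIntegral_Ioi {f : ℝ → ℝ → ℝ} (hf : Measurable fun p : ℝ × ℝ => f p.1 p.2) :
    Measurable fun p : ℝ × ℝ => ∫ z in Ioi p.2, f p.1 z := by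
  have h1 : ∀ p : ℝ × ℝ, ∫ z in Ioi p.2, f p.1 z = ∫ z, if p.2 < z then f p.1 z else 0 := by
    intro p
    rw [← integral_indicator measurableSet_Ioi]
    rfl
  simp_rw [h1]
  have h2 : Measurable fun q : (ℝ × ℝ) × ℝ => if q.1.2 < q.2 then f q.1.1 q.2 else 0 :=
    Measurable.ite (measurableSet_lt (by fun_prop) (by fun_prop))
      (hf.comp ((measurable_fst.comp measurable_fst).prodMk measurable_snd)) measurable_const
  exact (h2.stronglyMeasurable.integral_prod_right').measurable

lemma measurable_setLIntegral_Ioi {f : ℝ → ℝ → ℝ≥0∞}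
    (hf : Measurable fun p : ℝ × ℝ => f p.1 p.2) :
    Measurable fun p : ℝ × ℝ => ∫⁻ z in Ioi p.2, f p.1 z := by
  have h1 : ∀ p : ℝ × ℝ, ∫⁻ z in Ioi p.2, f p.1 z = ∫⁻ z, if p.2 < z then f p.1 z else 0 := by
    intro p
    rw [← lintegral_indicator measurableSet_Ioi]
    rfl
  simp_rw [h1]
  have h2 : Measurable fun q : (ℝ × ℝ) × ℝ => if q.1.2 < q.2 then f q.1.1 q.2 else 0 :=
    Measurable.ite (measurableSet_lt (by fun_prop) (by fun_prop))
      (hf.comp ((measurable_fst.comp measurable_fst).prodMk measurable_snd)) measurable_const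
  exact h2.lintegral_prod_right'

lemma measurable_tailOp {w : ℝ → ℝ} (hw : Measurable w) {T : ℝ → ℝ → ℝ}
    (hT : Measurable fun p : ℝ × ℝ => T p.1 p.2) :
    Measurable fun p : ℝ × ℝ => tailOp w (T p.1) p.2 :=
  ((hw.comp measurable_snd).mul hT).add (measurable_setIntegral_Ioi
    (f := fun s z => deriv w z * T s z) (((measurable_deriv w).comp measurable_snd).mul hT))

namespace IsFlow

variable {w : ℝ → ℝ} {δ C α : ℝ} {F : ℝ≥0 → Profile}

lemma measurable_uncurry (hF : IsFlow w α F) :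
    Measurable fun p : ℝ × ℝ => F p.1.toNNReal p.2 :=
  measurable_uncurry_profile hF.measurable

lemma mass_nonneg (hF : IsFlow w α F) : 0 ≤ α :=
  ((F 0).nonneg 0).trans (Profile.le_of_tendsto (hF.mass 0) 0)

lemma measurable_tailOp (hw : IsWeight w δ C) (hF : IsFlow w α F) :
    Measurable fun p : ℝ × ℝ => tailOp w (fun z => α - F p.1.toNNReal z) p.2 :=
  _root_.measurable_tailOp hw.measurable (T := fun s z => α - F s.toNNReal z)
    (measurable_const.sub hF.measurable_uncurry)

/-- Passes from the integral against a measure to `tailOp`, which also makes sense for the signed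
difference of two solutions. -/
lemma tailOp_eq (hw : IsWeight w δ C) (hδ : δ ≤ 2) (hF : IsFlow w α F) (s : ℝ≥0) {y : ℝ}
    (hy : 0 < y) :
    tailOp w (fun z => α - F s z) y = ∫ z in Ioi y, w z ∂(F s).measure :=
  (hw.integral_stieltjes hδ (hF.mass s) hy).symm

lemma tailOp_nonneg (hw : IsWeight w δ C) (hδ : δ ≤ 2) (hF : IsFlow w α F) (s : ℝ≥0) {y : ℝ}
    (hy : 0 < y) : 0 ≤ tailOp w (fun z => α - F s z) y := by
  rw [hF.tailOp_eq hw hδ s hy]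
  exact setIntegral_nonneg measurableSet_Ioi fun z hz => hw.nonneg z (hy.trans hz)

lemma tailOp_le (hw : IsWeight w δ C) (hδ : δ ≤ 2) (hF : IsFlow w α F) (s : ℝ≥0) {y : ℝ}
    (hy : 0 < y) : tailOp w (fun z => α - F s z) y ≤ C / y * α := by
  rw [hF.tailOp_eq hw hδ s hy]
  have := Profile.isFiniteMeasure_restrict (hF.mass s) y
  have hC := hw.const_nonneg
  calc ∫ z in Ioi y, w z ∂(F s).measure ≤ ∫ _z in Ioi y, C / y ∂(F s).measure := by
        refine setIntegral_mono_on (hw.integrableOn_stieltjes (hF.mass s) hy)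
          (integrable_const _) measurableSet_Ioi fun z hz => ?_
        refine (hw.le z (hy.trans hz)).trans ?_
        gcongr
        exact le_of_lt hz
    _ = C / y * (α - F s y) := by
        rw [setIntegral_const, measureReal_def, Profile.measure_Ioi (hF.mass s),
          ENNReal.toReal_ofReal (sub_nonneg.2 (Profile.le_of_tendsto (hF.mass s) y)), smul_eq_mul,
          mul_comm]
    _ ≤ C / y * α := by
        gcongr
        linarith [(F s).nonneg y]

lemma ofReal_tailOp (hw : IsWeight w δ C) (hδ : δ ≤ 2) (hF : IsFlow w α F) (s : ℝ≥0) {y : ℝ}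
    (hy : 0 < y) : ENNReal.ofReal (tailOp w (fun z => α - F s z) y) =
      ∫⁻ v in Ioi y, ENNReal.ofReal (w v) ∂(F s).measure := by
  rw [hF.tailOp_eq hw hδ s hy, ofReal_integral_eq_lintegral_ofReal
    (hw.integrableOn_stieltjes (hF.mass s) hy)]
  filter_upwards [ae_restrict_mem measurableSet_Ioi] with z hz
  exact hw.nonneg z (hy.trans hz)

/-- The fixed point equation along the characteristic through `x`. -/
lemma eq_along (hw : IsWeight w δ C) (hδ : δ ≤ 2) (hF : IsFlow w α F) (t : ℝ≥0) {x : ℝ}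
    (hx : 0 < x) :
    F t (Real.exp t * x) = F 0 x + ∫ s in (0 : ℝ)..t,
      (Real.exp s * x) ^ 2 * tailOp w (fun z => α - F s.toNNReal z) (Real.exp s * x) := by
  rw [hF.fixed t _ (by positivity)]
  have h1 : ∀ s : ℝ, Real.exp (s - t) * (Real.exp t * x) = Real.exp s * x := fun s => by
    rw [← mul_assoc, ← Real.exp_add]; ring_nf
  have h2 : Real.exp (-(t : ℝ)) * (Real.exp t * x) = x := by
    rw [← mul_assoc, ← Real.exp_add]; simp
  rw [h2]
  congr 1
  refine intervalIntegral.integral_congr fun s _ => ?_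
  rw [h1, hF.tailOp_eq hw hδ _ (by positivity)]

end IsFlow
end

/-! ### Change of variables along characteristics, finite moments, vanishing tails -/

noncomputable section

/-- With `y = e^s x` this says `x^{-1-δ} y² dx = e^{δs} y^{1-δ} dy`; the isolated factor `e^s` is
the Jacobian. -/
lemma rpow_mul_sq_scale {δ s x : ℝ} (hx : 0 < x) :
    x ^ (-1 - δ) * (Real.exp s * x) ^ 2 =
      Real.exp (δ * s) * (Real.exp s * (Real.exp s * x) ^ (1 - δ)) := by
  have hc := Real.exp_pos s
  have h1 : (Real.exp s * x) ^ (1 - δ) = Real.exp s ^ (1 - δ) * x ^ (1 - δ) :=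
    Real.mul_rpow hc.le hx.le
  have h2 : Real.exp s ^ (1 - δ) = Real.exp (s * (1 - δ)) := by rw [Real.exp_mul]
  have h3 : x ^ (1 - δ) = x ^ (-1 - δ) * x ^ 2 := by
    rw [← Real.rpow_natCast, ← Real.rpow_add hx]; norm_num; ring_nf
  have h4 : Real.exp (δ * s) * (Real.exp s * Real.exp (s * (1 - δ))) = Real.exp s ^ 2 := by
    rw [← Real.exp_add, ← Real.exp_add, ← Real.exp_nat_mul]; congr 1; push_cast; ring
  rw [h1, h2, h3, mul_pow]
  linear_combination (-(x ^ (-1 - δ) * x ^ 2)) * h4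

lemma lintegral_Ioi_scale (δ s : ℝ) {h : ℝ → ℝ≥0∞} (hh : Measurable h) :
    ∫⁻ x in Ioi 0, ENNReal.ofReal (x ^ (-1 - δ)) *
        (ENNReal.ofReal ((Real.exp s * x) ^ 2) * h (Real.exp s * x)) =
      ENNReal.ofReal (Real.exp (δ * s)) *
        ∫⁻ y in Ioi 0, ENNReal.ofReal (y ^ (1 - δ)) * h y := by
  rw [← lintegral_Ioi_comp_mul (Real.exp_pos s) fun y => ENNReal.ofReal (y ^ (1 - δ)) * h y,
    ← lintegral_const_mul _ (by fun_prop),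
    ← lintegral_const_mul _ (by fun_prop)]
  refine setLIntegral_congr_fun measurableSet_Ioi fun x hx => ?_
  have hx : 0 < x := hx
  rw [← mul_assoc, ← mul_assoc, ← mul_assoc, ← ENNReal.ofReal_mul (by positivity),
    ← ENNReal.ofReal_mul (by positivity), ← ENNReal.ofReal_mul (by positivity),
    rpow_mul_sq_scale hx, mul_assoc]

lemma lintegral_Ioo_scale (δ s X : ℝ) {h : ℝ → ℝ≥0∞} (hh : Measurable h) :
    ∫⁻ x in Ioo 0 X, ENNReal.ofReal (x ^ (-1 - δ)) *
        (ENNReal.ofReal ((Real.exp s * x) ^ 2) * h (Real.exp s * x)) =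
      ENNReal.ofReal (Real.exp (δ * s)) *
        ∫⁻ y in Ioo 0 (Real.exp s * X), ENNReal.ofReal (y ^ (1 - δ)) * h y := by
  rw [← lintegral_Ioo_comp_mul (Real.exp_pos s) X fun y => ENNReal.ofReal (y ^ (1 - δ)) * h y,
    ← lintegral_const_mul _ (by fun_prop),
    ← lintegral_const_mul _ (by fun_prop)]
  refine setLIntegral_congr_fun measurableSet_Ioo fun x hx => ?_
  have hx : 0 < x := hx.1
  rw [← mul_assoc, ← mul_assoc, ← mul_assoc, ← ENNReal.ofReal_mul (by positivity),
    ← ENNReal.ofReal_mul (by positivity), ← ENNReal.ofReal_mul (by positivity),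
    rpow_mul_sq_scale hx, mul_assoc]

/-- The factor `e^{δs}` gained by following characteristics is the source of the decay rate. -/
lemma wnorm_scale (δ s : ℝ) {f : ℝ → ℝ} (hf : Measurable f) :
    ∫⁻ x in Ioi 0, ENNReal.ofReal (x ^ (-1 - δ)) * ENNReal.ofReal |f (Real.exp s * x)| =
      ENNReal.ofReal (Real.exp (δ * s)) * wnorm δ f := by
  rw [wnorm, ← lintegral_Ioi_comp_mul (Real.exp_pos s)
    fun y => ENNReal.ofReal (y ^ (-1 - δ) * |f y|), ← lintegral_const_mul _ (by fun_prop),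
    ← lintegral_const_mul _ (by fun_prop)]
  refine setLIntegral_congr_fun measurableSet_Ioi fun x hx => ?_
  have hx : 0 < x := hx
  rw [← ENNReal.ofReal_mul (by positivity), ← ENNReal.ofReal_mul (by positivity),
    ← ENNReal.ofReal_mul (by positivity), Real.mul_rpow (Real.exp_pos s).le hx.le,
    ← Real.exp_mul]
  have h4 : Real.exp (δ * s) * (Real.exp s * Real.exp (s * (-1 - δ))) = 1 := by
    rw [← Real.exp_add, ← Real.exp_add, Real.exp_eq_one_iff]; ring
  congr 1
  linear_combination (-(x ^ (-1 - δ) * |f (Real.exp s * x)|)) * h4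

namespace IsFlow

variable {w : ℝ → ℝ} {δ C α : ℝ} {F : ℝ≥0 → Profile}

lemma measurable_along (hw : IsWeight w δ C) (hF : IsFlow w α F) :
    Measurable fun p : ℝ × ℝ => (Real.exp p.1 * p.2) ^ 2 *
      tailOp w (fun z => α - F p.1.toNNReal z) (Real.exp p.1 * p.2) := by
  refine Measurable.mul (by fun_prop) ?_
  exact (hF.measurable_tailOp hw).comp
    (measurable_fst.prodMk (by fun_prop : Measurable fun p : ℝ × ℝ => Real.exp p.1 * p.2))

lemma along_nonneg (hw : IsWeight w δ C) (hδ : δ ≤ 2) (hF : IsFlow w α F) (s : ℝ) {x : ℝ}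
    (hx : 0 < x) : 0 ≤ (Real.exp s * x) ^ 2 *
      tailOp w (fun z => α - F s.toNNReal z) (Real.exp s * x) :=
  mul_nonneg (sq_nonneg _) (hF.tailOp_nonneg hw hδ _ (by positivity))

lemma along_le (hw : IsWeight w δ C) (hδ : δ ≤ 2) (hF : IsFlow w α F) {s t : ℝ} (hst : s ≤ t)
    {x : ℝ} (hx : 0 < x) : (Real.exp s * x) ^ 2 *
      tailOp w (fun z => α - F s.toNNReal z) (Real.exp s * x) ≤ C * α * (Real.exp t * x) := by
  have hC := hw.const_nonneg
  have hα := hF.mass_nonneg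
  calc _ ≤ (Real.exp s * x) ^ 2 * (C / (Real.exp s * x) * α) := by
        gcongr
        exact hF.tailOp_le hw hδ _ (by positivity)
    _ = C * α * (Real.exp s * x) := by field_simp
    _ ≤ _ := by gcongr

lemma intervalIntegrable_along (hw : IsWeight w δ C) (hδ : δ ≤ 2) (hF : IsFlow w α F) {t : ℝ}
    (ht : 0 ≤ t) {x : ℝ} (hx : 0 < x) : IntervalIntegrable (fun s => (Real.exp s * x) ^ 2 *
      tailOp w (fun z => α - F s.toNNReal z) (Real.exp s * x)) volume 0 t := by
  rw [intervalIntegrable_iff_integrableOn_Ioc_of_le ht]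
  refine Integrable.mono' (integrable_const (C * α * (Real.exp t * x)))
    ((hF.measurable_along hw).comp (measurable_id.prodMk measurable_const)).aestronglyMeasurable ?_
  filter_upwards [ae_restrict_mem measurableSet_Ioc] with s hs
  rw [Real.norm_of_nonneg (hF.along_nonneg hw hδ s hx)]
  exact hF.along_le hw hδ hs.2 hx

/-- Finiteness of the time integral of the moments of order `2-δ` against the weight. -/
theorem lintegral_moment_lt_top (hw : IsWeight w δ C) (hδ0 : 0 < δ) (hδ1 : δ ≤ 1)
    (hF : IsFlow w α F) (t : ℝ≥0) :
    ∫⁻ s in Ioc 0 (t : ℝ), ENNReal.ofReal (Real.exp (δ * s)) *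
      ∫⁻ y in Ioi 0, ENNReal.ofReal (y ^ (1 - δ)) *
        ENNReal.ofReal (tailOp w (fun z => α - F s.toNNReal z) y) < ∞ := by
  have hδ : δ ≤ 2 := by linarith
  have hm := hF.measurable_along hw
  have hm' := hF.measurable_tailOp hw
  have h1 : ∀ s : ℝ, ENNReal.ofReal (Real.exp (δ * s)) *
      ∫⁻ y in Ioi 0, ENNReal.ofReal (y ^ (1 - δ)) *
        ENNReal.ofReal (tailOp w (fun z => α - F s.toNNReal z) y) =
      ∫⁻ x in Ioi 0, ENNReal.ofReal (x ^ (-1 - δ)) * ENNReal.ofReal ((Real.exp s * x) ^ 2 *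
        tailOp w (fun z => α - F s.toNNReal z) (Real.exp s * x)) := by
    intro s
    rw [← lintegral_Ioi_scale]
    · simp_rw [ENNReal.ofReal_mul (sq_nonneg _)]
    · exact (hm'.comp (measurable_const.prodMk measurable_id)).ennreal_ofReal
  simp_rw [h1]
  rw [lintegral_lintegral_swap]
  -- For fixed `x` the time integral is `F_t(e^t x) - F_0(x) ≤ F_t(e^t x)`, and integration against
  -- `x^{-1-δ} dx` turns this bound into `e^{δt} ‖F_t‖_δ`.
  · refine lt_of_le_of_lt (setLIntegral_mono' measurableSet_Ioi
      (g := fun x => ENNReal.ofReal (x ^ (-1 - δ)) * ENNReal.ofReal |F t (Real.exp t * x)|)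
      fun x hx => ?_) ?_
    · rw [lintegral_const_mul' _ _ ENNReal.ofReal_ne_top]
      refine mul_le_mul_right ?_ _
      rw [← ofReal_integral_eq_lintegral_ofReal
        ((intervalIntegrable_iff_integrableOn_Ioc_of_le t.coe_nonneg).1
          (hF.intervalIntegrable_along hw hδ t.coe_nonneg hx))
        (Eventually.of_forall fun s => hF.along_nonneg hw hδ s hx),
        ← intervalIntegral.integral_of_le t.coe_nonneg]
      refine ENNReal.ofReal_le_ofReal (le_trans ?_ (le_abs_self _))
      rw [hF.eq_along hw hδ t hx]
      linarith [(F 0).nonneg x]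
    · rw [wnorm_scale δ t (F t).measurable]
      refine ENNReal.mul_lt_top ENNReal.ofReal_lt_top ?_
      exact (wnorm_one_bound hδ0 hδ1 (hF.norm_le t)).trans_lt ENNReal.ofReal_lt_top
  · refine Measurable.aemeasurable ?_
    exact Measurable.mul (by fun_prop) hm.ennreal_ofReal

/-- The part of the energy lost beyond the cutoff `X` vanishes as `X → ∞`. -/
theorem tendsto_lintegral_tail (hw : IsWeight w δ C) (hδ0 : 0 < δ) (hδ1 : δ ≤ 1)
    (hF : IsFlow w α F) (t : ℝ≥0) :
    Tendsto (fun n : ℕ => ∫⁻ s in Ioc 0 (t : ℝ), ENNReal.ofReal (Real.exp (δ * s)) *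
      (ENNReal.ofReal ((Real.exp s * (n + 1 : ℝ)) ^ (2 - δ)) *
        ∫⁻ z in Ioi (Real.exp s * (n + 1 : ℝ)),
          ENNReal.ofReal (w z / z * (α - F s.toNNReal z)))) atTop (𝓝 0) := by
  have hδ : δ ≤ 2 := by linarith
  have hδ' : δ < 2 := by linarith
  set J : ℝ → ℝ≥0∞ := fun s => ∫⁻ y in Ioi 0, ENNReal.ofReal (y ^ (1 - δ)) *
        ENNReal.ofReal (tailOp w (fun z => α - F s.toNNReal z) y) with hJ
  have hJeq : ∀ s, J s = ∫⁻ v in Ioi 0, ENNReal.ofReal (w v * (v ^ (2 - δ) / (2 - δ)))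
      ∂(F s.toNNReal).measure := by
    intro s
    rw [← hw.moment_eq hδ']
    refine setLIntegral_congr_fun measurableSet_Ioi fun y hy => ?_
    rw [hF.ofReal_tailOp hw hδ _ hy]
  have htail : ∀ (s : ℝ) (n : ℕ), ENNReal.ofReal ((Real.exp s * (n + 1 : ℝ)) ^ (2 - δ)) *
        ∫⁻ z in Ioi (Real.exp s * (n + 1 : ℝ)),
          ENNReal.ofReal (w z / z * (α - F s.toNNReal z)) ≤
      ∫⁻ v in Ioi (Real.exp s * (n + 1 : ℝ)), ENNReal.ofReal (w v * (v ^ (2 - δ) / (2 - δ)))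
      ∂(F s.toNNReal).measure := fun s n =>
    hw.tail_le_moment hδ' (hF.mass _) (by positivity)
  have hfin := hF.lintegral_moment_lt_top hw hδ0 hδ1 t
  have hm := hF.measurable_uncurry
  have hJm : Measurable J := by
    have : Measurable fun p : ℝ × ℝ => ENNReal.ofReal (p.2 ^ (1 - δ)) *
        ENNReal.ofReal (tailOp w (fun z => α - F p.1.toNNReal z) p.2) :=
      Measurable.mul (by fun_prop) (hF.measurable_tailOp hw).ennreal_ofReal
    exact this.lintegral_prod_right'
  have hmw : Measurable fun v => ENNReal.ofReal (w v * (v ^ (2 - δ) / (2 - δ))) := by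
    have := hw.measurable
    fun_prop
  rw [show (0 : ℝ≥0∞) = ∫⁻ _s in Ioc 0 (t : ℝ), 0 by simp]
  -- Dominated convergence twice. In time the majorant is the full moment `J`. Since `J` has a
  -- finite time integral it is finite for almost every `s`, and for such `s` it dominates the
  -- moments over the windows `(e^s (n+1), ∞)`, which shrink to the empty set.
  refine tendsto_lintegral_of_dominated_convergence
    (fun s => ENNReal.ofReal (Real.exp (δ * s)) * J s) (fun n => ?_) (fun n => ?_) hfin.ne ?_
  · refine Measurable.mul (by fun_prop) (Measurable.mul (by fun_prop) ?_)
    have h1 : Measurable fun p : ℝ × ℝ => ENNReal.ofReal (w p.2 / p.2 * (α - F p.1.toNNReal p.2)) :=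
      (((hw.measurable.comp measurable_snd).div measurable_snd).mul
        (measurable_const.sub hm)).ennreal_ofReal
    exact (measurable_setLIntegral_Ioi
      (f := fun s z => ENNReal.ofReal (w z / z * (α - F s.toNNReal z))) h1).comp
      (measurable_id.prodMk (by fun_prop : Measurable fun s : ℝ => Real.exp s * (n + 1 : ℝ)))
  · refine Eventually.of_forall fun s => mul_le_mul_right ((htail s n).trans ?_) _
    rw [hJeq]
    exact lintegral_mono_set (Ioi_subset_Ioi (by positivity))
  · have hexp : Measurable fun s : ℝ => ENNReal.ofReal (Real.exp (δ * s)) := by fun_prop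
    have hae := ae_lt_top' (hexp.mul hJm).aemeasurable hfin.ne
    filter_upwards [hae] with s hs
    have hJs : J s ≠ ∞ := by
      intro h
      change ENNReal.ofReal (Real.exp (δ * s)) * J s < ∞ at hs
      rw [h, ENNReal.mul_top (by simp [Real.exp_pos])] at hs
      exact lt_irrefl _ hs
    rw [← mul_zero (ENNReal.ofReal (Real.exp (δ * s)))]
    refine ENNReal.Tendsto.const_mul ?_ (Or.inr ENNReal.ofReal_ne_top)
    refine tendsto_of_tendsto_of_tendsto_of_le_of_le tendsto_const_nhds ?_ (fun _ => zero_le)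
      (htail s)
    have h0 : ∀ n : ℕ, ∫⁻ v in Ioi (Real.exp s * (n + 1 : ℝ)),
        ENNReal.ofReal (w v * (v ^ (2 - δ) / (2 - δ))) ∂(F s.toNNReal).measure =
        ∫⁻ v in Ioi 0, (Ioi (Real.exp s * (n + 1 : ℝ))).indicator (fun v =>
        ENNReal.ofReal (w v * (v ^ (2 - δ) / (2 - δ)))) v ∂(F s.toNNReal).measure := by
      intro n
      have h2 : (0 : ℝ) ≤ Real.exp s * (n + 1 : ℝ) := by positivity
      rw [lintegral_indicator measurableSet_Ioi, Measure.restrict_restrict measurableSet_Ioi,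
        Ioi_inter_Ioi, sup_of_le_left h2]
    simp_rw [h0]
    rw [show (0 : ℝ≥0∞) = ∫⁻ _v in Ioi 0, 0 ∂(F s.toNNReal).measure by simp]
    refine tendsto_lintegral_of_dominated_convergence
      (fun v => ENNReal.ofReal (w v * (v ^ (2 - δ) / (2 - δ))))
      (fun n => hmw.indicator measurableSet_Ioi)
      (fun n => Eventually.of_forall fun v => indicator_le_self _ _ _) ?_ ?_
    · rw [← hJeq]; exact hJs
    · refine Eventually.of_forall fun v => tendsto_const_nhds.congr' ?_
      have h3 : Tendsto (fun n : ℕ => Real.exp s * (n + 1 : ℝ)) atTop atTop :=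
        (tendsto_atTop_add_const_right _ _ tendsto_natCast_atTop_atTop).const_mul_atTop
          (Real.exp_pos s)
      filter_upwards [h3.eventually_ge_atTop v] with n hn
      rw [indicator_of_notMem]
      simpa using hn

end IsFlow
end

/-! ### The energy balance along one characteristic and the cancellation of gain and loss -/

noncomputable section

lemma integral_Ioi_inv_sq {y : ℝ} (hy : 0 < y) : ∫ z in Ioi y, (z ^ 2)⁻¹ = y⁻¹ := by
  have h := integral_Ioi_rpow_of_lt (a := -2) (by norm_num) hy
  have h2 : ∫ z in Ioi y, (z ^ 2)⁻¹ = ∫ z in Ioi y, z ^ (-2 : ℝ) := by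
    refine setIntegral_congr_fun measurableSet_Ioi fun z hz => ?_
    have hz : 0 < z := hy.trans hz
    rw [Real.rpow_neg hz.le]; norm_cast
  rw [h2, h]
  norm_num
  rw [Real.rpow_neg_one]

namespace IsWeight

variable {w : ℝ → ℝ} {δ C M : ℝ} {g : ℝ → ℝ}

lemma div_mul_abs_le (hw : IsWeight w δ C) (hδ : δ ≤ 2) (hg : ∀ z, |g z| ≤ M) {z : ℝ}
    (hz : 0 < z) : (2 - δ) * (w z / z * |g z|) ≤ (2 - δ) * C * M * (z ^ 2)⁻¹ := by
  have hC := hw.const_nonneg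
  have hM : 0 ≤ M := (abs_nonneg _).trans (hg 0)
  have h2 : 0 ≤ 2 - δ := by linarith
  calc (2 - δ) * (w z / z * |g z|) ≤ (2 - δ) * (C / z / z * M) := by
        gcongr
        · exact hw.le z hz
        · exact hg z
    _ = _ := by field_simp

lemma div_mul_abs_nonneg (hw : IsWeight w δ C) (hδ : δ ≤ 2) {z : ℝ}
    (hz : 0 < z) : 0 ≤ (2 - δ) * (w z / z * |g z|) := by
  have h2 : 0 ≤ 2 - δ := by linarith
  have := hw.nonneg z hz
  positivity

lemma integrableOn_div_mul_abs (hw : IsWeight w δ C) (hδ : δ ≤ 2) (hgm : Measurable g)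
    (hg : ∀ z, |g z| ≤ M) {y : ℝ} (hy : 0 < y) :
    IntegrableOn (fun z => (2 - δ) * (w z / z * |g z|)) (Ioi y) := by
  have := hw.measurable
  refine Integrable.mono' ((integrableOn_inv_sq hy).const_mul ((2 - δ) * C * M))
    (Measurable.aestronglyMeasurable (by fun_prop)) ?_
  filter_upwards [ae_restrict_mem measurableSet_Ioi] with z hz
  rw [Real.norm_of_nonneg (hw.div_mul_abs_nonneg hδ (hy.trans hz))]
  exact hw.div_mul_abs_le hδ hg (hy.trans hz)

lemma integral_div_mul_abs_nonneg (hw : IsWeight w δ C) (hδ : δ ≤ 2) {y : ℝ} (hy : 0 < y) :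
    0 ≤ ∫ z in Ioi y, (2 - δ) * (w z / z * |g z|) :=
  setIntegral_nonneg measurableSet_Ioi fun _ hz => hw.div_mul_abs_nonneg hδ (hy.trans hz)

lemma integral_div_mul_abs_le (hw : IsWeight w δ C) (hδ : δ ≤ 2) (hgm : Measurable g)
    (hg : ∀ z, |g z| ≤ M) {y : ℝ} (hy : 0 < y) :
    ∫ z in Ioi y, (2 - δ) * (w z / z * |g z|) ≤ (2 - δ) * C * M / y := by
  rw [div_eq_mul_inv, ← integral_Ioi_inv_sq hy, ← integral_const_mul]
  exact setIntegral_mono_on (hw.integrableOn_div_mul_abs hδ hgm hg hy)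
    ((integrableOn_inv_sq hy).const_mul _) measurableSet_Ioi
    fun z hz => hw.div_mul_abs_le hδ hg (hy.trans hz)

lemma integrableOn_deriv_mul (hw : IsWeight w δ C) (hδ : δ ≤ 2) (hgm : Measurable g)
    (hg : ∀ z, |g z| ≤ M) {y : ℝ} (hy : 0 < y) :
    IntegrableOn (fun z => deriv w z * g z) (Ioi y) := by
  refine (hw.integrableOn_deriv hδ hy).mul_bdd (c := M) hgm.aestronglyMeasurable ?_
  exact Eventually.of_forall hg

lemma abs_integral_deriv_mul_le (hw : IsWeight w δ C) (hδ : δ ≤ 2) (hgm : Measurable g)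
    (hg : ∀ z, |g z| ≤ M) {y : ℝ} (hy : 0 < y) :
    |∫ z in Ioi y, deriv w z * g z| ≤ ∫ z in Ioi y, (2 - δ) * (w z / z * |g z|) := by
  rw [← Real.norm_eq_abs]
  refine (norm_integral_le_integral_norm _).trans ?_
  refine setIntegral_mono_on (hw.integrableOn_deriv_mul hδ hgm hg hy).norm
    (hw.integrableOn_div_mul_abs hδ hgm hg hy) measurableSet_Ioi fun z hz => ?_
  rw [norm_mul, Real.norm_eq_abs, Real.norm_eq_abs, ← mul_assoc]
  exact mul_le_mul_of_nonneg_right (hw.abs_deriv_le z (hy.trans hz)) (abs_nonneg _)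

/-- The energy balance along a characteristic for solutions of the linear equation. -/
theorem energy_along (hw : IsWeight w δ C) (hδ : δ ≤ 2) {G : ℝ → ℝ → ℝ}
    (hGm : Measurable fun p : ℝ × ℝ => G p.1 p.2) (hGb : ∀ s z, |G s z| ≤ M) {t x : ℝ}
    (ht : 0 ≤ t) (hx : 0 < x)
    (hG : ∀ s ∈ Icc 0 t, G s (Real.exp s * x) = G 0 x +
      ∫ r in (0 : ℝ)..s, -((Real.exp r * x) ^ 2 * tailOp w (G r) (Real.exp r * x))) :
    ENNReal.ofReal |G t (Real.exp t * x)| + ∫⁻ s in Ioc 0 t,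
        ENNReal.ofReal ((Real.exp s * x) ^ 2) *
          ENNReal.ofReal (w (Real.exp s * x) * |G s (Real.exp s * x)|) ≤
      ENNReal.ofReal |G 0 x| + ∫⁻ s in Ioc 0 t, ENNReal.ofReal ((Real.exp s * x) ^ 2) *
        ∫⁻ z in Ioi (Real.exp s * x), ENNReal.ofReal ((2 - δ) * (w z / z * |G s z|)) := by
  have hC := hw.const_nonneg
  have hM : 0 ≤ M := (abs_nonneg _).trans (hGb 0 0)
  have h2 : 0 ≤ 2 - δ := by linarith
  have hwm := hw.measurable
  have hy : ∀ s, 0 < Real.exp s * x := fun s => by positivity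
  have hGs : ∀ s, Measurable (G s) := fun s => hGm.comp (measurable_const.prodMk measurable_id)
  have hcurve : Measurable fun s : ℝ => (s, Real.exp s * x) := by fun_prop
  -- `a` is the loss and `b` the bound for the gain; both are bounded in time because `w` is at most
  -- `C / z`.
  set a : ℝ → ℝ := fun s => (Real.exp s * x) ^ 2 *
    (w (Real.exp s * x) * |G s (Real.exp s * x)|) with ha
  set D : ℝ → ℝ := fun s => ∫ z in Ioi (Real.exp s * x), (2 - δ) * (w z / z * |G s z|) with hD
  set b : ℝ → ℝ := fun s => (Real.exp s * x) ^ 2 * D s with hb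
  have ham : Measurable a := by
    have := hGm.comp hcurve
    simp only [Function.comp_def] at this
    fun_prop
  have hDm : Measurable D := (measurable_setIntegral_Ioi
    (f := fun s z => (2 - δ) * (w z / z * |G s z|)) (by fun_prop)).comp hcurve
  have hbm : Measurable b := by fun_prop
  have ha0 : ∀ s, 0 ≤ a s := fun s =>
    mul_nonneg (sq_nonneg _) (mul_nonneg (hw.nonneg _ (hy s)) (abs_nonneg _))
  have hD0 : ∀ s, 0 ≤ D s := fun s => hw.integral_div_mul_abs_nonneg hδ (hy s)
  have hb0 : ∀ s, 0 ≤ b s := fun s => mul_nonneg (sq_nonneg _) (hD0 s)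
  have haM : ∀ s ∈ Icc 0 t, a s ≤ C * M * (Real.exp t * x) := by
    intro s hs
    calc a s ≤ (Real.exp s * x) ^ 2 * (C / (Real.exp s * x) * M) := by
          have := hw.le _ (hy s)
          have := hw.nonneg _ (hy s)
          have := hGb s (Real.exp s * x)
          simp only [ha]
          gcongr
      _ = C * M * (Real.exp s * x) := by field_simp
      _ ≤ _ := by have := hs.2; gcongr
  have hbM : ∀ s ∈ Icc 0 t, b s ≤ (2 - δ) * C * M * (Real.exp t * x) := by
    intro s hs
    calc b s ≤ (Real.exp s * x) ^ 2 * ((2 - δ) * C * M / (Real.exp s * x)) := by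
          have := hw.integral_div_mul_abs_le hδ (hGs s) (hGb s) (hy s)
          simp only [hb]
          gcongr
      _ = (2 - δ) * C * M * (Real.exp s * x) := by field_simp
      _ ≤ _ := by have := hs.2; gcongr
  have hint : ∀ {f : ℝ → ℝ} {K : ℝ}, Measurable f → (∀ s, 0 ≤ f s) → (∀ s ∈ Icc 0 t, f s ≤ K) →
      IntervalIntegrable f volume 0 t := by
    intro f K hf hf0 hfK
    rw [intervalIntegrable_iff_integrableOn_Ioc_of_le ht]
    refine Integrable.mono' (integrable_const K) hf.aestronglyMeasurable ?_
    filter_upwards [ae_restrict_mem measurableSet_Ioc] with s hs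
    rw [Real.norm_of_nonneg (hf0 s)]
    exact hfK s (Ioc_subset_Icc_self hs)
  have hai := hint ham ha0 haM
  have hbi := hint hbm hb0 hbM
  have htm : Measurable fun s => -((Real.exp s * x) ^ 2 * tailOp w (G s) (Real.exp s * x)) := by
    have := (measurable_tailOp hwm (T := G) hGm).comp hcurve
    simp only [Function.comp_def] at this
    fun_prop
  have habs : ∀ s, |∫ z in Ioi (Real.exp s * x), deriv w z * G s z| ≤ D s := fun s =>
    hw.abs_integral_deriv_mul_le hδ (hGs s) (hGb s) (hy s)
  -- The derivative of `|G|` is at most `b - a`: the local term has the sign opposite to `G` and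
  -- gives `-a`, the nonlocal term is at most `b` in modulus. Where `G` vanishes so does `a`.
  have hkey := abs_le_abs_add_integral (g := fun s => G s (Real.exp s * x))
    (k := fun s => -((Real.exp s * x) ^ 2 * tailOp w (G s) (Real.exp s * x)))
    (m := fun s => b s - a s) (M := C * M * (Real.exp t * x) + (2 - δ) * C * M * (Real.exp t * x))
    ht (fun s hs => by simpa using hG s hs) htm (fun s hs => ?_) (hbi.sub hai) (fun s hs hpos => ?_)
    (fun s hs hneg => ?_) (fun s hs hzero => ?_)
  · rw [intervalIntegral.integral_sub hbi hai] at hkey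
    have h3 : |G t (Real.exp t * x)| + ∫ s in (0 : ℝ)..t, a s ≤
        |G 0 x| + ∫ s in (0 : ℝ)..t, b s := by
      simp only [Real.exp_zero, one_mul] at hkey
      linarith
    have hconv : ∀ {f : ℝ → ℝ}, IntervalIntegrable f volume 0 t → (∀ s, 0 ≤ f s) →
        ENNReal.ofReal (∫ s in (0 : ℝ)..t, f s) = ∫⁻ s in Ioc 0 t, ENNReal.ofReal (f s) := by
      intro f hf hf0
      rw [intervalIntegral.integral_of_le ht, ofReal_integral_eq_lintegral_ofReal
        ((intervalIntegrable_iff_integrableOn_Ioc_of_le ht).1 hf) (Eventually.of_forall hf0)]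
    have h4 := ENNReal.ofReal_le_ofReal h3
    rw [ENNReal.ofReal_add (abs_nonneg _) (intervalIntegral.integral_nonneg ht fun s _ => ha0 s),
      ENNReal.ofReal_add (abs_nonneg _) (intervalIntegral.integral_nonneg ht fun s _ => hb0 s),
      hconv hai ha0, hconv hbi hb0] at h4
    convert h4 using 3
    · ext s
      rw [ha, ENNReal.ofReal_mul (sq_nonneg _)]
    · ext s
      rw [hb, ENNReal.ofReal_mul (sq_nonneg _), hD, ofReal_integral_eq_lintegral_ofReal
        (hw.integrableOn_div_mul_abs hδ (hGs s) (hGb s) (hy s))]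
      filter_upwards [ae_restrict_mem measurableSet_Ioi] with z hz
      exact hw.div_mul_abs_nonneg hδ ((hy s).trans hz)
  · refine le_trans ?_ (add_le_add (haM s hs) (hbM s hs))
    rw [abs_neg, abs_mul, abs_of_nonneg (sq_nonneg (Real.exp s * x)), tailOp]
    simp only [ha, hb]
    rw [← mul_add]
    refine mul_le_mul_of_nonneg_left ((abs_add_le _ _).trans (add_le_add ?_ (habs s)))
      (sq_nonneg _)
    rw [abs_mul, abs_of_nonneg (hw.nonneg _ (hy s))]
  · have h5 := neg_le_of_abs_le (habs s)
    simp only [ha, hb, tailOp, abs_of_pos hpos]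
    rw [← mul_sub, ← mul_neg]
    refine mul_le_mul_of_nonneg_left ?_ (sq_nonneg _)
    linarith
  · have h5 := le_of_abs_le (habs s)
    simp only [ha, hb, tailOp, abs_of_neg hneg]
    rw [← mul_sub, neg_neg]
    refine mul_le_mul_of_nonneg_left ?_ (sq_nonneg _)
    linarith
  · have : a s = 0 := by simp only [ha]; rw [hzero]; simp
    rw [this, sub_zero]; exact hb0 s

/-- The source term of the energy balance is compensated by the loss term, up to a tail. -/
lemma lintegral_source_le (hw : IsWeight w δ C) (hδ : δ < 2) (hgm : Measurable g) {R : ℝ}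
    (hR : 0 < R) :
    ∫⁻ y in Ioo 0 R, ENNReal.ofReal (y ^ (1 - δ)) *
        ∫⁻ z in Ioi y, ENNReal.ofReal ((2 - δ) * (w z / z * |g z|)) ≤
      (∫⁻ y in Ioo 0 R, ENNReal.ofReal (y ^ (1 - δ)) * ENNReal.ofReal (w y * |g y|)) +
        ENNReal.ofReal (R ^ (2 - δ)) * ∫⁻ z in Ioi R, ENNReal.ofReal (w z / z * |g z|) := by
  have hwm := hw.measurable
  have h2 : 0 < 2 - δ := by linarith
  -- Tonelli makes every term an integral in `z`. Replacing `Ioi R` by `Ici R`, up to a null set,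
  -- makes it partition `(0,∞)` together with `Ioo 0 R`, so that the integrands can be compared
  -- pointwise.
  rw [lintegral_mul_lintegral_Ioi_swap _ (by fun_prop) (by fun_prop),
    ← lintegral_const_mul' _ _ ENNReal.ofReal_ne_top, ← lintegral_indicator measurableSet_Ioo,
    ← setLIntegral_congr (Ioi_ae_eq_Ici (a := R)).symm, ← lintegral_indicator measurableSet_Ici,
    ← lintegral_add_right _ (Measurable.indicator (by fun_prop) measurableSet_Ici)]
  refine lintegral_mono fun z => ?_
  rcases le_or_gt z 0 with hz | hz
  · have : Ioo 0 R ∩ Iio z = ∅ := by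
      ext y; simp only [mem_inter_iff, mem_Ioo, mem_Iio, mem_empty_iff_false, iff_false]
      intro h; linarith [h.1.1, h.2]
    simp [this]
  · have hwz := hw.nonneg z hz
    -- The integral of `y^{1-δ}` over `(0,S)` is `S^{2-δ}/(2-δ)`, whose denominator cancels the
    -- factor of the gain. Below the cutoff `S = z` reproduces the loss; above it `S = R` leaves the
    -- tail term.
    have hsub : ∀ S : ℝ, 0 ≤ S → Ioo 0 R ∩ Iio z ⊆ Ioo 0 S →
        (∫⁻ y in Ioo 0 R ∩ Iio z, ENNReal.ofReal (y ^ (1 - δ))) *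
          ENNReal.ofReal ((2 - δ) * (w z / z * |g z|)) ≤
        ENNReal.ofReal (S ^ (2 - δ)) * ENNReal.ofReal (w z / z * |g z|) := by
      intro S hS hsub
      refine (mul_le_mul_left (lintegral_mono_set hsub) _).trans ?_
      rw [lintegral_Ioo_rpow (by linarith) hS, ← ENNReal.ofReal_mul (by
        rw [show 1 - δ + 1 = 2 - δ by ring]; positivity), ← ENNReal.ofReal_mul (by positivity)]
      refine ENNReal.ofReal_le_ofReal (le_of_eq ?_)
      rw [show 1 - δ + 1 = 2 - δ by ring]
      field_simp
    rcases lt_or_ge z R with hzR | hzR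
    · rw [indicator_of_mem (by exact ⟨hz, hzR⟩), indicator_of_notMem (by simpa using hzR), add_zero]
      refine (hsub z hz.le fun y hy => ⟨hy.1.1, hy.2⟩).trans (le_of_eq ?_)
      rw [← ENNReal.ofReal_mul (by positivity), ← ENNReal.ofReal_mul (by positivity)]
      congr 1
      rw [show 2 - δ = 1 - δ + 1 by ring, Real.rpow_add_one hz.ne']
      field_simp
    · rw [indicator_of_notMem (by simp [hzR]), indicator_of_mem (by exact hzR), zero_add]
      exact hsub R hR.le fun y hy => hy.1

end IsWeight
end

/-! ### Truncated energy estimate and exponential contraction -/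

noncomputable section

namespace IsWeight

variable {w : ℝ → ℝ} {δ C M : ℝ}

/-- The truncated energy of a solution of the linear equation grows at most by the tail term. -/
theorem energy_truncated (hw : IsWeight w δ C) (hδ : δ < 2) {G : ℝ → ℝ → ℝ}
    (hGm : Measurable fun p : ℝ × ℝ => G p.1 p.2) (hGb : ∀ s z, |G s z| ≤ M) {t X : ℝ}
    (ht : 0 ≤ t) (hX : 0 < X) {K : ℝ≥0∞} (hK : K ≠ ∞) (hGn : ∀ s, wnorm δ (G s) ≤ K)
    (hG : ∀ s ∈ Icc 0 t, ∀ x, 0 < x → G s (Real.exp s * x) = G 0 x +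
      ∫ r in (0 : ℝ)..s, -((Real.exp r * x) ^ 2 * tailOp w (G r) (Real.exp r * x))) :
    ∫⁻ x in Ioo 0 X, ENNReal.ofReal (x ^ (-1 - δ)) * ENNReal.ofReal |G t (Real.exp t * x)| ≤
      wnorm δ (G 0) + ∫⁻ s in Ioc 0 t, ENNReal.ofReal (Real.exp (δ * s)) *
        (ENNReal.ofReal ((Real.exp s * X) ^ (2 - δ)) *
          ∫⁻ z in Ioi (Real.exp s * X), ENNReal.ofReal (w z / z * |G s z|)) := by
  have hwm := hw.measurable
  have hC := hw.const_nonneg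
  have hGs : ∀ s, Measurable (G s) := fun s => hGm.comp (measurable_const.prodMk measurable_id)
  have hcurve : Measurable fun p : ℝ × ℝ => (p.1, Real.exp p.1 * p.2) := by fun_prop
  -- the loss term
  set Q : ℝ → ℝ≥0∞ := fun s => ENNReal.ofReal (Real.exp (δ * s)) *
    ∫⁻ y in Ioo 0 (Real.exp s * X), ENNReal.ofReal (y ^ (1 - δ)) *
      ENNReal.ofReal (w y * |G s y|) with hQ
  set h : ℝ → ℝ → ℝ≥0∞ := fun s z => ENNReal.ofReal ((2 - δ) * (w z / z * |G s z|)) with hh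
  have hhm : Measurable fun p : ℝ × ℝ => h p.1 p.2 := by simp only [hh]; fun_prop
  have hHm := measurable_setLIntegral_Ioi hhm
  have hloss : Measurable fun p : ℝ × ℝ => ENNReal.ofReal (w p.2 * |G p.1 p.2|) := by fun_prop
  have hmul : ∀ x ∈ Ioo 0 X, ENNReal.ofReal (x ^ (-1 - δ)) *
        ENNReal.ofReal |G t (Real.exp t * x)| +
      ∫⁻ s in Ioc 0 t, ENNReal.ofReal (x ^ (-1 - δ)) * (ENNReal.ofReal ((Real.exp s * x) ^ 2) *
          ENNReal.ofReal (w (Real.exp s * x) * |G s (Real.exp s * x)|)) ≤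
      ENNReal.ofReal (x ^ (-1 - δ)) * ENNReal.ofReal |G 0 x| +
      ∫⁻ s in Ioc 0 t, ENNReal.ofReal (x ^ (-1 - δ)) * (ENNReal.ofReal ((Real.exp s * x) ^ 2) *
          ∫⁻ z in Ioi (Real.exp s * x), h s z) := by
    intro x hx
    rw [lintegral_const_mul' _ _ ENNReal.ofReal_ne_top,
      lintegral_const_mul' _ _ ENNReal.ofReal_ne_top, ← mul_add, ← mul_add]
    exact mul_le_mul_right
      (hw.energy_along hδ.le hGm hGb ht hx.1 fun s hs => hG s hs x hx.1) _
  have hint := setLIntegral_mono' (μ := volume) measurableSet_Ioo hmul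
  have hm1 : Measurable fun p : ℝ × ℝ => ENNReal.ofReal (p.2 ^ (-1 - δ)) *
      (ENNReal.ofReal ((Real.exp p.1 * p.2) ^ 2) *
          ENNReal.ofReal (w (Real.exp p.1 * p.2) * |G p.1 (Real.exp p.1 * p.2)|)) :=
    Measurable.mul (by fun_prop) (Measurable.mul (by fun_prop) (hloss.comp hcurve))
  have hm2 : Measurable fun p : ℝ × ℝ => ENNReal.ofReal (p.2 ^ (-1 - δ)) *
      (ENNReal.ofReal ((Real.exp p.1 * p.2) ^ 2) *
          ∫⁻ z in Ioi (Real.exp p.1 * p.2), h p.1 z) :=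
    Measurable.mul (by fun_prop) (Measurable.mul (by fun_prop) (hHm.comp hcurve))
  have hm0 : ∀ s c : ℝ, Measurable fun x : ℝ => ENNReal.ofReal (x ^ (-1 - δ)) *
      ENNReal.ofReal |G s (c * x)| := by
    intro s c
    have := hGs s
    fun_prop
  have hm0' : Measurable fun x : ℝ => ENNReal.ofReal (x ^ (-1 - δ)) * ENNReal.ofReal |G 0 x| := by
    simpa using hm0 0 1
  have hswap : ∀ f : ℝ → ℝ → ℝ≥0∞, Measurable (fun p : ℝ × ℝ => f p.1 p.2) →
      ∫⁻ x in Ioo 0 X, ∫⁻ s in Ioc 0 t, f s x = ∫⁻ s in Ioc 0 t, ∫⁻ x in Ioo 0 X, f s x :=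
    fun f hf => lintegral_lintegral_swap (f := fun x s => f s x)
      (hf.comp measurable_swap).aemeasurable
  rw [lintegral_add_left (hm0 t _), lintegral_add_left hm0',
    hswap (fun s x => ENNReal.ofReal (x ^ (-1 - δ)) * (ENNReal.ofReal ((Real.exp s * x) ^ 2) *
      ENNReal.ofReal (w (Real.exp s * x) * |G s (Real.exp s * x)|))) hm1,
    hswap (fun s x => ENNReal.ofReal (x ^ (-1 - δ)) * (ENNReal.ofReal ((Real.exp s * x) ^ 2) *
      ∫⁻ z in Ioi (Real.exp s * x), h s z)) hm2] at hint
  have hQeq : ∀ s, ∫⁻ x in Ioo 0 X, ENNReal.ofReal (x ^ (-1 - δ)) *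
      (ENNReal.ofReal ((Real.exp s * x) ^ 2) *
          ENNReal.ofReal (w (Real.exp s * x) * |G s (Real.exp s * x)|)) = Q s := fun s =>
    lintegral_Ioo_scale δ s X (h := fun y => ENNReal.ofReal (w y * |G s y|))
      (hloss.comp (measurable_const.prodMk measurable_id))
  have hSle : ∀ s, ∫⁻ x in Ioo 0 X, ENNReal.ofReal (x ^ (-1 - δ)) *
      (ENNReal.ofReal ((Real.exp s * x) ^ 2) * ∫⁻ z in Ioi (Real.exp s * x), h s z) ≤
      Q s + ENNReal.ofReal (Real.exp (δ * s)) * (ENNReal.ofReal ((Real.exp s * X) ^ (2 - δ)) *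
          ∫⁻ z in Ioi (Real.exp s * X), ENNReal.ofReal (w z / z * |G s z|)) := by
    intro s
    rw [lintegral_Ioo_scale δ s X (h := fun y => ∫⁻ z in Ioi y, h s z)
      (hHm.comp (measurable_const.prodMk measurable_id)), hQ]
    simp only
    rw [← mul_add]
    exact mul_le_mul_right (hw.lintegral_source_le hδ (hGs s) (by positivity)) _
  have hQm : Measurable Q := by
    have : Q = fun s => ∫⁻ x in Ioo 0 X, ENNReal.ofReal (x ^ (-1 - δ)) *
      (ENNReal.ofReal ((Real.exp s * x) ^ 2) *
          ENNReal.ofReal (w (Real.exp s * x) * |G s (Real.exp s * x)|)) :=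
      funext fun s => (hQeq s).symm
    rw [this]
    exact hm1.lintegral_prod_right'
  -- This is what the cutoff is for: on `y < e^t X` the bound `w ≤ C / y` makes the loss at most `C
  -- e^t X` times a finite `δ`-norm.
  have hQfin : ∫⁻ s in Ioc 0 t, Q s ≠ ∞ := by
    have hQle : ∀ s ∈ Ioc 0 t, Q s ≤ ENNReal.ofReal (Real.exp (|δ| * t)) *
        (ENNReal.ofReal (C * (Real.exp t * X)) * K) := by
      intro s hs
      refine mul_le_mul' (ENNReal.ofReal_le_ofReal (Real.exp_le_exp.2 ?_)) ?_
      -- The modulus appears because no sign of `δ` is assumed here.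
      · calc δ * s ≤ |δ| * s := mul_le_mul_of_nonneg_right (le_abs_self δ) hs.1.le
          _ ≤ |δ| * t := mul_le_mul_of_nonneg_left hs.2 (abs_nonneg δ)
      · refine le_trans ?_ (mul_le_mul_right (hGn s) _)
        rw [wnorm, ← lintegral_const_mul' _ _ ENNReal.ofReal_ne_top]
        refine (setLIntegral_mono' measurableSet_Ioo fun y hy => ?_).trans
          (lintegral_mono_set Ioo_subset_Ioi_self)
        have hy0 := hy.1
        have hyR : y ≤ Real.exp t * X := by
          refine hy.2.le.trans ?_
          have := hs.2
          gcongr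
        rw [← ENNReal.ofReal_mul (by positivity), ← ENNReal.ofReal_mul (by positivity)]
        refine ENNReal.ofReal_le_ofReal ?_
        calc y ^ (1 - δ) * (w y * |G s y|) ≤ y ^ (1 - δ) * (C / y * |G s y|) := by
              have := hw.le y hy0
              gcongr
          _ = C * y * (y ^ (-1 - δ) * |G s y|) := by
              have : y ^ (1 - δ) = y ^ (-1 - δ) * y ^ 2 := by
                rw [← Real.rpow_natCast, ← Real.rpow_add hy0]; norm_num; ring_nf
              rw [this]; field_simp
          _ ≤ _ := by
              rw [mul_assoc, mul_assoc]
              gcongr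
    refine ((setLIntegral_mono' measurableSet_Ioc hQle).trans_lt ?_).ne
    rw [setLIntegral_const]
    refine ENNReal.mul_lt_top (ENNReal.mul_lt_top ENNReal.ofReal_lt_top
      (ENNReal.mul_lt_top ENNReal.ofReal_lt_top hK.lt_top)) ?_
    simp
  simp only [hQeq] at hint
  have hfinal := hint.trans (add_le_add (le_refl _) (lintegral_mono hSle))
  -- The finite loss now stands on both sides and is cancelled.
  rw [lintegral_add_left hQm, ← add_assoc, add_comm _ (∫⁻ s in Ioc 0 t, Q s),
    add_right_comm, add_comm _ (∫⁻ s in Ioc 0 t, Q s)] at hfinal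
  have := (ENNReal.add_le_add_iff_left hQfin).1 hfinal
  refine this.trans (add_le_add ?_ le_rfl)
  rw [wnorm]
  refine (lintegral_mono_set Ioo_subset_Ioi_self).trans
    (setLIntegral_mono' measurableSet_Ioi fun x hx => ?_)
  rw [← ENNReal.ofReal_mul (Real.rpow_nonneg (le_of_lt hx) _)]

end IsWeight

namespace IsFlow

variable {w : ℝ → ℝ} {δ C α : ℝ} {F H : ℝ≥0 → Profile}

/-- Exponential contraction for the difference of two solutions of the same mass. -/
theorem wnorm_sub_le (hw : IsWeight w δ C) (hδ0 : 0 < δ) (hδ1 : δ ≤ 1) (hα1 : α ≤ 1)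
    (hF : IsFlow w α F) (hH : IsFlow w 1 H) (t : ℝ≥0) :
    wnorm δ (fun x => F t x - α * H t x) ≤
      ENNReal.ofReal (2 * (1 + δ⁻¹) * Real.exp (-δ * t)) := by
  have hδ : δ < 2 := by linarith
  have hα := hF.mass_nonneg
  have hwm := hw.measurable
  set G : ℝ → ℝ → ℝ := fun s z => F s.toNNReal z - α * H s.toNNReal z with hGdef
  have hFm := hF.measurable_uncurry
  have hHm := hH.measurable_uncurry
  have hGm : Measurable fun p : ℝ × ℝ => G p.1 p.2 := hFm.sub (hHm.const_mul α)
  have hF0 : ∀ s z, 0 ≤ F s z := fun s z => (F s).nonneg z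
  have hH0 : ∀ s z, 0 ≤ H s z := fun s z => (H s).nonneg z
  have hFα : ∀ s z, F s z ≤ α := fun s z => Profile.le_of_tendsto (hF.mass s) z
  have hH1 : ∀ s z, α * H s z ≤ α := fun s z =>
    mul_le_of_le_one_right hα (Profile.le_of_tendsto (hH.mass s) z)
  have hGb : ∀ s z, |G s z| ≤ α := by
    intro s z
    have h1 := mul_nonneg hα (hH0 s.toNNReal z)
    rw [abs_le]
    constructor <;> simp only [hGdef] <;>
      linarith [hF0 s.toNNReal z, hFα s.toNNReal z, hH1 s.toNNReal z]
  -- Since `G = α (1 - H) - (α - F)`, the error beyond the cutoff is controlled by the tails of the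
  -- two solutions separately.
  have hGtail : ∀ s z, |G s z| ≤ (α - F s.toNNReal z) + α * (1 - H s.toNNReal z) := by
    intro s z
    rw [abs_le]
    constructor <;> simp only [hGdef] <;>
      linarith [hFα s.toNNReal z, hH1 s.toNNReal z]
  have hGn : ∀ s, wnorm δ (G s) ≤ ENNReal.ofReal (2 * (1 + δ⁻¹)) := by
    intro s
    have h1 : wnorm δ (G s) ≤ wnorm δ (F s.toNNReal) + wnorm δ (H s.toNNReal) := by
      have := (F s.toNNReal).measurable
      rw [wnorm, wnorm, wnorm, ← lintegral_add_left (by fun_prop)]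
      refine setLIntegral_mono' measurableSet_Ioi fun x hx => ?_
      have hx : 0 ≤ x ^ (-1 - δ) := Real.rpow_nonneg (le_of_lt hx) _
      rw [← ENNReal.ofReal_add (by positivity) (by positivity), ← mul_add]
      refine ENNReal.ofReal_le_ofReal (mul_le_mul_of_nonneg_left ?_ hx)
      refine (abs_sub _ _).trans (add_le_add le_rfl ?_)
      rw [abs_mul, abs_of_nonneg hα]
      exact mul_le_of_le_one_left (abs_nonneg _) hα1
    refine h1.trans ((add_le_add (wnorm_one_bound hδ0 hδ1 (hF.norm_le _))
      (wnorm_one_bound hδ0 hδ1 (hH.norm_le _))).trans ?_)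
    rw [← ENNReal.ofReal_add (by positivity) (by positivity), two_mul]
  have hTF : ∀ (r : ℝ≥0) (y : ℝ), 0 < y →
      IntegrableOn (fun z => deriv w z * (α - F r z)) (Ioi y) := fun r y hy =>
    hw.integrableOn_deriv_mul hδ.le (M := α) (measurable_const.sub (F r).measurable) (fun z => by
      change |α - F r z| ≤ α
      rw [abs_of_nonneg (sub_nonneg.2 (hFα r z))]; linarith [hF0 r z]) hy
  have hTH : ∀ (r : ℝ≥0) (y : ℝ), 0 < y →
      IntegrableOn (fun z => deriv w z * (1 - H r z)) (Ioi y) := fun r y hy =>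
    hw.integrableOn_deriv_mul hδ.le (M := 1) (measurable_const.sub (H r).measurable) (fun z => by
      change |1 - H r z| ≤ 1
      rw [abs_of_nonneg (sub_nonneg.2 ((H r).le_one z))]; linarith [hH0 r z]) hy
  -- The tail of the signed measure with distribution function `G` is `-G`, because both masses
  -- equal `α`; hence the minus sign in the linear equation.
  have hop : ∀ (r : ℝ) (y : ℝ), 0 < y → -tailOp w (G r) y =
      tailOp w (fun z => α - F r.toNNReal z) y - α * tailOp w (fun z => 1 - H r.toNNReal z) y := by
    intro r y hy
    have h1 : ∫ z in Ioi y, deriv w z * G r z = α * (∫ z in Ioi y, deriv w z * (1 - H r.toNNReal z))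
        - ∫ z in Ioi y, deriv w z * (α - F r.toNNReal z) := by
      rw [← integral_const_mul, ← integral_sub ((hTH _ _ hy).const_mul α) (hTF _ _ hy)]
      refine integral_congr_ae (Eventually.of_forall fun z => ?_)
      simp only [hGdef]
      ring
    simp only [tailOp, h1]
    simp only [hGdef]
    ring
  have hG : ∀ s ∈ Icc 0 (t : ℝ), ∀ x, 0 < x → G s (Real.exp s * x) = G 0 x +
      ∫ r in (0 : ℝ)..s, -((Real.exp r * x) ^ 2 * tailOp w (G r) (Real.exp r * x)) := by
    intro s hs x hx
    have h1 := hF.eq_along hw hδ.le s.toNNReal hx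
    have h2 := hH.eq_along hw hδ.le s.toNNReal hx
    rw [Real.coe_toNNReal s hs.1] at h1 h2
    have h3 : ∀ r : ℝ, -((Real.exp r * x) ^ 2 * tailOp w (G r) (Real.exp r * x)) =
        (Real.exp r * x) ^ 2 * tailOp w (fun z => α - F r.toNNReal z) (Real.exp r * x) -
        α * ((Real.exp r * x) ^ 2 * tailOp w (fun z => 1 - H r.toNNReal z) (Real.exp r * x)) := by
      intro r
      have := hop r (Real.exp r * x) (by positivity)
      linear_combination (Real.exp r * x) ^ 2 * this
    simp_rw [h3]
    rw [intervalIntegral.integral_sub (hF.intervalIntegrable_along hw hδ.le hs.1 hx)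
      ((hH.intervalIntegrable_along hw hδ.le hs.1 hx).const_mul α),
      intervalIntegral.integral_const_mul]
    simp only [hGdef, Real.toNNReal_zero, h1, h2]
    ring
  -- the tail terms of both solutions
  set E : (ℝ≥0 → Profile) → ℝ → ℕ → ℝ≥0∞ := fun F α n =>
    ∫⁻ s in Ioc 0 (t : ℝ), ENNReal.ofReal (Real.exp (δ * s)) *
      (ENNReal.ofReal ((Real.exp s * (n + 1 : ℝ)) ^ (2 - δ)) *
        ∫⁻ z in Ioi (Real.exp s * (n + 1 : ℝ)),
          ENNReal.ofReal (w z / z * (α - F s.toNNReal z))) with hE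
  have hlim : Tendsto (fun n => E F α n + ENNReal.ofReal α * E H 1 n) atTop (𝓝 0) := by
    have h1 := hF.tendsto_lintegral_tail hw hδ0 hδ1 t
    have h2 := ENNReal.Tendsto.const_mul (hH.tendsto_lintegral_tail hw hδ0 hδ1 t)
      (Or.inr (ENNReal.ofReal_ne_top (r := α)))
    simpa using h1.add h2
  have htailm : ∀ n : ℕ, Measurable fun s : ℝ => ENNReal.ofReal (Real.exp (δ * s)) *
      (ENNReal.ofReal ((Real.exp s * (n + 1 : ℝ)) ^ (2 - δ)) *
        ∫⁻ z in Ioi (Real.exp s * (n + 1 : ℝ)),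
          ENNReal.ofReal (w z / z * (α - F s.toNNReal z))) := by
    intro n
    refine Measurable.mul (by fun_prop) (Measurable.mul (by fun_prop) ?_)
    have h1 : Measurable fun p : ℝ × ℝ =>
        ENNReal.ofReal (w p.2 / p.2 * (α - F p.1.toNNReal p.2)) :=
      (((hwm.comp measurable_snd).div measurable_snd).mul
        (measurable_const.sub hFm)).ennreal_ofReal
    exact (measurable_setLIntegral_Ioi
      (f := fun s z => ENNReal.ofReal (w z / z * (α - F s.toNNReal z))) h1).comp
      (measurable_id.prodMk (by fun_prop : Measurable fun s : ℝ => Real.exp s * (n + 1 : ℝ)))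
  have hsplit : ∀ n : ℕ, ∫⁻ s in Ioc 0 (t : ℝ), ENNReal.ofReal (Real.exp (δ * s)) *
        (ENNReal.ofReal ((Real.exp s * (n + 1 : ℝ)) ^ (2 - δ)) *
          ∫⁻ z in Ioi (Real.exp s * (n + 1 : ℝ)), ENNReal.ofReal (w z / z * |G s z|)) ≤
      E F α n + ENNReal.ofReal α * E H 1 n := by
    intro n
    simp only [hE]
    rw [← lintegral_const_mul' _ _ ENNReal.ofReal_ne_top, ← lintegral_add_left (htailm n)]
    refine lintegral_mono fun s => ?_
    rw [mul_left_comm (ENNReal.ofReal α), ← mul_add, mul_left_comm (ENNReal.ofReal α), ← mul_add]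
    refine mul_le_mul_right (mul_le_mul_right ?_ _) _
    have := (F s.toNNReal).measurable
    rw [← lintegral_const_mul' _ _ ENNReal.ofReal_ne_top, ← lintegral_add_left (by fun_prop)]
    refine setLIntegral_mono' measurableSet_Ioi fun z hz => ?_
    have hz : 0 < z := lt_trans (by positivity) hz
    have hwz := hw.nonneg z hz
    have h1 := sub_nonneg.2 (hFα s.toNNReal z)
    have h2 := sub_nonneg.2 ((H s.toNNReal).le_one z)
    rw [← ENNReal.ofReal_mul hα, ← ENNReal.ofReal_add (by positivity) (by positivity)]
    refine ENNReal.ofReal_le_ofReal ?_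
    calc w z / z * |G s z| ≤ w z / z * ((α - F s.toNNReal z) + α * (1 - H s.toNNReal z)) := by
          have := hGtail s z
          gcongr
      _ = _ := by ring
  -- remove the cutoff
  have hN : ∫⁻ x in Ioi 0, ENNReal.ofReal (x ^ (-1 - δ)) *
      ENNReal.ofReal |G t (Real.exp t * x)| ≤ ENNReal.ofReal (2 * (1 + δ⁻¹)) := by
    have hmono : Tendsto (fun n : ℕ => ∫⁻ x in Ioo 0 (n + 1 : ℝ), ENNReal.ofReal (x ^ (-1 - δ)) *
        ENNReal.ofReal |G t (Real.exp t * x)|) atTop (𝓝 (∫⁻ x in Ioi 0,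
          ENNReal.ofReal (x ^ (-1 - δ)) * ENNReal.ofReal |G t (Real.exp t * x)|)) := by
      have hU : Ioi (0 : ℝ) = ⋃ n : ℕ, Ioo 0 (n + 1 : ℝ) := by
        ext x
        simp only [mem_Ioi, mem_iUnion, mem_Ioo, exists_and_left, iff_self_and]
        intro _
        obtain ⟨n, hn⟩ := exists_nat_gt x
        exact ⟨n, by linarith⟩
      simp_rw [← withDensity_apply _ measurableSet_Ioo, ← withDensity_apply _ measurableSet_Ioi]
      rw [hU]
      refine tendsto_measure_iUnion_atTop ?_
      intro m n hmn
      refine Ioo_subset_Ioo le_rfl ?_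
      have : (m : ℝ) ≤ n := by exact_mod_cast hmn
      linarith
    have hub : Tendsto (fun n => ENNReal.ofReal (2 * (1 + δ⁻¹)) +
        (E F α n + ENNReal.ofReal α * E H 1 n)) atTop (𝓝 (ENNReal.ofReal (2 * (1 + δ⁻¹)))) := by
      simpa using tendsto_const_nhds.add hlim
    refine le_of_tendsto_of_tendsto' hmono hub fun n => ?_
    refine (hw.energy_truncated hδ hGm hGb t.coe_nonneg (by positivity) ENNReal.ofReal_ne_top hGn
      hG).trans ?_
    exact add_le_add (hGn 0) (hsplit n)
  have hGt : G t = fun x => F t x - α * H t x := by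
    simp only [hGdef, Real.toNNReal_coe]
  rw [wnorm_scale δ t (f := G t) (hGm.comp (measurable_const.prodMk measurable_id)), hGt] at hN
  have hexp : ENNReal.ofReal (Real.exp (-δ * t)) * ENNReal.ofReal (Real.exp (δ * t)) = 1 := by
    rw [← ENNReal.ofReal_mul (Real.exp_pos _).le, ← Real.exp_add]
    simp
  calc wnorm δ (fun x => F t x - α * H t x) = ENNReal.ofReal (Real.exp (-δ * t)) *
        (ENNReal.ofReal (Real.exp (δ * t)) * wnorm δ (fun x => F t x - α * H t x)) := by
        rw [← mul_assoc, hexp, one_mul]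
    _ ≤ ENNReal.ofReal (Real.exp (-δ * t)) * ENNReal.ofReal (2 * (1 + δ⁻¹)) :=
        mul_le_mul_right hN _
    _ = _ := by
        rw [← ENNReal.ofReal_mul (Real.exp_pos _).le, mul_comm]

end IsFlow
end

/-! ### The stationary equation: regularity, norm, and the fixed point property -/

noncomputable section

/-- The integral of `1/z` over `(r,∞)` against the measure with distribution function `φ`, in a
form that does not mention that measure. -/
def tailKernel (φ : ℝ → ℝ) (r : ℝ) : ℝ := ∫ z in Ioi r, (z ^ 2)⁻¹ * (φ z - φ r)

section tailKernel

variable {φ : ℝ → ℝ}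

lemma measurable_tailKernel (hφ : Measurable φ) : Measurable (tailKernel φ) :=
  (measurable_setIntegral_Ioi (f := fun s z => (z ^ 2)⁻¹ * (φ z - φ s)) (by fun_prop)).comp
    (measurable_id.prodMk measurable_id)

lemma integrableOn_inv_sq_mul {g : ℝ → ℝ} (hg : Measurable g) {M : ℝ} (hM : ∀ z, |g z| ≤ M)
    {r : ℝ} (hr : 0 < r) : IntegrableOn (fun z => (z ^ 2)⁻¹ * g z) (Ioi r) :=
  (IsWeight.integrableOn_inv_sq hr).mul_bdd (c := M) hg.aestronglyMeasurable
    (Eventually.of_forall hM)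

variable (hφ : Monotone φ) (h0 : ∀ z, 0 ≤ φ z) (h1 : ∀ z, φ z ≤ 1)

include hφ in
lemma tailKernel_nonneg (r : ℝ) : 0 ≤ tailKernel φ r :=
  setIntegral_nonneg measurableSet_Ioi fun z hz =>
    mul_nonneg (by positivity) (sub_nonneg.2 (hφ (le_of_lt hz)))

include hφ h0 h1 in
-- Bounding `φ z` by one leaves `(1 - φ r) ∫_r^∞ z⁻² dz`. This bounds the density of a stationary
-- profile by one and makes it vanish at infinity.
lemma mul_tailKernel_le {r : ℝ} (hr : 0 < r) : r * tailKernel φ r ≤ 1 - φ r := by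
  have h : tailKernel φ r ≤ ∫ z in Ioi r, (z ^ 2)⁻¹ * (1 - φ r) := by
    refine setIntegral_mono_on (integrableOn_inv_sq_mul (M := 1) (hφ.measurable.sub_const _)
      (fun z => ?_) hr) ((IsWeight.integrableOn_inv_sq hr).mul_const _) measurableSet_Ioi
      fun z _ => ?_
    · rw [abs_le]; constructor <;> linarith [h0 z, h1 z, h0 r, h1 r]
    · have := h1 z
      gcongr
  rw [integral_mul_const, integral_Ioi_inv_sq hr] at h
  calc r * tailKernel φ r ≤ r * (r⁻¹ * (1 - φ r)) := by gcongr
    _ = 1 - φ r := by field_simp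

include hφ h0 h1 in
-- Up to `√r` the increment of `φ` is at most `φ(√r)`, beyond `√r` it is at most one. The bound
-- serves for `r → 0`, where it tends to zero if `φ` does, whereas `1 - φ r` does not.
lemma mul_tailKernel_le_sqrt {r : ℝ} (hr : 0 < r) :
    r * tailKernel φ r ≤ φ (√r) * 1 + r * (√r)⁻¹ := by
  have hs : 0 < √r := Real.sqrt_pos.2 hr
  have hi : IntegrableOn (fun z : ℝ => (Ioi (√r)).indicator (fun z => (z ^ 2)⁻¹) z) (Ioi r) :=
    (IsWeight.integrableOn_inv_sq hr).indicator measurableSet_Ioi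
  have h : tailKernel φ r ≤ ∫ z in Ioi r, ((z ^ 2)⁻¹ * φ (√r) +
      (Ioi (√r)).indicator (fun z => (z ^ 2)⁻¹) z) := by
    refine setIntegral_mono_on (integrableOn_inv_sq_mul (M := 1) (hφ.measurable.sub_const _)
      (fun z => ?_) hr) (((IsWeight.integrableOn_inv_sq hr).mul_const _).add hi) measurableSet_Ioi
      fun z _ => ?_
    · rw [abs_le]; constructor <;> linarith [h0 z, h1 z, h0 r, h1 r]
    · have hz : (0 : ℝ) ≤ (z ^ 2)⁻¹ := by positivity
      by_cases hz2 : z ∈ Ioi (√r)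
      · rw [indicator_of_mem hz2]
        nlinarith [h0 (√r), h1 z, h0 r]
      · rw [indicator_of_notMem hz2, add_zero]
        have := hφ (not_lt.1 hz2)
        have := h0 r
        gcongr
        linarith
  rw [integral_add ((IsWeight.integrableOn_inv_sq hr).mul_const _) hi, integral_mul_const,
    integral_Ioi_inv_sq hr, setIntegral_indicator measurableSet_Ioi] at h
  have h2 : ∫ z in Ioi r ∩ Ioi (√r), (z ^ 2)⁻¹ ≤ ∫ z in Ioi (√r), (z ^ 2)⁻¹ :=
    setIntegral_mono_set (IsWeight.integrableOn_inv_sq hs)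
      (Eventually.of_forall fun z => by positivity) (inter_subset_right.eventuallyLE)
  rw [integral_Ioi_inv_sq hs] at h2
  calc r * tailKernel φ r ≤ r * (r⁻¹ * φ (√r) + (√r)⁻¹) := by gcongr; linarith
    _ = _ := by field_simp

include hφ h0 h1 in
lemma tailKernel_eq {r : ℝ} (hr : 0 < r) :
    tailKernel φ r = (∫ z in Ioi r, (z ^ 2)⁻¹ * φ z) - φ r / r := by
  rw [tailKernel]
  simp_rw [mul_sub]
  rw [integral_sub (integrableOn_inv_sq_mul (M := 1) hφ.measurable
    (fun z => by rw [abs_of_nonneg (h0 z)]; exact h1 z) hr)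
    ((IsWeight.integrableOn_inv_sq hr).mul_const _), integral_mul_const, integral_Ioi_inv_sq hr]
  congr 1
  field_simp

include hφ h0 h1 in
lemma hasDerivAt_integral_Ioi_inv_sq_mul (hc : Continuous φ) {r : ℝ} (hr : 0 < r) :
    HasDerivAt (fun r => ∫ z in Ioi r, (z ^ 2)⁻¹ * φ z) (-((r ^ 2)⁻¹ * φ r)) r := by
  have hi : ∀ y : ℝ, 0 < y → IntegrableOn (fun z => (z ^ 2)⁻¹ * φ z) (Ioi y) := fun y hy =>
    integrableOn_inv_sq_mul (M := 1) hφ.measurable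
      (fun z => by rw [abs_of_nonneg (h0 z)]; exact h1 z) hy
  have heq : (fun r => ∫ z in Ioi r, (z ^ 2)⁻¹ * φ z) =ᶠ[𝓝 r]
      fun y => (∫ z in Ioi r, (z ^ 2)⁻¹ * φ z) - ∫ z in r..y, (z ^ 2)⁻¹ * φ z := by
    filter_upwards [Ioi_mem_nhds hr] with y hy
    rw [← intervalIntegral.integral_Ioi_sub_Ioi' (hi r hr) (hi y hy)]
    ring
  have hcont : ContinuousAt (fun z => (z ^ 2)⁻¹ * φ z) r := by
    have : r ^ 2 ≠ 0 := by positivity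
    fun_prop (disch := assumption)
  have hd : HasDerivAt (fun y => ∫ z in r..y, (z ^ 2)⁻¹ * φ z) ((r ^ 2)⁻¹ * φ r) r :=
    intervalIntegral.integral_hasDerivAt_right (by simp)
      ((by fun_prop : Measurable fun z => (z ^ 2)⁻¹ * φ z).stronglyMeasurable.stronglyMeasurableAtFilter)
      hcont
  exact (hd.const_sub _).congr_of_eventuallyEq heq

include hφ h0 h1 in
lemma continuousAt_tailKernel (hc : Continuous φ) {r : ℝ} (hr : 0 < r) :
    ContinuousAt (tailKernel φ) r := by
  have heq : tailKernel φ =ᶠ[𝓝 r] fun r => (∫ z in Ioi r, (z ^ 2)⁻¹ * φ z) - φ r / r := by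
    filter_upwards [Ioi_mem_nhds hr] with y hy using tailKernel_eq hφ h0 h1 hy
  refine ContinuousAt.congr_of_eventuallyEq ?_ heq
  exact (hasDerivAt_integral_Ioi_inv_sq_mul hφ h0 h1 hc hr).continuousAt.sub
    (hc.continuousAt.div continuousAt_id hr.ne')

include hφ h0 h1 in
-- The endpoint of the integral and the quotient `φ r / r` each produce `φ r / r²`, with opposite
-- signs; only `-d / r` survives, as expected of `∫_{(r,∞)} z⁻¹ dφ`.
lemma hasDerivAt_tailKernel (hc : Continuous φ) {r d : ℝ} (hr : 0 < r) (hd : HasDerivAt φ d r) :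
    HasDerivAt (tailKernel φ) (-(d / r)) r := by
  have heq : tailKernel φ =ᶠ[𝓝 r] fun r => (∫ z in Ioi r, (z ^ 2)⁻¹ * φ z) - φ r / r := by
    filter_upwards [Ioi_mem_nhds hr] with y hy using tailKernel_eq hφ h0 h1 hy
  refine HasDerivAt.congr_of_eventuallyEq ?_ heq
  refine ((hasDerivAt_integral_Ioi_inv_sq_mul hφ h0 h1 hc hr).sub
    (hd.div (hasDerivAt_id r) hr.ne')).congr_deriv ?_
  simp only [id]
  field_simp
  ring

end tailKernel

/-- `F̂` solves the stationary equation `F̂(x) = ∫₀ˣ r ∫_{(r,∞)} z⁻¹ dΨ(F̂(z)) dr`. -/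
structure IsStationaryProfile (Ψ : ℝ → ℝ) (Fhat : Profile) : Prop where
  tendsto_one : Tendsto Fhat atTop (𝓝 1)
  eq : ∀ x, 0 < x → Fhat x = ∫ r in (0 : ℝ)..x, r * tailKernel (fun z => Ψ (Fhat z)) r

namespace IsC1Law

variable {Ψ : ℝ → ℝ}

lemma hasDerivWithinAt (hΨ : IsC1Law Ψ) {u : ℝ} (hu : u ∈ Icc (0 : ℝ) 1) :
    HasDerivWithinAt Ψ (dens Ψ u) (Icc 0 1) u :=
  (hΨ.contDiffOn.differentiableOn (by norm_num) u hu).hasDerivWithinAt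

lemma continuousOn_dens (hΨ : IsC1Law Ψ) : ContinuousOn (dens Ψ) (Icc 0 1) :=
  hΨ.contDiffOn.continuousOn_derivWithin (uniqueDiffOn_Icc zero_lt_one) le_rfl

lemma dens_nonneg (hΨ : IsC1Law Ψ) (u : ℝ) : 0 ≤ dens Ψ u := hΨ.monotoneOn.derivWithin_nonneg

lemma nonneg (hΨ : IsC1Law Ψ) {u : ℝ} (hu : u ∈ Icc (0 : ℝ) 1) : 0 ≤ Ψ u := by
  rw [← hΨ.map_zero]; exact hΨ.monotoneOn (by simp) hu hu.1

lemma le_one (hΨ : IsC1Law Ψ) {u : ℝ} (hu : u ∈ Icc (0 : ℝ) 1) : Ψ u ≤ 1 := by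
  rw [← hΨ.map_one]; exact hΨ.monotoneOn hu (by simp) hu.2

lemma exists_dens_le (hΨ : IsC1Law Ψ) : ∃ C, ∀ u ∈ Icc (0 : ℝ) 1, dens Ψ u ≤ C := by
  obtain ⟨C, hC⟩ := isCompact_Icc.exists_bound_of_continuousOn hΨ.continuousOn_dens
  exact ⟨C, fun u hu => (le_abs_self _).trans (hC u hu)⟩

end IsC1Law

lemma Profile.mem_Icc (F : Profile) (x : ℝ) : F x ∈ Icc (0 : ℝ) 1 := ⟨F.nonneg x, F.le_one x⟩

namespace IsStationaryProfile

variable {Ψ : ℝ → ℝ} {Fhat : Profile}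

section

variable (hΨ : IsC1Law Ψ)
include hΨ

lemma comp_monotone : Monotone fun z => Ψ (Fhat z) := fun _ _ h =>
  hΨ.monotoneOn (Fhat.mem_Icc _) (Fhat.mem_Icc _) (Fhat.monotone h)

lemma comp_nonneg (z : ℝ) : 0 ≤ Ψ (Fhat z) := hΨ.nonneg (Fhat.mem_Icc z)

lemma comp_le_one (z : ℝ) : Ψ (Fhat z) ≤ 1 := hΨ.le_one (Fhat.mem_Icc z)

lemma mul_kernel_mem {r : ℝ} (hr : 0 < r) :
    r * tailKernel (fun z => Ψ (Fhat z)) r ∈ Icc (0 : ℝ) (1 - Ψ (Fhat r)) :=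
  ⟨mul_nonneg hr.le (tailKernel_nonneg (comp_monotone hΨ) r),
    mul_tailKernel_le (comp_monotone hΨ) (comp_nonneg hΨ) (comp_le_one hΨ) hr⟩

lemma intervalIntegrable_mul_kernel {a b : ℝ} (ha : 0 ≤ a) (hab : a ≤ b) :
    IntervalIntegrable (fun r => r * tailKernel (fun z => Ψ (Fhat z)) r) volume a b := by
  rw [intervalIntegrable_iff_integrableOn_Ioc_of_le hab]
  refine Integrable.mono' (integrable_const 1) (measurable_id.mul
    (measurable_tailKernel (comp_monotone hΨ).measurable)).aestronglyMeasurable ?_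
  filter_upwards [ae_restrict_mem measurableSet_Ioc] with r hr
  have h := mul_kernel_mem (Fhat := Fhat) hΨ (ha.trans_lt hr.1)
  rw [Real.norm_of_nonneg h.1]
  linarith [h.2, comp_nonneg (Fhat := Fhat) hΨ r]

variable (hS : IsStationaryProfile Ψ Fhat)
include hS

/-- The density `r K(r)` lies between `0` and `1 - Ψ(F̂ r) ≤ 1`. -/
lemma sub_le {x y : ℝ} (hx : 0 < x) (hxy : x ≤ y) : Fhat y - Fhat x ≤ y - x := by
  rw [hS.eq x hx, hS.eq y (hx.trans_le hxy), intervalIntegral.integral_interval_sub_left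
    (intervalIntegrable_mul_kernel hΨ le_rfl (hx.le.trans hxy))
    (intervalIntegrable_mul_kernel hΨ le_rfl hx.le)]
  calc _ ≤ ∫ _r in x..y, (1 : ℝ) := by
        refine intervalIntegral.integral_mono_on hxy (intervalIntegrable_mul_kernel hΨ hx.le hxy)
          (by simp) fun r hr => ?_
        have h := mul_kernel_mem (Fhat := Fhat) hΨ (hx.trans_le hr.1)
        linarith [h.2, comp_nonneg (Fhat := Fhat) hΨ r]
    _ = y - x := by simp

lemma le_self {x : ℝ} (hx : 0 < x) : Fhat x ≤ x := by
  have h := hS.eq x hx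
  rw [h]
  calc _ ≤ ∫ _r in (0 : ℝ)..x, (1 : ℝ) := by
        refine intervalIntegral.integral_mono_on_of_le_Ioo hx.le
          (intervalIntegrable_mul_kernel hΨ le_rfl hx.le) (by simp) fun r hr => ?_
        have h := mul_kernel_mem (Fhat := Fhat) hΨ hr.1
        linarith [h.2, comp_nonneg (Fhat := Fhat) hΨ r]
    _ = x := by simp

lemma map_nonpos {x : ℝ} (hx : x ≤ 0) : Fhat x = 0 := by
  refine le_antisymm ?_ (Fhat.nonneg x)
  refine le_of_forall_pos_le_add fun ε hε => ?_
  rw [zero_add]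
  exact (Fhat.monotone (hx.trans hε.le)).trans (hS.le_self hΨ hε)

lemma continuous : Continuous Fhat := by
  have h : ∀ x y, x ≤ y → Fhat y - Fhat x ≤ y - x := by
    intro x y hxy
    rcases le_or_gt y 0 with hy | hy
    · rw [hS.map_nonpos hΨ hy, hS.map_nonpos hΨ (hxy.trans hy)]; linarith
    · rcases le_or_gt x 0 with hx | hx
      · rw [hS.map_nonpos hΨ hx]; linarith [hS.le_self hΨ hy]
      · exact hS.sub_le hΨ hx hxy
  refine LipschitzWith.continuous (K := 1) (LipschitzWith.of_dist_le_mul fun x y => ?_)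
  rw [NNReal.coe_one, one_mul, Real.dist_eq, Real.dist_eq]
  rcases le_total x y with hxy | hxy
  · rw [abs_sub_comm, abs_sub_comm x, abs_of_nonneg (sub_nonneg.2 (Fhat.monotone hxy)),
      abs_of_nonneg (sub_nonneg.2 hxy)]
    exact h x y hxy
  · rw [abs_of_nonneg (sub_nonneg.2 (Fhat.monotone hxy)), abs_of_nonneg (sub_nonneg.2 hxy)]
    exact h y x hxy

lemma continuous_comp : Continuous fun z => Ψ (Fhat z) :=
  hΨ.contDiffOn.continuousOn.comp_continuous (hS.continuous hΨ) Fhat.mem_Icc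

lemma hasDerivAt {x : ℝ} (hx : 0 < x) :
    HasDerivAt Fhat (x * tailKernel (fun z => Ψ (Fhat z)) x) x := by
  have hk := continuousAt_tailKernel (comp_monotone hΨ) (comp_nonneg hΨ) (comp_le_one hΨ)
    (hS.continuous_comp hΨ) hx
  have hd := intervalIntegral.integral_hasDerivAt_right
    (intervalIntegrable_mul_kernel (Fhat := Fhat) hΨ le_rfl hx.le)
    ((measurable_id.mul (measurable_tailKernel
      (comp_monotone (Fhat := Fhat) hΨ).measurable)).stronglyMeasurable.stronglyMeasurableAtFilter)
    (continuousAt_id.mul hk)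
  refine hd.congr_of_eventuallyEq ?_
  filter_upwards [Ioi_mem_nhds hx] with y hy using hS.eq y hy

lemma hasDerivAt_comp {x : ℝ} (hx : 0 < x) : HasDerivAt (fun z => Ψ (Fhat z))
    (dens Ψ (Fhat x) * (x * tailKernel (fun z => Ψ (Fhat z)) x)) x := by
  rw [← hasDerivWithinAt_univ]
  exact (hΨ.hasDerivWithinAt (Fhat.mem_Icc x)).comp x (hS.hasDerivAt hΨ hx).hasDerivWithinAt
    fun z _ => Fhat.mem_Icc z

lemma hasDerivAt_kernel {x : ℝ} (hx : 0 < x) : HasDerivAt (tailKernel fun z => Ψ (Fhat z))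
    (-(dens Ψ (Fhat x) * tailKernel (fun z => Ψ (Fhat z)) x)) x := by
  refine (hasDerivAt_tailKernel (comp_monotone hΨ) (comp_nonneg hΨ) (comp_le_one hΨ)
    (hS.continuous_comp hΨ) hx (hS.hasDerivAt_comp hΨ hx)).congr_deriv ?_
  field_simp

lemma continuous_dens_comp : Continuous fun z => dens Ψ (Fhat z) :=
  hΨ.continuousOn_dens.comp_continuous (hS.continuous hΨ) Fhat.mem_Icc

lemma tendsto_comp_atTop : Tendsto (fun z => Ψ (Fhat z)) atTop (𝓝 1) := by
  have h1 : Tendsto Fhat atTop (𝓝[Icc 0 1] 1) :=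
    tendsto_nhdsWithin_iff.2 ⟨hS.tendsto_one, Eventually.of_forall Fhat.mem_Icc⟩
  have := (hΨ.contDiffOn.continuousOn 1 (by simp)).tendsto.comp h1
  rwa [hΨ.map_one] at this

lemma tendsto_mul_kernel_atTop :
    Tendsto (fun x => x * tailKernel (fun z => Ψ (Fhat z)) x) atTop (𝓝 0) := by
  have h : Tendsto (fun x => 1 - Ψ (Fhat x)) atTop (𝓝 0) := by
    simpa using (hS.tendsto_comp_atTop hΨ).const_sub 1
  refine tendsto_of_tendsto_of_tendsto_of_le_of_le' tendsto_const_nhds h ?_ ?_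
  · filter_upwards [eventually_gt_atTop 0] with x hx using (mul_kernel_mem hΨ hx).1
  · filter_upwards [eventually_gt_atTop 0] with x hx using (mul_kernel_mem hΨ hx).2

lemma tendsto_kernel_atTop : Tendsto (tailKernel fun z => Ψ (Fhat z)) atTop (𝓝 0) := by
  have h := (hS.tendsto_mul_kernel_atTop hΨ).mul tendsto_inv_atTop_zero
  rw [zero_mul] at h
  refine h.congr' ?_
  filter_upwards [eventually_gt_atTop 0] with x hx
  field_simp

/-- The stationary profile has norm at most one. -/
lemma wnorm_one_le : wnorm 1 Fhat ≤ 1 := by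
  set K := tailKernel fun z => Ψ (Fhat z) with hK
  -- `Z` is a primitive of `F̂ x / x²`: from `F̂' = x K` and `K' = -ψ(F̂) K` all terms of `Z'` but
  -- this one cancel. Since `Z` rises from `0` at the origin to `1` at infinity, the norm is in fact
  -- equal to one.
  set Z : ℝ → ℝ := fun x => x * K x + Ψ (Fhat x) - Fhat x / x with hZ
  have hderiv : ∀ x ∈ Ioi (0 : ℝ), HasDerivAt Z (Fhat x / x ^ 2) x := by
    intro x hx
    have hx : 0 < x := hx
    refine ((((hasDerivAt_id x).mul (hS.hasDerivAt_kernel hΨ hx)).add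
      (hS.hasDerivAt_comp hΨ hx)).sub
      ((hS.hasDerivAt hΨ hx).div (hasDerivAt_id x) hx.ne')).congr_deriv ?_
    simp only [id]
    field_simp
    ring
  have hpos : ∀ x ∈ Ioi (0 : ℝ), 0 ≤ Fhat x / x ^ 2 := fun x _ =>
    div_nonneg (Fhat.nonneg x) (sq_nonneg x)
  have hlim : Tendsto Z atTop (𝓝 1) := by
    have h1 := ((hS.tendsto_mul_kernel_atTop hΨ).add (hS.tendsto_comp_atTop hΨ)).sub
      (hS.tendsto_one.mul tendsto_inv_atTop_zero)
    simpa [hZ, div_eq_mul_inv] using h1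
  have hΨ0 : Ψ (Fhat 0) = 0 := by rw [hS.map_nonpos hΨ le_rfl, hΨ.map_zero]
  -- A monotone majorant of `x K(x)` that tends to `0` at the origin; being monotone, it also bounds
  -- `F̂ x / x`, the average of `r K(r)` over `(0,x)`.
  set b : ℝ → ℝ := fun x => Ψ (Fhat (√x)) + √x with hb
  have hbmono : Monotone b := fun x y h =>
    add_le_add (comp_monotone hΨ (Real.sqrt_le_sqrt h)) (Real.sqrt_le_sqrt h)
  have hb0 : Tendsto b (𝓝[>] 0) (𝓝 0) := by
    have hc : Continuous b :=
      ((hS.continuous_comp hΨ).comp Real.continuous_sqrt).add Real.continuous_sqrt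
    have := (hc.tendsto 0).mono_left (nhdsWithin_le_nhds (s := Ioi 0))
    simpa [hb, hΨ0] using this
  have hKb : ∀ x, 0 < x → x * K x ≤ b x := by
    intro x hx
    have h := mul_tailKernel_le_sqrt (comp_monotone (Fhat := Fhat) hΨ) (comp_nonneg hΨ)
      (comp_le_one hΨ) hx
    rw [mul_one, ← div_eq_mul_inv, Real.div_sqrt] at h
    exact h
  have hK0 : Tendsto (fun x => x * K x) (𝓝[>] 0) (𝓝 0) := by
    refine tendsto_of_tendsto_of_tendsto_of_le_of_le' tendsto_const_nhds hb0 ?_ ?_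
    · filter_upwards [self_mem_nhdsWithin] with x hx using (mul_kernel_mem hΨ hx).1
    · filter_upwards [self_mem_nhdsWithin] with x hx using hKb x hx
  have hF0 : Tendsto (fun x => Fhat x / x) (𝓝[>] 0) (𝓝 0) := by
    refine tendsto_of_tendsto_of_tendsto_of_le_of_le' tendsto_const_nhds hb0 ?_ ?_
    · filter_upwards [self_mem_nhdsWithin] with x hx
      exact div_nonneg (Fhat.nonneg x) (le_of_lt hx)
    · filter_upwards [self_mem_nhdsWithin] with x hx
      have hx : 0 < x := hx
      rw [div_le_iff₀ hx, hS.eq x hx]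
      calc _ ≤ ∫ _r in (0 : ℝ)..x, b x := by
            refine intervalIntegral.integral_mono_on_of_le_Ioo hx.le
              (intervalIntegrable_mul_kernel hΨ le_rfl hx.le) (by simp) fun r hr => ?_
            exact (hKb r hr.1).trans (hbmono hr.2.le)
        _ = b x * x := by simp [mul_comm]
  -- The convention `F̂ 0 / 0 = 0` gives the value that makes `Z` right-continuous at `0`.
  have hZ0 : Z 0 = 0 := by simp [hZ, hΨ0]
  have hcont : ContinuousWithinAt Z (Ici 0) 0 := by
    rw [← Ioi_insert, continuousWithinAt_insert_self]
    have hφ0 : Tendsto (fun x => Ψ (Fhat x)) (𝓝[>] 0) (𝓝 0) := by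
      have := ((hS.continuous_comp hΨ).tendsto 0).mono_left (nhdsWithin_le_nhds (s := Ioi 0))
      rwa [hΨ0] at this
    have := (hK0.add hφ0).sub hF0
    rw [ContinuousWithinAt, hZ0]
    simpa [hZ] using this
  have hint := integrableOn_Ioi_deriv_of_nonneg hcont hderiv hpos hlim
  have hval := integral_Ioi_of_hasDerivAt_of_nonneg hcont hderiv hpos hlim
  rw [hZ0, sub_zero] at hval
  have : wnorm 1 Fhat = ∫⁻ x in Ioi 0, ENNReal.ofReal (Fhat x / x ^ 2) := by
    rw [wnorm]
    refine setLIntegral_congr_fun measurableSet_Ioi fun x hx => ?_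
    have hx : 0 < x := hx
    rw [abs_of_nonneg (Fhat.nonneg x), show (-1 - 1 : ℝ) = -((2 : ℕ) : ℝ) by norm_num,
      Real.rpow_neg hx.le, Real.rpow_natCast, mul_comm, div_eq_mul_inv]
  rw [this, ← ofReal_integral_eq_lintegral_ofReal hint
    ((ae_restrict_iff' measurableSet_Ioi).2 (Eventually.of_forall hpos)), hval]
  simp

end

section

variable {δ : ℝ} (hΨ : IsC1Law Ψ) (hS : IsStationaryProfile Ψ Fhat)
  (hineq : DensityInequality Ψ Fhat δ)
include hΨ hS hineq

/-- The numerator is the expression in the density inequality, which thereby becomes `|w'| ≤ (2-δ) w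
/ z`. -/
lemma hasDerivAt_weight {z : ℝ} (hz : 0 < z) : HasDerivAt (fun z => dens Ψ (Fhat z) / z)
    ((z * densDeriv Ψ (Fhat z) * deriv Fhat z - dens Ψ (Fhat z)) / z ^ 2) z := by
  have h1 : HasDerivAt (fun z => dens Ψ (Fhat z)) (densDeriv Ψ (Fhat z) * deriv Fhat z) z := by
    rw [← hasDerivWithinAt_univ]
    exact (hineq.differentiable z hz).hasDerivWithinAt.comp z
      (hS.hasDerivAt hΨ hz).differentiableAt.hasDerivAt.hasDerivWithinAt
      fun z _ => Fhat.mem_Icc z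
  refine (h1.div (hasDerivAt_id z) hz.ne').congr_deriv ?_
  simp only [id]
  ring

lemma exists_isWeight : ∃ C, IsWeight (fun z => dens Ψ (Fhat z) / z) δ C := by
  obtain ⟨C, hC⟩ := hΨ.exists_dens_le
  refine ⟨C, (hS.continuous_dens_comp hΨ).measurable.div measurable_id,
    fun z hz => (hS.hasDerivAt_weight hΨ hineq hz).differentiableAt,
    fun z hz => div_nonneg (hΨ.dens_nonneg _) hz.le, fun z hz => ?_, fun z hz => ?_⟩
  · have := hC _ (Fhat.mem_Icc z)
    gcongr
  · rw [(hS.hasDerivAt_weight hΨ hineq hz).deriv, abs_div, abs_of_pos (by positivity : 0 < z ^ 2),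
      div_le_iff₀ (by positivity)]
    refine (hineq.ineq z hz.le).trans (le_of_eq ?_)
    field_simp

/-- The chain rule `ψ(F̂) dF̂ = dΨ(F̂)` in integrated form. Since `w F̂' = ψ(F̂) K = -K'`, the
function `w (1 - F̂) - K` is a primitive of `w' (1 - F̂)` and vanishes at infinity. -/
lemma tailKernel_eq_tailOp (hδ : δ ≤ 2) {y : ℝ} (hy : 0 < y) :
    tailOp (fun z => dens Ψ (Fhat z) / z) (fun z => 1 - Fhat z) y =
      tailKernel (fun z => Ψ (Fhat z)) y := by
  obtain ⟨C, hw⟩ := hS.exists_isWeight hΨ hineq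
  set w : ℝ → ℝ := fun z => dens Ψ (Fhat z) / z with hwdef
  set K := tailKernel fun z => Ψ (Fhat z) with hK
  have hbd : ∀ z, |1 - Fhat z| ≤ 1 := fun z => by
    rw [abs_of_nonneg (sub_nonneg.2 (Fhat.le_one z))]; linarith [Fhat.nonneg z]
  have hd : ∀ z ∈ Ici y, HasDerivAt (fun z => w z * (1 - Fhat z) - K z)
      (deriv w z * (1 - Fhat z)) z := by
    intro z hz
    have hz : 0 < z := hy.trans_le hz
    refine ((((hw.differentiableAt z hz).hasDerivAt).mul
      ((hS.hasDerivAt hΨ hz).const_sub 1)).sub (hS.hasDerivAt_kernel hΨ hz)).congr_deriv ?_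
    simp only [hwdef]
    field_simp
    ring
  have hlim : Tendsto (fun z => w z * (1 - Fhat z) - K z) atTop (𝓝 0) := by
    have hw0 : Tendsto w atTop (𝓝 0) := by
      have hC0 : Tendsto (fun z : ℝ => C / z) atTop (𝓝 0) := tendsto_const_nhds.div_atTop tendsto_id
      refine tendsto_of_tendsto_of_tendsto_of_le_of_le' tendsto_const_nhds hC0 ?_ ?_
      · filter_upwards [eventually_gt_atTop 0] with z hz using hw.nonneg z hz
      · filter_upwards [eventually_gt_atTop 0] with z hz using hw.le z hz
    simpa using (hw0.mul (hS.tendsto_one.const_sub 1)).sub (hS.tendsto_kernel_atTop hΨ)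
  have hi := hw.integrableOn_deriv_mul hδ (g := fun z => 1 - Fhat z) (M := 1)
    (measurable_const.sub Fhat.measurable) hbd hy
  have := integral_Ioi_of_hasDerivAt_of_tendsto' hd hi hlim
  rw [tailOp, this]
  ring

/-- The constant family at the stationary profile is a solution. -/
theorem isFlow (hδ : δ ≤ 2) : IsFlow (fun z => dens Ψ (Fhat z) / z) 1 fun _ => Fhat where
  measurable _ := measurable_const
  mass _ := hS.tendsto_one
  norm_le _ := hS.wnorm_one_le hΨ
  fixed t x hx := by
    obtain ⟨C, hw⟩ := hS.exists_isWeight hΨ hineq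
    rcases hx.eq_or_lt with rfl | hx
    · simp
    have hy : ∀ s : ℝ, 0 < Real.exp (s - t) * x := fun s => by positivity
    have heq : ∀ s : ℝ, (Real.exp (s - t) * x) ^ 2 *
        ∫ z in Ioi (Real.exp (s - t) * x), dens Ψ (Fhat z) / z ∂Fhat.measure =
        (Real.exp (s - t) * x) * tailKernel (fun z => Ψ (Fhat z)) (Real.exp (s - t) * x) *
          (Real.exp (s - t) * x) := by
      intro s
      rw [hw.integral_stieltjes hδ hS.tendsto_one (hy s)]
      have := hS.tailKernel_eq_tailOp hΨ hineq hδ (hy s)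
      rw [tailOp] at this
      rw [this]
      ring
    simp_rw [heq]
    -- With `y = e^{s-t} x` the integrand `y² K(y) = y F̂'(y)` is the derivative of `s ↦ F̂(y)`, so
    -- the time integral telescopes to `F̂(x) - F̂(e^{-t} x)`.
    have hd : ∀ s : ℝ, HasDerivAt (fun s => Fhat (Real.exp (s - t) * x))
        ((Real.exp (s - t) * x) * tailKernel (fun z => Ψ (Fhat z)) (Real.exp (s - t) * x) *
          (Real.exp (s - t) * x)) s := by
      intro s
      have h1 : HasDerivAt (fun s : ℝ => Real.exp (s - t) * x) (Real.exp (s - t) * x) s := by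
        simpa using (((hasDerivAt_id s).sub_const (t : ℝ)).exp).mul_const x
      exact (hS.hasDerivAt hΨ (hy s)).comp s h1
    have hcont : Continuous fun s : ℝ => (Real.exp (s - t) * x) *
        tailKernel (fun z => Ψ (Fhat z)) (Real.exp (s - t) * x) * (Real.exp (s - t) * x) := by
      rw [continuous_iff_continuousAt]
      intro s
      have h1 : ContinuousAt (fun s : ℝ => Real.exp (s - t) * x) s := by fun_prop
      have h2 : ContinuousAt (fun s : ℝ =>
          tailKernel (fun z => Ψ (Fhat z)) (Real.exp (s - t) * x)) s :=
        ContinuousAt.comp (f := fun s : ℝ => Real.exp (s - t) * x)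
          (hS.hasDerivAt_kernel hΨ (hy s)).continuousAt h1
      exact (h1.mul h2).mul h1
    rw [intervalIntegral.integral_eq_sub_of_hasDerivAt (fun s _ => hd s)
      (hcont.intervalIntegrable _ _)]
    simp

end

end IsStationaryProfile

/-- Contraction towards a stationary profile. -/
theorem wnorm_sub_le_of_isStationaryProfile {Ψ : ℝ → ℝ} (hΨ : IsC1Law Ψ) {Fhat : Profile}
    (hS : IsStationaryProfile Ψ Fhat) {δ : ℝ} (hδ0 : 0 < δ) (hδ1 : δ ≤ 1)
    (hineq : DensityInequality Ψ Fhat δ) {α : ℝ} (hα1 : α ≤ 1) {F : ℝ≥0 → Profile}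
    (hfix : IsFixedPoint Ψ Fhat α F) (t : ℝ≥0) :
    wnorm δ (fun x => F t x - α * Fhat x) ≤
      ENNReal.ofReal (2 * (1 + δ⁻¹) * Real.exp (-δ * t)) := by
  obtain ⟨C, hw⟩ := hS.exists_isWeight hΨ hineq
  have hF : IsFlow (fun z => dens Ψ (Fhat z) / z) α F :=
    ⟨hfix.measurable, hfix.mass, hfix.norm_le, hfix.fixed⟩
  exact hF.wnorm_sub_le hw hδ0 hδ1 hα1 (hS.isFlow hΨ hineq (by linarith)) t

end

/-! ### A single split: selected length and mean increment -/

noncomputable section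

/-- Configurations with nonnegative lengths of total length one. -/
structure IsConfig (I : Multiset ℝ) : Prop where
  nonneg : ∀ l ∈ I, 0 ≤ l
  sum_eq : I.sum = 1

/-- The change of the size-biased distribution function at `y` when a fragment of length `l` is cut
at the fraction `v`. -/
def splitIncr (y l v : ℝ) : ℝ :=
  if y < l then (if v * l ≤ y then v * l else 0) + (if (1 - v) * l ≤ y then (1 - v) * l else 0)
  else 0

lemma sizeBiased_cons (a : ℝ) (I : Multiset ℝ) (x : ℝ) :
    sizeBiased (a ::ₘ I) x = (if a ≤ x then a else 0) + sizeBiased I x := by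
  unfold sizeBiased
  split_ifs with h <;> simp [h]

lemma sizeBiased_nonneg {I : Multiset ℝ} (hI : ∀ l ∈ I, 0 ≤ l) (x : ℝ) : 0 ≤ sizeBiased I x :=
  Multiset.sum_nonneg fun l hl => hI l (Multiset.mem_of_mem_filter hl)

lemma sizeBiased_mono {I : Multiset ℝ} (hI : ∀ l ∈ I, 0 ≤ l) : Monotone (sizeBiased I) := by
  induction I using Multiset.induction_on with
  | empty => intro x y _; simp [sizeBiased]
  | cons a I ih =>
    intro x y hxy
    rw [sizeBiased_cons, sizeBiased_cons]
    refine add_le_add ?_ (ih (fun l hl => hI l (Multiset.mem_cons_of_mem hl)) hxy)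
    have := hI a (Multiset.mem_cons_self a I)
    split_ifs <;> linarith

lemma sizeBiased_le_sum {I : Multiset ℝ} (hI : ∀ l ∈ I, 0 ≤ l) (x : ℝ) :
    sizeBiased I x ≤ I.sum := by
  induction I using Multiset.induction_on with
  | empty => simp [sizeBiased]
  | cons a I ih =>
    rw [sizeBiased_cons, Multiset.sum_cons]
    refine add_le_add ?_ (ih fun l hl => hI l (Multiset.mem_cons_of_mem hl))
    have := hI a (Multiset.mem_cons_self a I)
    split_ifs <;> linarith

namespace IsConfig

variable {I : Multiset ℝ}

lemma sizeBiased_le_one (hI : IsConfig I) (x : ℝ) : sizeBiased I x ≤ 1 :=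
  hI.sum_eq ▸ sizeBiased_le_sum hI.nonneg x

lemma sizeBiased_mem_Icc (hI : IsConfig I) (x : ℝ) : sizeBiased I x ∈ Icc (0 : ℝ) 1 :=
  ⟨sizeBiased_nonneg hI.nonneg x, hI.sizeBiased_le_one x⟩

/-- The length selected by `u ∈ (0,1]` belongs to the configuration, and the selection map is the
generalized inverse of the size-biased distribution function. -/
lemma selectedLength_spec (hI : IsConfig I) {u : ℝ} (hu : u ∈ Ioc (0 : ℝ) 1) :
    selectedLength I u ∈ I ∧ ∀ x, u ≤ sizeBiased I x ↔ selectedLength I u ≤ x := by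
  -- The distribution function jumps only at lengths present, so it has at `x` the same value as at
  -- the largest length below `x`; `u > 0` ensures that there is one.
  have hbelow : ∀ x, u ≤ sizeBiased I x → ∃ m ∈ I, m ≤ x ∧ u ≤ sizeBiased I m := by
    intro x hx
    have hne : (I.filter (fun l => l ≤ x)).toFinset.Nonempty := by
      rw [Finset.nonempty_iff_ne_empty]
      intro h
      rw [Multiset.toFinset_eq_empty] at h
      rw [sizeBiased, h, Multiset.sum_zero] at hx
      linarith [hu.1]
    obtain ⟨m, hm, hmax⟩ := Finset.exists_max_image _ id hne
    rw [Multiset.mem_toFinset, Multiset.mem_filter] at hm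
    refine ⟨m, hm.1, hm.2, hx.trans (le_of_eq ?_)⟩
    unfold sizeBiased
    congr 1
    refine Multiset.filter_congr fun l hl => ⟨fun h => ?_, fun h => h.trans hm.2⟩
    exact hmax l (by rw [Multiset.mem_toFinset, Multiset.mem_filter]; exact ⟨hl, h⟩)
  have htop : u ≤ sizeBiased I 1 := by
    have : sizeBiased I 1 = I.sum := by
      unfold sizeBiased
      rw [Multiset.filter_eq_self.2]
      intro l hl
      rw [← hI.sum_eq]
      exact Multiset.single_le_sum hI.nonneg l hl
    rw [this, hI.sum_eq]; exact hu.2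
  have hne : (I.toFinset.filter fun m => u ≤ sizeBiased I m).Nonempty := by
    obtain ⟨m, hm, _, h⟩ := hbelow 1 htop
    exact ⟨m, by simp [hm, h]⟩
  obtain ⟨m, hm, hmin⟩ := Finset.exists_min_image _ id hne
  rw [Finset.mem_filter, Multiset.mem_toFinset] at hm
  have hiff : ∀ x, u ≤ sizeBiased I x ↔ m ≤ x := by
    refine fun x => ⟨fun h => ?_, fun h => hm.2.trans (sizeBiased_mono hI.nonneg h)⟩
    obtain ⟨k, hk, hkx, hk2⟩ := hbelow x h
    exact (hmin k (by simp [hk, hk2])).trans hkx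
  have hsel : selectedLength I u = m := by
    rw [selectedLength, show {x : ℝ | u ≤ sizeBiased I x} = Ici m from ext hiff, csInf_Ici]
  rw [hsel]
  exact ⟨hm.1, hiff⟩

lemma splitStep (hI : IsConfig I) {u v : ℝ} (hu : u ∈ Ioc (0 : ℝ) 1) (hv : v ∈ Icc (0 : ℝ) 1) :
    IsConfig (splitStep I u v) := by
  have hmem := (hI.selectedLength_spec hu).1
  have h0 := hI.nonneg _ hmem
  constructor
  · intro l hl
    rw [_root_.splitStep, Multiset.mem_cons, Multiset.mem_cons] at hl
    rcases hl with rfl | rfl | hl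
    · exact mul_nonneg hv.1 h0
    · exact mul_nonneg (sub_nonneg.2 hv.2) h0
    · exact hI.nonneg l (Multiset.mem_of_mem_erase hl)
  · have := hI.sum_eq
    rw [← Multiset.cons_erase hmem, Multiset.sum_cons] at this
    rw [_root_.splitStep, Multiset.sum_cons, Multiset.sum_cons]
    linarith

/-- Cutting a length already counted changes nothing, since both pieces are still counted; cutting a
longer one adds exactly the pieces that fall below `y`. -/
lemma sizeBiased_splitStep (hI : IsConfig I) {u v : ℝ} (hu : u ∈ Ioc (0 : ℝ) 1)
    (hv : v ∈ Icc (0 : ℝ) 1) (y : ℝ) : sizeBiased (_root_.splitStep I u v) y =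
      sizeBiased I y + splitIncr y (selectedLength I u) v := by
  have hmem := (hI.selectedLength_spec hu).1
  set l := selectedLength I u with hl
  have h0 := hI.nonneg _ hmem
  have h1 : sizeBiased I y = (if l ≤ y then l else 0) + sizeBiased (I.erase l) y := by
    rw [← sizeBiased_cons, Multiset.cons_erase hmem]
  rw [_root_.splitStep, sizeBiased_cons, sizeBiased_cons, h1, splitIncr]
  by_cases hly : l ≤ y
  · have h2 : v * l ≤ y := (mul_le_of_le_one_left h0 hv.2).trans hly
    have h3 : (1 - v) * l ≤ y := (mul_le_of_le_one_left h0 (by linarith [hv.1])).trans hly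
    rw [if_pos h2, if_pos h3, if_pos hly, if_neg (not_lt.2 hly)]
    ring
  · rw [if_neg hly, if_pos (not_le.1 hly)]
    ring

end IsConfig

lemma isConfig_splitChain {I₀ : Multiset ℝ} (h : IsConfig I₀) {u v : ℕ → ℝ}
    (hu : ∀ n, u n ∈ Ioc (0 : ℝ) 1) (hv : ∀ n, v n ∈ Icc (0 : ℝ) 1) (n : ℕ) :
    IsConfig (splitChain I₀ u v n) := by
  induction n with
  | zero => exact h
  | succ n ih => exact ih.splitStep (hu n) (hv n)

lemma splitIncr_mem_Icc {y l v : ℝ} (hy : 0 ≤ y) (hv : v ∈ Icc (0 : ℝ) 1) :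
    splitIncr y l v ∈ Icc 0 (2 * y) := by
  unfold splitIncr
  split_ifs with h1 h2 h3 h3
  · have := mul_nonneg hv.1 (hy.trans h1.le)
    have := mul_nonneg (sub_nonneg.2 hv.2) (hy.trans h1.le)
    constructor <;> linarith
  · have := mul_nonneg hv.1 (hy.trans h1.le)
    constructor <;> linarith
  · have := mul_nonneg (sub_nonneg.2 hv.2) (hy.trans h1.le)
    constructor <;> linarith
  · constructor <;> linarith
  · constructor <;> linarith

lemma measurable_splitIncr (y : ℝ) : Measurable fun p : ℝ × ℝ => splitIncr y p.1 p.2 := by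
  unfold splitIncr
  refine Measurable.ite (measurableSet_lt (by fun_prop) (by fun_prop)) (Measurable.add ?_ ?_)
    measurable_const
  · exact Measurable.ite (measurableSet_le (by fun_prop) (by fun_prop)) (by fun_prop)
      measurable_const
  · exact Measurable.ite (measurableSet_le (by fun_prop) (by fun_prop)) (by fun_prop)
      measurable_const

/-- The mean increment at a uniform cut. -/
lemma integral_splitIncr {y : ℝ} (hy : 0 < y) (l : ℝ) :
    ∫ v in Icc (0 : ℝ) 1, splitIncr y l v = if y < l then y ^ 2 / l else 0 := by
  unfold splitIncr
  split_ifs with hl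
  · have hl0 : 0 < l := hy.trans hl
    rw [integral_Icc_eq_integral_Ioc, ← intervalIntegral.integral_of_le zero_le_one]
    have hmeas : Measurable fun v : ℝ => if v * l ≤ y then v * l else 0 :=
      Measurable.ite (measurableSet_le (by fun_prop) (by fun_prop)) (by fun_prop) measurable_const
    have hi : IntervalIntegrable (fun v : ℝ => if v * l ≤ y then v * l else 0) volume 0 1 := by
      rw [intervalIntegrable_iff_integrableOn_Ioc_of_le zero_le_one]
      refine Integrable.mono' (integrable_const y) hmeas.aestronglyMeasurable ?_
      filter_upwards [ae_restrict_mem measurableSet_Ioc] with v hv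
      have := mul_nonneg hv.1.le hl0.le
      rw [Real.norm_eq_abs]
      split_ifs with h
      · rwa [abs_of_nonneg this]
      · simpa using hy.le
    have hi2 : IntervalIntegrable (fun v : ℝ => if (1 - v) * l ≤ y then (1 - v) * l else 0)
        volume 0 1 := by
      have := hi.comp_sub_left 1
      simpa using this.symm
    -- Each piece contributes `∫_0^{y/l} v l dv = y²/(2l)`; the second reduces to the first by `v ↦
    -- 1 - v`.
    have hval : ∫ v in (0 : ℝ)..1, (if v * l ≤ y then v * l else 0) = y ^ 2 / l / 2 := by
      rw [intervalIntegral.integral_of_le zero_le_one]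
      have h1 : (fun v : ℝ => if v * l ≤ y then v * l else 0) =
          (Iic (y / l)).indicator fun v => v * l := by
        ext v
        simp only [indicator, mem_Iic, le_div_iff₀ hl0]
      have h2 : Ioc (0 : ℝ) 1 ∩ Iic (y / l) = Ioc 0 (y / l) := by
        rw [Ioc_inter_Iic, min_eq_right]
        rw [div_le_one hl0]; exact hl.le
      rw [h1, setIntegral_indicator measurableSet_Iic, h2,
        ← intervalIntegral.integral_of_le (by positivity), intervalIntegral.integral_mul_const,
        integral_id]
      field_simp
      ring
    rw [intervalIntegral.integral_add hi hi2,
      intervalIntegral.integral_comp_sub_left (fun v => if v * l ≤ y then v * l else 0) 1]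
    simp only [sub_self, sub_zero, hval]
    ring
  · simp

end

/-! ### Mean evolution of the size-biased distribution function along the arrivals -/

noncomputable section

/-- Independent selections in `(0,1]` with distribution function `Ψ` and uniform cuts in `[0,1]`. -/
structure IsSplitInput (Ψ : ℝ → ℝ) {Ω : Type*} [MeasurableSpace Ω] (P : Measure Ω)
    (U V : ℕ → Ω → ℝ) : Prop where
  measurable_sel : ∀ n, Measurable (U n)
  measurable_cut : ∀ n, Measurable (V n)
  sel_mem : ∀ n ω, U n ω ∈ Ioc (0 : ℝ) 1
  cut_mem : ∀ n ω, V n ω ∈ Icc (0 : ℝ) 1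
  sel_law : ∀ n, ∀ u ∈ Icc (0 : ℝ) 1, P {ω | U n ω ≤ u} = ENNReal.ofReal (Ψ u)
  cut_law : ∀ n, P.map (V n) = volume.restrict (Icc 0 1)
  indep : iIndepFun (Sum.elim U V) P

/-- The size-biased distribution function at `y` after `n` arrivals. -/
def chainCdf {Ω : Type*} (I₀ : Multiset ℝ) (U V : ℕ → Ω → ℝ) (n : ℕ) (y : ℝ) (ω : Ω) : ℝ :=
  sizeBiased (splitChain I₀ (fun k => U k ω) (fun k => V k ω) n) y

/-- The length of the fragment that is cut at the arrival with index `n`. -/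
def chainSel {Ω : Type*} (I₀ : Multiset ℝ) (U V : ℕ → Ω → ℝ) (n : ℕ) (ω : Ω) : ℝ :=
  selectedLength (splitChain I₀ (fun k => U k ω) (fun k => V k ω) n) (U n ω)

/-- The σ-algebra generated by the inputs with index in `S`. -/
abbrev inputAlgebra {Ω : Type*} (U V : ℕ → Ω → ℝ) (S : Set (ℕ ⊕ ℕ)) : MeasurableSpace Ω :=
  ⨆ i ∈ S, MeasurableSpace.comap (Sum.elim U V i) inferInstance

/-- The indices of the inputs used before the arrival with index `n`. -/
def pastIndices (n : ℕ) : Set (ℕ ⊕ ℕ) := {i | Sum.elim id id i < n}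

/-- Gives measurability of the selected length from that of the distribution functions, so that no
σ-algebra on multisets is needed. -/
lemma measurable_of_le_iff {Ω : Type*} {m : MeasurableSpace Ω} {S u : Ω → ℝ} {H : ℝ → Ω → ℝ}
    (hH : ∀ y, Measurable (H y)) (hu : Measurable u) (h : ∀ y ω, u ω ≤ H y ω ↔ S ω ≤ y) :
    Measurable S := by
  refine measurable_of_Iic fun y => ?_
  have : S ⁻¹' Iic y = {ω | u ω ≤ H y ω} := by
    ext ω; exact (h y ω).symm
  rw [this]
  exact measurableSet_le hu (hH y)

namespace IsSplitInput

variable {Ψ : ℝ → ℝ} {Ω : Type*} [mΩ : MeasurableSpace Ω] {P : Measure Ω} {U V : ℕ → Ω → ℝ}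
  {I₀ : Multiset ℝ}

lemma measurable (h : IsSplitInput Ψ P U V) (i : ℕ ⊕ ℕ) : Measurable (Sum.elim U V i) := by
  rcases i with n | n
  · exact h.measurable_sel n
  · exact h.measurable_cut n

lemma inputAlgebra_le (h : IsSplitInput Ψ P U V) (S : Set (ℕ ⊕ ℕ)) : inputAlgebra U V S ≤ mΩ :=
  iSup₂_le fun i _ => (h.measurable i).comap_le

omit mΩ in
lemma measurable_input {S : Set (ℕ ⊕ ℕ)} {i : ℕ ⊕ ℕ} (hi : i ∈ S) :
    Measurable[inputAlgebra U V S] (Sum.elim U V i) :=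
  (comap_measurable _).mono (le_iSup₂ (f := fun i (_ : i ∈ S) =>
    MeasurableSpace.comap (Sum.elim U V i) inferInstance) i hi) le_rfl

lemma indepFun_of_disjoint (h : IsSplitInput Ψ P U V) {S T : Set (ℕ ⊕ ℕ)} (hST : Disjoint S T)
    {f g : Ω → ℝ} (hf : Measurable[inputAlgebra U V S] f) (hg : Measurable[inputAlgebra U V T] g) :
    IndepFun f g P := by
  have := indep_iSup_of_disjoint (fun i => (h.measurable i).comap_le) h.indep.iIndep hST
  exact indep_of_indep_of_le_left (indep_of_indep_of_le_right this hg.comap_le) hf.comap_le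

lemma isConfig (h : IsSplitInput Ψ P U V) (hI : IsConfig I₀) (n : ℕ) (ω : Ω) :
    IsConfig (splitChain I₀ (fun k => U k ω) (fun k => V k ω) n) :=
  isConfig_splitChain hI (fun k => h.sel_mem k ω) (fun k => h.cut_mem k ω) n

lemma le_chainCdf_iff (h : IsSplitInput Ψ P U V) (hI : IsConfig I₀) (n : ℕ) (y : ℝ) (ω : Ω) :
    U n ω ≤ chainCdf I₀ U V n y ω ↔ chainSel I₀ U V n ω ≤ y :=
  ((h.isConfig hI n ω).selectedLength_spec (h.sel_mem n ω)).2 y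

lemma chainCdf_succ (h : IsSplitInput Ψ P U V) (hI : IsConfig I₀) (n : ℕ) (y : ℝ) (ω : Ω) :
    chainCdf I₀ U V (n + 1) y ω =
      chainCdf I₀ U V n y ω + splitIncr y (chainSel I₀ U V n ω) (V n ω) :=
  (h.isConfig hI n ω).sizeBiased_splitStep (h.sel_mem n ω) (h.cut_mem n ω) y

lemma chainCdf_mem (h : IsSplitInput Ψ P U V) (hI : IsConfig I₀) (n : ℕ) (y : ℝ) (ω : Ω) :
    chainCdf I₀ U V n y ω ∈ Icc (0 : ℝ) 1 := (h.isConfig hI n ω).sizeBiased_mem_Icc y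

lemma chainCdf_mono (h : IsSplitInput Ψ P U V) (hI : IsConfig I₀) (n : ℕ) (ω : Ω) :
    Monotone fun y => chainCdf I₀ U V n y ω := sizeBiased_mono (h.isConfig hI n ω).nonneg

lemma measurable_chainSel_of (h : IsSplitInput Ψ P U V) (hI : IsConfig I₀) {n : ℕ}
    {m : MeasurableSpace Ω} (hH : ∀ y, Measurable[m] (chainCdf I₀ U V n y))
    (hU : Measurable[m] (U n)) : Measurable[m] (chainSel I₀ U V n) :=
  measurable_of_le_iff hH hU (le_chainCdf_iff (mΩ := mΩ) h hI n)

/-- The distribution functions after `n` arrivals and the selection determine the selected length,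
and this and the cut determine the next distribution functions. Independence of the later inputs
follows. -/
lemma measurable_chainCdf_past (h : IsSplitInput Ψ P U V) (hI : IsConfig I₀) (n : ℕ) :
    ∀ y, Measurable[inputAlgebra U V (pastIndices n)] (chainCdf I₀ U V n y) := by
  induction n with
  | zero =>
    intro y
    have : chainCdf I₀ U V 0 y = fun _ => sizeBiased I₀ y := rfl
    rw [this]
    exact @measurable_const _ _ _ (_) _
  | succ n ih =>
    intro y
    have hle : inputAlgebra U V (pastIndices n) ≤ inputAlgebra U V (pastIndices (n + 1)) :=
      biSup_mono fun i hi => Nat.lt_succ_of_lt hi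
    have hH : ∀ y, Measurable[inputAlgebra U V (pastIndices (n + 1))] (chainCdf I₀ U V n y) :=
      fun y => (ih y).mono hle le_rfl
    have hU : Measurable[inputAlgebra U V (pastIndices (n + 1))] (U n) :=
      measurable_input (i := Sum.inl n) (Nat.lt_succ_self n)
    have hV : Measurable[inputAlgebra U V (pastIndices (n + 1))] (V n) :=
      measurable_input (i := Sum.inr n) (Nat.lt_succ_self n)
    have heq : chainCdf I₀ U V (n + 1) y = fun ω => chainCdf I₀ U V n y ω +
        splitIncr y (chainSel I₀ U V n ω) (V n ω) := funext fun ω => h.chainCdf_succ hI n y ω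
    rw [heq]
    exact (hH y).add ((measurable_splitIncr y).comp
      ((h.measurable_chainSel_of hI hH hU).prodMk hV))

lemma measurable_chainCdf (h : IsSplitInput Ψ P U V) (hI : IsConfig I₀) (n : ℕ) (y : ℝ) :
    Measurable (chainCdf I₀ U V n y) :=
  (h.measurable_chainCdf_past hI n y).mono (h.inputAlgebra_le _) le_rfl

lemma measurable_chainSel (h : IsSplitInput Ψ P U V) (hI : IsConfig I₀) (n : ℕ) :
    Measurable (chainSel I₀ U V n) :=
  h.measurable_chainSel_of hI (h.measurable_chainCdf hI n) (h.measurable_sel n)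

lemma indepFun_chainCdf (h : IsSplitInput Ψ P U V) (hI : IsConfig I₀) (n : ℕ) (y : ℝ) :
    IndepFun (chainCdf I₀ U V n y) (U n) P := by
  refine h.indepFun_of_disjoint (S := pastIndices n) (T := {Sum.inl n}) ?_
    (h.measurable_chainCdf_past hI n y) (measurable_input (i := Sum.inl n) rfl)
  rw [disjoint_singleton_right]
  simp [pastIndices]

lemma indepFun_chainSel (h : IsSplitInput Ψ P U V) (hI : IsConfig I₀) (n : ℕ) :
    IndepFun (chainSel I₀ U V n) (V n) P := by
  refine h.indepFun_of_disjoint (S := pastIndices n ∪ {Sum.inl n}) (T := {Sum.inr n}) ?_ ?_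
    (measurable_input (i := Sum.inr n) rfl)
  · rw [disjoint_singleton_right]
    simp [pastIndices]
  · refine h.measurable_chainSel_of hI (fun y => ?_) (measurable_input (i := Sum.inl n) (by simp))
    exact (h.measurable_chainCdf_past hI n y).mono (biSup_mono fun i hi => Or.inl hi) le_rfl

/-- The mean of `Ψ` along the distribution function after `n` arrivals. -/
def _root_.meanLaw (P : Measure Ω) (Ψ : ℝ → ℝ) (I₀ : Multiset ℝ) (U V : ℕ → Ω → ℝ) (n : ℕ)
    (z : ℝ) : ℝ := ∫ ω, Ψ (chainCdf I₀ U V n z ω) ∂P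

lemma meanLaw_nonneg (hΨ : IsC1Law Ψ) (h : IsSplitInput Ψ P U V) (hI : IsConfig I₀) (n : ℕ)
    (z : ℝ) : 0 ≤ meanLaw P Ψ I₀ U V n z :=
  integral_nonneg fun ω => hΨ.nonneg (h.chainCdf_mem hI n z ω)

variable [IsProbabilityMeasure P]

lemma integrable_chainCdf (h : IsSplitInput Ψ P U V) (hI : IsConfig I₀) (n : ℕ) (y : ℝ) :
    Integrable (chainCdf I₀ U V n y) P := by
  refine Integrable.mono' (integrable_const 1) (h.measurable_chainCdf hI n y).aestronglyMeasurable
    (Eventually.of_forall fun ω => ?_)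
  have := h.chainCdf_mem hI n y ω
  rw [Real.norm_of_nonneg this.1]
  exact this.2

lemma measurable_comp {g : ℝ → ℝ} (hg : ContinuousOn g (Icc 0 1)) {f : Ω → ℝ} (hf : Measurable f)
    (hmem : ∀ ω, f ω ∈ Icc (0 : ℝ) 1) : Measurable fun ω => g (f ω) := by
  have hc : Continuous (IccExtend zero_le_one ((Icc (0 : ℝ) 1).domRestrict g)) :=
    (continuousOn_iff_continuous_domRestrict.1 hg).Icc_extend'
  have : (fun ω => g (f ω)) =
      fun ω => IccExtend zero_le_one ((Icc (0 : ℝ) 1).domRestrict g) (f ω) := by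
    ext ω
    rw [IccExtend_of_mem _ _ (hmem ω)]
    rfl
  rw [this]
  exact hc.measurable.comp hf

lemma integrable_comp (hΨ : IsC1Law Ψ) {f : Ω → ℝ} (hf : Measurable f)
    (hmem : ∀ ω, f ω ∈ Icc (0 : ℝ) 1) : Integrable (fun ω => Ψ (f ω)) P := by
  refine Integrable.mono' (integrable_const 1)
    (measurable_comp hΨ.contDiffOn.continuousOn hf hmem).aestronglyMeasurable
    (Eventually.of_forall fun ω => ?_)
  rw [Real.norm_of_nonneg (hΨ.nonneg (hmem ω))]
  exact hΨ.le_one (hmem ω)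

/-- The event is `U n ≤ H` with `H` the current distribution function at `z`. As `U n` is
independent of `H`, its conditional probability is `Ψ(H)`. -/
lemma measure_chainSel_le (hΨ : IsC1Law Ψ) (h : IsSplitInput Ψ P U V) (hI : IsConfig I₀) (n : ℕ)
    (z : ℝ) : P {ω | chainSel I₀ U V n ω ≤ z} = ENNReal.ofReal (meanLaw P Ψ I₀ U V n z) := by
  have hH := h.measurable_chainCdf hI n z
  have hU := h.measurable_sel n
  have hset : {ω | chainSel I₀ U V n ω ≤ z} =
      (fun ω => (chainCdf I₀ U V n z ω, U n ω)) ⁻¹' {p | p.2 ≤ p.1} := by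
    ext ω; exact (h.le_chainCdf_iff hI n z ω).symm
  have hms : MeasurableSet {p : ℝ × ℝ | p.2 ≤ p.1} := measurableSet_le measurable_snd measurable_fst
  have := Measure.isProbabilityMeasure_map (μ := P) hU.aemeasurable
  rw [hset, ← Measure.map_apply (hH.prodMk hU) hms,
    (indepFun_iff_map_prod_eq_prod_map_map hH.aemeasurable hU.aemeasurable).1
      (h.indepFun_chainCdf hI n z), Measure.prod_apply hms,
    lintegral_map (measurable_measure_prodMk_left hms) hH, meanLaw,
    ofReal_integral_eq_lintegral_ofReal (integrable_comp hΨ hH (h.chainCdf_mem hI n z))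
      (Eventually.of_forall fun ω => hΨ.nonneg (h.chainCdf_mem hI n z ω))]
  refine lintegral_congr fun ω => ?_
  rw [Measure.map_apply hU (measurable_prodMk_left hms)]
  exact h.sel_law n _ (h.chainCdf_mem hI n z ω)

lemma meanLaw_mono (hΨ : IsC1Law Ψ) (h : IsSplitInput Ψ P U V) (hI : IsConfig I₀) (n : ℕ) :
    Monotone (meanLaw P Ψ I₀ U V n) := fun y z hyz =>
  integral_mono (integrable_comp hΨ (h.measurable_chainCdf hI n y) (h.chainCdf_mem hI n y))
    (integrable_comp hΨ (h.measurable_chainCdf hI n z) (h.chainCdf_mem hI n z)) fun ω =>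
    hΨ.monotoneOn (h.chainCdf_mem hI n y ω) (h.chainCdf_mem hI n z ω) (h.chainCdf_mono hI n ω hyz)

lemma meanLaw_le_one (hΨ : IsC1Law Ψ) (h : IsSplitInput Ψ P U V) (hI : IsConfig I₀) (n : ℕ)
    (z : ℝ) : meanLaw P Ψ I₀ U V n z ≤ 1 := by
  have := integral_mono (integrable_comp (P := P) hΨ (h.measurable_chainCdf hI n z)
    (h.chainCdf_mem hI n z)) (integrable_const 1) fun ω => hΨ.le_one (h.chainCdf_mem hI n z ω)
  simpa [meanLaw] using this

/-- Write `1/ℓ = ∫_ℓ^∞ z⁻² dz` and apply Fubini; the probability of `y < ℓ ≤ z` is the increment of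
`meanLaw` from `y` to `z`. -/
lemma integral_inv_chainSel (hΨ : IsC1Law Ψ) (h : IsSplitInput Ψ P U V) (hI : IsConfig I₀) (n : ℕ)
    {y : ℝ} (hy : 0 < y) :
    ∫ ω, (if y < chainSel I₀ U V n ω then y ^ 2 / chainSel I₀ U V n ω else 0) ∂P =
      y ^ 2 * tailKernel (meanLaw P Ψ I₀ U V n) y := by
  set ℓ := chainSel I₀ U V n with hℓ
  have hm : Measurable ℓ := h.measurable_chainSel hI n
  have hset : MeasurableSet {p : Ω × ℝ | y < ℓ p.1 ∧ ℓ p.1 ≤ p.2} := by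
    have : {p : Ω × ℝ | y < ℓ p.1 ∧ ℓ p.1 ≤ p.2} =
        {p : Ω × ℝ | y < ℓ p.1} ∩ {p : Ω × ℝ | ℓ p.1 ≤ p.2} := by ext; simp
    rw [this]
    exact (measurableSet_lt measurable_const (hm.comp measurable_fst)).inter
      (measurableSet_le (hm.comp measurable_fst) measurable_snd)
  have hmeas : Measurable (Function.uncurry fun (ω : Ω) (z : ℝ) =>
      {p : Ω × ℝ | y < ℓ p.1 ∧ ℓ p.1 ≤ p.2}.indicator (fun p => (p.2 ^ 2)⁻¹) (ω, z)) :=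
    Measurable.indicator (by fun_prop) hset
  have hint : Integrable (Function.uncurry fun (ω : Ω) (z : ℝ) =>
      {p : Ω × ℝ | y < ℓ p.1 ∧ ℓ p.1 ≤ p.2}.indicator (fun p => (p.2 ^ 2)⁻¹) (ω, z))
      (P.prod (volume.restrict (Ioi y))) := by
    have hb : Integrable (fun p : Ω × ℝ => (1 : ℝ) * (p.2 ^ 2)⁻¹)
        (P.prod (volume.restrict (Ioi y))) :=
      (integrable_const (1 : ℝ)).mul_prod (IsWeight.integrableOn_inv_sq hy)
    refine hb.mono hmeas.aestronglyMeasurable (Eventually.of_forall fun p => ?_)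
    rw [one_mul]
    simp only [Function.uncurry, indicator]
    split_ifs
    · exact le_rfl
    · rw [norm_zero]; exact norm_nonneg _
  have h1 : ∀ ω, (if y < ℓ ω then y ^ 2 / ℓ ω else 0) = y ^ 2 * ∫ z in Ioi y,
      {p : Ω × ℝ | y < ℓ p.1 ∧ ℓ p.1 ≤ p.2}.indicator (fun p => (p.2 ^ 2)⁻¹) (ω, z) := by
    intro ω
    split_ifs with hlt
    · have h2 : (fun z : ℝ => {p : Ω × ℝ | y < ℓ p.1 ∧ ℓ p.1 ≤ p.2}.indicator
          (fun p => (p.2 ^ 2)⁻¹) (ω, z)) = (Ici (ℓ ω)).indicator fun z => (z ^ 2)⁻¹ := by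
        ext z; simp [indicator, hlt]
      rw [h2, setIntegral_indicator measurableSet_Ici, inter_eq_right.2 (Ici_subset_Ioi.2 hlt),
        integral_Ici_eq_integral_Ioi, integral_Ioi_inv_sq (hy.trans hlt)]
      rfl
    · have h2 : (fun z : ℝ => {p : Ω × ℝ | y < ℓ p.1 ∧ ℓ p.1 ≤ p.2}.indicator
          (fun p => (p.2 ^ 2)⁻¹) (ω, z)) = fun _ => 0 := by
        ext z; simp [indicator, hlt]
      simp [h2]
  simp_rw [h1]
  rw [integral_const_mul, integral_integral_swap hint, tailKernel]
  congr 1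
  refine setIntegral_congr_fun measurableSet_Ioi fun z hz => ?_
  have hz : y < z := hz
  have h2 : (fun ω => {p : Ω × ℝ | y < ℓ p.1 ∧ ℓ p.1 ≤ p.2}.indicator
      (fun p => (p.2 ^ 2)⁻¹) (ω, z)) =
      ({ω | ℓ ω ≤ z} \ {ω | ℓ ω ≤ y}).indicator fun _ => (z ^ 2)⁻¹ := by
    ext ω
    simp only [indicator, mem_ofPred_eq, Set.mem_sdiff, not_le, and_comm]
  have hmz : ∀ z, MeasurableSet {ω | ℓ ω ≤ z} := fun z => measurableSet_le hm measurable_const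
  have hreal : ∀ z, P.real {ω | ℓ ω ≤ z} = meanLaw P Ψ I₀ U V n z := fun z => by
    rw [measureReal_def, h.measure_chainSel_le hΨ hI n z,
      ENNReal.toReal_ofReal (h.meanLaw_nonneg hΨ hI n z)]
  rw [h2, integral_indicator ((hmz z).diff (hmz y)), setIntegral_const,
    measureReal_sdiff (show {ω | ℓ ω ≤ y} ⊆ {ω | ℓ ω ≤ z} from
      fun ω hω => le_trans (show ℓ ω ≤ y from hω) hz.le) (hmz y), hreal, hreal, smul_eq_mul, mul_comm]

/-- The mean increment of the size-biased distribution function at one arrival. -/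
theorem integral_chainCdf_succ (hΨ : IsC1Law Ψ) (h : IsSplitInput Ψ P U V) (hI : IsConfig I₀)
    (n : ℕ) {y : ℝ} (hy : 0 < y) :
    ∫ ω, chainCdf I₀ U V (n + 1) y ω ∂P = ∫ ω, chainCdf I₀ U V n y ω ∂P +
      y ^ 2 * tailKernel (meanLaw P Ψ I₀ U V n) y := by
  have hS := h.measurable_chainSel hI n
  have hV := h.measurable_cut n
  have hincr : Integrable (fun ω => splitIncr y (chainSel I₀ U V n ω) (V n ω)) P := by
    refine Integrable.mono' (integrable_const (2 * y))
      ((measurable_splitIncr y).comp (hS.prodMk hV)).aestronglyMeasurable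
      (Eventually.of_forall fun ω => ?_)
    have := splitIncr_mem_Icc (l := chainSel I₀ U V n ω) hy.le (h.cut_mem n ω)
    rw [Real.norm_of_nonneg this.1]
    exact this.2
  simp_rw [h.chainCdf_succ hI n y]
  rw [integral_add (h.integrable_chainCdf hI n y) hincr, ← h.integral_inv_chainSel hΨ hI n hy]
  congr 1
  -- The cut is uniform and independent of the selected length, so it can be averaged first.
  have hmap := (indepFun_iff_map_prod_eq_prod_map_map hS.aemeasurable hV.aemeasurable).1
    (h.indepFun_chainSel hI n)
  have hsm : ∀ μ : Measure (ℝ × ℝ),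
      AEStronglyMeasurable (fun p : ℝ × ℝ => splitIncr y p.1 p.2) μ := fun μ =>
    (measurable_splitIncr y).aestronglyMeasurable
  have hpair : Integrable (fun p : ℝ × ℝ => splitIncr y p.1 p.2)
      ((P.map (chainSel I₀ U V n)).prod (P.map (V n))) := by
    rw [← hmap, integrable_map_measure (hsm _) (hS.prodMk hV).aemeasurable]
    exact hincr
  have := Measure.isProbabilityMeasure_map (μ := P) hV.aemeasurable
  calc ∫ ω, splitIncr y (chainSel I₀ U V n ω) (V n ω) ∂P
      = ∫ p, splitIncr y p.1 p.2 ∂(P.map fun ω => (chainSel I₀ U V n ω, V n ω)) :=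
        (integral_map (hS.prodMk hV).aemeasurable (hsm _)).symm
    _ = ∫ l, ∫ v, splitIncr y l v ∂(P.map (V n)) ∂(P.map (chainSel I₀ U V n)) := by
        rw [hmap, integral_prod _ hpair]
    _ = ∫ l, (if y < l then y ^ 2 / l else 0) ∂(P.map (chainSel I₀ U V n)) := by
        simp_rw [h.cut_law n, integral_splitIncr hy]
    _ = _ := integral_map hS.aemeasurable (Measurable.ite measurableSet_Ioi (by fun_prop)
        measurable_const).aestronglyMeasurable

/-- The mean size-biased distribution function after `m` arrivals. -/
theorem integral_chainCdf_eq_sum (hΨ : IsC1Law Ψ) (h : IsSplitInput Ψ P U V) (hI : IsConfig I₀)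
    (m : ℕ) {y : ℝ} (hy : 0 < y) :
    ∫ ω, chainCdf I₀ U V m y ω ∂P = sizeBiased I₀ y +
      ∑ n ∈ Finset.range m, y ^ 2 * tailKernel (meanLaw P Ψ I₀ U V n) y := by
  induction m with
  | zero => simp [chainCdf, splitChain]
  | succ m ih => rw [h.integral_chainCdf_succ hΨ hI m hy, ih, Finset.sum_range_succ, add_assoc]

end IsSplitInput
end

noncomputable section

/-! ### Exponential gaps -/

lemma expMeasure_one_eq : expMeasure 1 = (volume.restrict (Ioi (0 : ℝ))).withDensity
    (fun x => ENNReal.ofReal (Real.exp (-x))) := by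
  rw [expMeasure, gammaMeasure, ← withDensity_indicator measurableSet_Ioi]
  refine withDensity_congr_ae ?_
  have h0 : ∀ᵐ x : ℝ, x ≠ 0 := by simp [ae_iff, measure_singleton]
  filter_upwards [h0] with x hx
  rcases lt_or_gt_of_ne hx with h | h
  · rw [gammaPDF_of_neg h, indicator_of_notMem (by simpa using h.le)]
  · rw [gammaPDF_of_nonneg h.le, indicator_of_mem (by simpa using h)]
    simp

lemma ae_pos_expMeasure : ∀ᵐ x ∂(expMeasure 1), 0 < x := by
  rw [expMeasure_one_eq]
  exact (withDensity_absolutelyContinuous _ _).ae_le (ae_restrict_mem measurableSet_Ioi)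

lemma integrable_integral_id_expMeasure :
    Integrable (fun x : ℝ => x) (expMeasure 1) ∧ ∫ x, x ∂(expMeasure 1) = 1 := by
  have hG : IntegrableOn (fun x : ℝ => Real.exp (-x) * x) (Ioi 0) := by
    have := Real.GammaIntegral_convergent (s := 2) two_pos
    refine this.congr_fun (fun x _ => ?_) measurableSet_Ioi
    norm_num
  rw [expMeasure_one_eq]
  constructor
  · rw [integrable_withDensity_iff_integrable_smul' (by fun_prop) (by simp)]
    refine hG.congr_fun (fun x _ => ?_) measurableSet_Ioi
    simp [ENNReal.toReal_ofReal, Real.exp_nonneg]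
  · rw [integral_withDensity_eq_integral_toReal_smul (by fun_prop) (by simp)]
    have h := Real.Gamma_eq_integral (s := 2) two_pos
    rw [Real.Gamma_two] at h
    rw [h]
    refine setIntegral_congr_fun measurableSet_Ioi fun x _ => ?_
    norm_num [ENNReal.toReal_ofReal, Real.exp_nonneg]

/-! ### From continuous time to the sequence of arrivals -/

namespace PsiProcess

variable {Ψ : ℝ → ℝ} {Ω : Type*} [MeasurableSpace Ω] {P : Measure Ω}

lemma ae_gap_pos (X : PsiProcess Ψ P) : ∀ᵐ ω ∂P, ∀ i, 0 < X.gap i ω := by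
  rw [ae_all_iff]
  intro i
  have := ae_pos_expMeasure
  rw [← X.gap_law i] at this
  exact ae_of_ae_map (X.measurable_gap i).aemeasurable this

lemma tendsto_sum_gap_div [IsProbabilityMeasure P] (X : PsiProcess Ψ P) : ∀ᵐ ω ∂P,
    Tendsto (fun n : ℕ => (∑ i ∈ Finset.range n, X.gap i ω) / n) atTop (𝓝 1) := by
  have hi := integrable_integral_id_expMeasure
  have hint : Integrable (X.gap 0) P := by
    have := hi.1
    rw [← X.gap_law 0] at this
    exact this.comp_measurable (X.measurable_gap 0)
  have hmean : P[X.gap 0] = 1 := by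
    rw [← hi.2, ← X.gap_law 0, integral_map (X.measurable_gap 0).aemeasurable (by fun_prop)]
  have hindep : iIndepFun X.gap P := iIndepFun.precomp (g := Sum.inl) Sum.inl_injective X.indep
  have := strong_law_ae_real X.gap hint (fun i j hij => hindep.indepFun hij)
    (fun i => ⟨(X.measurable_gap i).aemeasurable, (X.measurable_gap 0).aemeasurable, by
      rw [X.gap_law, X.gap_law]⟩)
  rwa [hmean] at this

/-- The number of arrivals at the arrival time with index `n - 1` is `n`. -/
lemma arrivals_log (X : PsiProcess Ψ P) {ω : Ω} (hpos : ∀ i, 0 < X.gap i ω) (n : ℕ) :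
    X.arrivals (Real.log (1 + ∑ i ∈ Finset.range n, X.gap i ω)) ω = n := by
  have hT : ∀ m, 0 < 1 + ∑ i ∈ Finset.range m, X.gap i ω := fun m =>
    add_pos_of_pos_of_nonneg one_pos (Finset.sum_nonneg fun i _ => (hpos i).le)
  have hmono : StrictMono fun m => ∑ i ∈ Finset.range m, X.gap i ω :=
    strictMono_nat_of_lt_succ fun m => by
      rw [Finset.sum_range_succ]; linarith [hpos m]
  -- Arrival `k` comes after `k + 1` gaps, so it is counted exactly when `k + 1 ≤ n`.
  have : {k : ℕ | X.arrivalTime k ω ≤ Real.log (1 + ∑ i ∈ Finset.range n, X.gap i ω)} =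
      ↑(Finset.range n) := by
    ext k
    rw [mem_ofPred_eq, arrivalTime, Real.log_le_log_iff (hT _) (hT _), add_le_add_iff_left,
      hmono.le_iff_le, Finset.coe_range, mem_Iio]
    rfl
  rw [arrivals, this, ncard_coe_finset, Finset.card_range]

/-- Convergence along the arrivals in place of convergence in continuous time. -/
lemma tendsto_sizeBiased_splitChain (X : PsiProcess Ψ P) {ω : Ω} {Fhat : Profile}
    (hpos : ∀ i, 0 < X.gap i ω)
    (hsum : Tendsto (fun n : ℕ => (∑ i ∈ Finset.range n, X.gap i ω) / n) atTop (𝓝 1))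
    (hA : ∀ x, 0 ≤ x → Tendsto (fun t : ℝ => X.A t ω x) atTop (𝓝 (Fhat x)))
    (hcfg : ∀ n, IsConfig (splitChain X.init (X.sel · ω) (X.cut · ω) n))
    {N : ℕ → ℕ} (hN : Tendsto N atTop atTop) {c : ℕ → ℝ} {p : ℝ} (hp : 0 < p)
    (hc : Tendsto (fun k => N k * c k) atTop (𝓝 p)) (hcont : ContinuousAt Fhat p) :
    Tendsto (fun k => sizeBiased (splitChain X.init (X.sel · ω) (X.cut · ω) (N k)) (c k)) atTop
      (𝓝 (Fhat p)) := by
  set T : ℕ → ℝ := fun n => 1 + ∑ i ∈ Finset.range n, X.gap i ω with hTdef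
  have hT0 : ∀ n, 0 < T n := fun n =>
    add_pos_of_pos_of_nonneg one_pos (Finset.sum_nonneg fun i _ => (hpos i).le)
  have hTdiv : Tendsto (fun n : ℕ => T n / n) atTop (𝓝 1) := by
    have := (tendsto_one_div_atTop_nhds_zero_nat (𝕜 := ℝ)).add hsum
    simpa [hTdef, add_div] using this
  have hTtop : Tendsto T atTop atTop := by
    have := hTdiv.pos_mul_atTop one_pos (tendsto_natCast_atTop_atTop (R := ℝ))
    refine this.congr' ?_
    filter_upwards [eventually_gt_atTop 0] with n hn
    have : (n : ℝ) ≠ 0 := by positivity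
    field_simp
  -- At time `log (T n)` exactly `n` arrivals have occurred, and the rescaling factor `e^{-t}` is `1
  -- / T n`.
  have hG : ∀ x, 0 ≤ x → Tendsto (fun k => sizeBiased
      (splitChain X.init (X.sel · ω) (X.cut · ω) (N k)) (x / T (N k))) atTop (𝓝 (Fhat x)) := by
    intro x hx
    refine ((hA x hx).comp ((Real.tendsto_log_atTop.comp hTtop).comp hN)).congr fun k => ?_
    simp only [Function.comp_apply, A, lengths, hTdef]
    rw [X.arrivals_log hpos, Real.exp_neg, Real.exp_log (hT0 _), inv_mul_eq_div]
  have hTc : Tendsto (fun k => T (N k) * c k) atTop (𝓝 p) := by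
    have := (hTdiv.comp hN).mul hc
    rw [one_mul] at this
    refine this.congr' ?_
    filter_upwards [hN.eventually_gt_atTop 0] with k hk
    have : (N k : ℝ) ≠ 0 := by positivity
    simp only [Function.comp_apply]
    field_simp
  -- For `a < p < b` the level `c k` eventually lies between `a / T (N k)` and `b / T (N k)`;
  -- monotonicity and continuity of `F̂` at `p` close the sandwich.
  rw [tendsto_order]
  constructor
  · intro u hu
    obtain ⟨a, ⟨ha0, hap⟩, hau⟩ : ∃ a ∈ Ioo 0 p, u < Fhat a :=
      (((hcont.eventually (lt_mem_nhds hu)).filter_mono nhdsWithin_le_nhds).and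
        (Ioo_mem_nhdsLT hp)).exists.imp fun a h => ⟨h.2, h.1⟩
    filter_upwards [(hG a ha0.le).eventually (lt_mem_nhds hau), hTc.eventually (lt_mem_nhds hap)]
      with k hk1 hk2
    refine hk1.trans_le (sizeBiased_mono (hcfg _).nonneg ?_)
    rw [div_le_iff₀ (hT0 _), mul_comm]
    exact hk2.le
  · intro u hu
    obtain ⟨b, hpb, hbu⟩ : ∃ b ∈ Ioi p, Fhat b < u :=
      (((hcont.eventually (gt_mem_nhds hu)).filter_mono nhdsWithin_le_nhds).and
        (self_mem_nhdsWithin (s := Ioi p))).exists.imp fun a h => ⟨h.2, h.1⟩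
    have hb0 : 0 ≤ b := (hp.trans hpb).le
    filter_upwards [(hG b hb0).eventually (gt_mem_nhds hbu), hTc.eventually (gt_mem_nhds hpb)]
      with k hk1 hk2
    refine lt_of_le_of_lt (sizeBiased_mono (hcfg _).nonneg ?_) hk1
    rw [le_div_iff₀ (hT0 _), mul_comm]
    exact hk2.le

lemma isConfig_init (X : PsiProcess Ψ P) : IsConfig X.init :=
  ⟨fun l hl => (X.init_pos l hl).le, X.init_sum⟩

/-- Replace values outside of `S`, of probability zero, by one. -/
def _root_.clampOne (S : Set ℝ) (x : ℝ) : ℝ := by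
  classical exact if x ∈ S then x else 1

lemma _root_.clampOne_of_mem {S : Set ℝ} {x : ℝ} (hx : x ∈ S) : clampOne S x = x := if_pos hx

lemma _root_.clampOne_mem {S : Set ℝ} (hS : 1 ∈ S) (x : ℝ) : clampOne S x ∈ S := by
  unfold clampOne
  split_ifs with h
  · exact h
  · exact hS

lemma _root_.measurable_clampOne {S : Set ℝ} (hS : MeasurableSet S) : Measurable (clampOne S) :=
  Measurable.ite hS measurable_id measurable_const

lemma ae_sel_mem [IsProbabilityMeasure P] (hΨ : IsC1Law Ψ) (X : PsiProcess Ψ P) (n : ℕ) :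
    ∀ᵐ ω ∂P, X.sel n ω ∈ Ioc (0 : ℝ) 1 := by
  have h0 : ∀ᵐ ω ∂P, ¬ X.sel n ω ≤ 0 := by
    rw [ae_iff]
    simpa [hΨ.map_zero] using X.sel_law n 0 (by simp)
  have h1 : ∀ᵐ ω ∂P, X.sel n ω ≤ 1 := by
    refine (mem_ae_iff_prob_eq_one (measurableSet_le (X.measurable_sel n) measurable_const)).2 ?_
    simpa [hΨ.map_one] using X.sel_law n 1 (by simp)
  filter_upwards [h0, h1] with ω h0 h1 using ⟨not_le.1 h0, h1⟩

lemma ae_cut_mem (X : PsiProcess Ψ P) (n : ℕ) : ∀ᵐ ω ∂P, X.cut n ω ∈ Icc (0 : ℝ) 1 := by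
  have : ∀ᵐ v ∂(volume.restrict (Icc (0 : ℝ) 1)), v ∈ Icc (0 : ℝ) 1 :=
    ae_restrict_mem measurableSet_Icc
  rw [← X.cut_law n] at this
  exact ae_of_ae_map (X.measurable_cut n).aemeasurable this

/-- The selections, modified on a null set to take values in `(0,1]`. -/
def sel' (X : PsiProcess Ψ P) (n : ℕ) (ω : Ω) : ℝ := clampOne (Ioc 0 1) (X.sel n ω)

/-- The cuts, modified on a null set to take values in `[0,1]`. -/
def cut' (X : PsiProcess Ψ P) (n : ℕ) (ω : Ω) : ℝ := clampOne (Icc 0 1) (X.cut n ω)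

lemma isSplitInput [IsProbabilityMeasure P] (hΨ : IsC1Law Ψ) (X : PsiProcess Ψ P) :
    IsSplitInput Ψ P X.sel' X.cut' where
  measurable_sel n := (measurable_clampOne measurableSet_Ioc).comp (X.measurable_sel n)
  measurable_cut n := (measurable_clampOne measurableSet_Icc).comp (X.measurable_cut n)
  sel_mem n ω := clampOne_mem (by simp) _
  cut_mem n ω := clampOne_mem (by simp) _
  sel_law n u hu := by
    rw [← X.sel_law n u hu]
    refine measure_congr ?_
    filter_upwards [X.ae_sel_mem hΨ n] with ω h
    exact congrArg (· ≤ u) (clampOne_of_mem h)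
  cut_law n := by
    rw [← X.cut_law n]
    refine Measure.map_congr ?_
    filter_upwards [X.ae_cut_mem n] with ω h using clampOne_of_mem h
  indep := by
    have h : iIndepFun (Sum.elim X.sel X.cut) P :=
      iIndepFun.precomp (g := Sum.inr) Sum.inr_injective X.indep
    have := h.comp (Sum.elim (fun _ : ℕ => clampOne (Ioc 0 1)) fun _ : ℕ => clampOne (Icc 0 1)) (by
      rintro (n | n)
      · exact measurable_clampOne measurableSet_Ioc
      · exact measurable_clampOne measurableSet_Icc)
    convert this using 1
    ext (n | n) ω <;> rfl

/-- Almost surely, the size-biased distribution functions converge along the arrivals. -/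
lemma ae_tendsto_chainCdf [IsProbabilityMeasure P] (hΨ : IsC1Law Ψ) (X : PsiProcess Ψ P)
    {Fhat : Profile} (hF : IsLimitingDistribution X Fhat) : ∀ᵐ ω ∂P,
    ∀ {N : ℕ → ℕ}, Tendsto N atTop atTop → ∀ {c : ℕ → ℝ} {p : ℝ}, 0 < p →
      Tendsto (fun k => N k * c k) atTop (𝓝 p) → ContinuousAt Fhat p →
      Tendsto (fun k => chainCdf X.init X.sel' X.cut' (N k) (c k) ω) atTop (𝓝 (Fhat p)) := by
  filter_upwards [X.ae_gap_pos, X.tendsto_sum_gap_div, hF.tendsto_A,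
    ae_all_iff.2 (X.ae_sel_mem hΨ), ae_all_iff.2 X.ae_cut_mem] with ω hpos hsum hA hsel hcut
  intro N hN c p hp hc hcont
  have h1 : (fun k => X.sel' k ω) = (X.sel · ω) := funext fun k => clampOne_of_mem (hsel k)
  have h2 : (fun k => X.cut' k ω) = (X.cut · ω) := funext fun k => clampOne_of_mem (hcut k)
  unfold chainCdf
  rw [h1, h2]
  exact X.tendsto_sizeBiased_splitChain hpos hsum hA
    (isConfig_splitChain X.isConfig_init hsel hcut) hN hp hc hcont

variable [IsProbabilityMeasure P]

/-- Bounded convergence. It is used with the identity for the distribution function itself and with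
`Ψ` for the law of the selected length. -/
lemma tendsto_integral_chainCdf (hΨ : IsC1Law Ψ) (X : PsiProcess Ψ P)
    {Fhat : Profile} (hF : IsLimitingDistribution X Fhat) {g : ℝ → ℝ}
    (hg : ContinuousOn g (Icc 0 1)) {N : ℕ → ℕ} (hN : Tendsto N atTop atTop)
    {c : ℕ → ℝ} {p : ℝ} (hp : 0 < p) (hc : Tendsto (fun k => N k * c k) atTop (𝓝 p))
    (hcont : ContinuousAt Fhat p) :
    Tendsto (fun k => ∫ ω, g (chainCdf X.init X.sel' X.cut' (N k) (c k) ω) ∂P) atTop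
      (𝓝 (g (Fhat p))) := by
  have h := X.isSplitInput hΨ
  have hmem := fun n y ω => h.chainCdf_mem X.isConfig_init n y ω
  obtain ⟨M, hM⟩ := isCompact_Icc.exists_bound_of_continuousOn hg
  have hlim := tendsto_integral_of_dominated_convergence (μ := P)
    (F := fun k ω => g (chainCdf X.init X.sel' X.cut' (N k) (c k) ω)) (f := fun _ => g (Fhat p))
    (fun _ => M) (fun k => ?_) (integrable_const M)
    (fun k => Eventually.of_forall fun ω => hM _ (hmem _ _ ω)) ?_
  · simpa using hlim
  · exact (IsSplitInput.measurable_comp hg (h.measurable_chainCdf X.isConfig_init _ _)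
      (hmem _ _)).aestronglyMeasurable
  · filter_upwards [X.ae_tendsto_chainCdf hΨ hF] with ω hω
    have h1 := hω hN hp hc hcont
    exact (hg.continuousWithinAt ⟨Fhat.nonneg p, Fhat.le_one p⟩).tendsto.comp
      (tendsto_nhdsWithin_iff.2 ⟨h1, Eventually.of_forall fun k => hmem _ _ ω⟩)

end PsiProcess

end

/-! ### Riemann sums and the derivation of the stationary equation -/

noncomputable section

lemma tailKernel_mul (φ : ℝ → ℝ) {c : ℝ} (hc : 0 < c) (r : ℝ) :
    tailKernel φ (c * r) = c⁻¹ * tailKernel (fun z => φ (c * z)) r := by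
  have h := integral_comp_mul_left_Ioi (fun z => (z ^ 2)⁻¹ * (φ z - φ (c * r))) r hc
  rw [smul_eq_mul, eq_inv_mul_iff_mul_eq₀ hc.ne'] at h
  rw [tailKernel, ← h, tailKernel, ← integral_const_mul, ← integral_const_mul]
  refine integral_congr_ae (Eventually.of_forall fun z => ?_)
  simp only
  field_simp

/-- The majorant is `z⁻²`. Convergence for almost every `z` suffices, which allows for the
discontinuities that `F̂` might still have at this stage. -/
lemma tendsto_tailKernel {φ : ℕ → ℝ → ℝ} {φ' : ℝ → ℝ} (hφ : ∀ k, Measurable (φ k))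
    (hmem : ∀ k z, φ k z ∈ Icc (0 : ℝ) 1) {r : ℝ} (hr : 0 < r)
    (hlim : Tendsto (fun k => φ k r) atTop (𝓝 (φ' r)))
    (hlim_ae : ∀ᵐ z ∂(volume.restrict (Ioi r)), Tendsto (fun k => φ k z) atTop (𝓝 (φ' z))) :
    Tendsto (fun k => tailKernel (φ k) r) atTop (𝓝 (tailKernel φ' r)) := by
  refine tendsto_integral_of_dominated_convergence (fun z => (z ^ 2)⁻¹) (fun k => ?_)
    (IsWeight.integrableOn_inv_sq hr) (fun k => Eventually.of_forall fun z => ?_) ?_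
  · exact (Measurable.mul (by fun_prop) ((hφ k).sub measurable_const)).aestronglyMeasurable
  · rw [norm_mul, Real.norm_of_nonneg (by positivity)]
    refine mul_le_of_le_one_right (by positivity) ?_
    rw [Real.norm_eq_abs, abs_le]
    have h1 := hmem k z
    have h2 := hmem k r
    constructor <;> linarith [h1.1, h1.2, h2.1, h2.2]
  · filter_upwards [hlim_ae] with z hz using (hz.sub hlim).const_mul _

lemma sum_range_eq_integral_floor (a : ℕ → ℝ) (m : ℕ) :
    ∑ n ∈ Finset.range m, a n = ∫ u in (0 : ℝ)..m, a ⌊u⌋₊ := by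
  have hIco : ∀ n : ℕ, EqOn (fun _ => a n) (fun u : ℝ => a ⌊u⌋₊) (Ico (n : ℝ) (n + 1 : ℕ)) := by
    intro n u hu
    simp only
    rw [(Nat.floor_eq_iff (n.cast_nonneg.trans hu.1)).2 ⟨hu.1, by exact_mod_cast hu.2⟩]
  have hle : ∀ n : ℕ, (n : ℝ) ≤ (n + 1 : ℕ) := fun n => by simp
  have := intervalIntegral.sum_integral_adjacent_intervals (μ := volume) (n := m)
    (f := fun u : ℝ => a ⌊u⌋₊) (a := fun n => (n : ℝ)) fun n _ => by
      rw [intervalIntegrable_iff_integrableOn_Ico_of_le (hle n)]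
      exact IntegrableOn.congr_fun (integrableOn_const (by simp)) (hIco n) measurableSet_Ico
  rw [Nat.cast_zero] at this
  rw [← this]
  refine Finset.sum_congr rfl fun n _ => ?_
  rw [intervalIntegral.integral_of_le (hle n), ← integral_Ico_eq_integral_Ioc,
    ← setIntegral_congr_fun measurableSet_Ico (hIco n)]
  simp

/-- With the sum written as the integral of a step function, the Riemann limit becomes a dominated
convergence in `r`. -/
lemma sum_range_mul_eq_integral (a : ℕ → ℝ) {m : ℕ} (hm : 0 < m) (x : ℝ) (hx : 0 < x) :
    ∑ n ∈ Finset.range m, x / m * a n = ∫ r in (0 : ℝ)..x, a ⌊r / (x / m)⌋₊ := by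
  have hy : x / m ≠ 0 := by positivity
  rw [← Finset.mul_sum, sum_range_eq_integral_floor,
    intervalIntegral.integral_comp_div (fun u => a ⌊u⌋₊) hy, zero_div, smul_eq_mul,
    div_div_cancel₀ hx.ne']

lemma tendsto_floor_div_mul {y : ℕ → ℝ} (hy0 : ∀ᶠ k in atTop, 0 < y k)
    (hy : Tendsto y atTop (𝓝 0)) {r : ℝ} (hr : 0 < r) :
    Tendsto (fun k => (⌊r / y k⌋₊ : ℝ) * (y k / r)) atTop (𝓝 1) := by
  have hdiv : Tendsto (fun k => r / y k) atTop atTop :=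
    (tendsto_nhdsWithin_iff.2 ⟨hy, hy0⟩).inv_tendsto_nhdsGT_zero.const_mul_atTop hr
  have := (tendsto_nat_floor_div_atTop (R := ℝ)).comp hdiv
  refine this.congr fun k => ?_
  simp only [Function.comp_apply]
  rw [div_eq_mul_inv, inv_div]

namespace PsiProcess

variable {Ψ : ℝ → ℝ} {Ω : Type*} [MeasurableSpace Ω] {P : Measure Ω} [IsProbabilityMeasure P]

omit [IsProbabilityMeasure P] in
lemma eventually_sizeBiased_init_eq_zero (X : PsiProcess Ψ P) :
    ∀ᶠ y in 𝓝 (0 : ℝ), sizeBiased X.init y = 0 := by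
  have : ∀ᶠ y in 𝓝 (0 : ℝ), ∀ l ∈ X.init.toFinset, y < l :=
    (Filter.eventually_all_finset _).2 fun l hl =>
      gt_mem_nhds (X.init_pos l (Multiset.mem_toFinset.1 hl))
  filter_upwards [this] with y hy
  rw [sizeBiased, Multiset.filter_eq_nil.2 fun l hl =>
    not_le.2 (hy l (Multiset.mem_toFinset.2 hl)), Multiset.sum_zero]

/-- Convergence of the rescaled drift at the index `⌊r / y⌋`. -/
lemma tendsto_mul_tailKernel_meanLaw (hΨ : IsC1Law Ψ) (X : PsiProcess Ψ P) {Fhat : Profile}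
    (hF : IsLimitingDistribution X Fhat) {y : ℕ → ℝ} (hy0 : ∀ᶠ k in atTop, 0 < y k)
    (hy : Tendsto y atTop (𝓝 0)) {r : ℝ} (hr : 0 < r) (hcont : ContinuousAt Fhat r) :
    Tendsto (fun k => y k * tailKernel (meanLaw P Ψ X.init X.sel' X.cut' ⌊r / y k⌋₊) (y k)) atTop
      (𝓝 (r * tailKernel (fun z => Ψ (Fhat z)) r)) := by
  have h := X.isSplitInput hΨ
  have hI := X.isConfig_init
  have hN : Tendsto (fun k => ⌊r / y k⌋₊) atTop atTop := tendsto_nat_floor_atTop.comp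
    ((tendsto_nhdsWithin_iff.2 ⟨hy, hy0⟩).inv_tendsto_nhdsGT_zero.const_mul_atTop hr)
  have hpt : ∀ w, r ≤ w → ContinuousAt Fhat w → Tendsto (fun k =>
      meanLaw P Ψ X.init X.sel' X.cut' ⌊r / y k⌋₊ (y k / r * w)) atTop (𝓝 (Ψ (Fhat w))) := by
    intro w hw hcw
    refine X.tendsto_integral_chainCdf hΨ hF hΨ.contDiffOn.continuousOn hN (hr.trans_le hw) ?_ hcw
    have := (tendsto_floor_div_mul hy0 hy hr).mul_const w
    rw [one_mul] at this
    exact this.congr fun k => by rw [mul_assoc]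
  have hlim := (tendsto_tailKernel (φ' := fun z => Ψ (Fhat z))
    (φ := fun k w => meanLaw P Ψ X.init X.sel' X.cut' ⌊r / y k⌋₊ (y k / r * w))
    (fun k => (h.meanLaw_mono hΨ hI _).measurable.comp (by fun_prop))
    (fun k w => ⟨h.meanLaw_nonneg hΨ hI _ _, h.meanLaw_le_one hΨ hI _ _⟩) hr
    (hpt r le_rfl hcont) ?_).const_mul r
  · refine hlim.congr' ?_
    filter_upwards [hy0] with k hk
    -- The dilation by `y/r` carries level `r` to level `y` and gives `y K_μ(y) = r K_ν(r)` with
    -- `ν(w) = μ((y/r) w)`.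
    have := tailKernel_mul (meanLaw P Ψ X.init X.sel' X.cut' ⌊r / y k⌋₊) (div_pos hk hr) r
    rw [div_mul_cancel₀ _ hr.ne'] at this
    rw [this, inv_div, ← mul_assoc, mul_div_cancel₀ _ hk.ne']
  · filter_upwards [ae_restrict_mem measurableSet_Ioi,
      ae_restrict_of_ae (Fhat.monotone.countable_not_continuousAt.ae_notMem volume)] with w hw hcw
    exact hpt w (le_of_lt hw) (by simpa using hcw)

/-- After `k` arrivals at level `x/k` the mean distribution function tends to `F̂ x`. It is also the
sum of the mean increments `(x/k)² K_n(x/k)`, and the term with `n = ⌊r/(x/k)⌋` is `x/k` times a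
quantity tending to `r K(r)`. -/
lemma profile_eq_integral_of_continuousAt (hΨ : IsC1Law Ψ) (X : PsiProcess Ψ P) {Fhat : Profile}
    (hF : IsLimitingDistribution X Fhat) {x : ℝ} (hx : 0 < x) (hcont : ContinuousAt Fhat x) :
    Fhat x = ∫ r in (0 : ℝ)..x, r * tailKernel (fun z => Ψ (Fhat z)) r := by
  have h := X.isSplitInput hΨ
  have hI := X.isConfig_init
  set μ := meanLaw P Ψ X.init X.sel' X.cut' with hμ
  have hy0 : ∀ᶠ k : ℕ in atTop, 0 < x / k := by
    filter_upwards [eventually_gt_atTop 0] with k hk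
    positivity
  have hy : Tendsto (fun k : ℕ => x / k) atTop (𝓝 0) := tendsto_const_div_atTop_nhds_zero_nat x
  have hL : Tendsto (fun k : ℕ => ∫ ω, chainCdf X.init X.sel' X.cut' k (x / k) ω ∂P) atTop
      (𝓝 (Fhat x)) := by
    refine X.tendsto_integral_chainCdf hΨ hF (g := fun u => u) continuousOn_id tendsto_id hx ?_
      hcont
    refine tendsto_const_nhds.congr' ?_
    filter_upwards [eventually_gt_atTop 0] with k hk
    have : (k : ℝ) ≠ 0 := by positivity
    simp only [id]
    field_simp
  have hR : Tendsto (fun k : ℕ => ∫ r in (0 : ℝ)..x, x / k * tailKernel (μ ⌊r / (x / k)⌋₊) (x / k))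
      atTop (𝓝 (∫ r in (0 : ℝ)..x, r * tailKernel (fun z => Ψ (Fhat z)) r)) := by
    refine intervalIntegral.tendsto_integral_filter_of_dominated_convergence (fun _ => 1)
      (Eventually.of_forall fun k => ?_) ?_ intervalIntegrable_const ?_
    · have hm : Measurable fun n : ℕ => x / k * tailKernel (μ n) (x / k) := measurable_from_nat
      exact (hm.comp (Nat.measurable_floor.comp (by fun_prop))).aestronglyMeasurable
    · filter_upwards [hy0] with k hk
      refine Eventually.of_forall fun r _ => ?_
      have hmono := h.meanLaw_mono hΨ hI ⌊r / (x / k)⌋₊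
      rw [Real.norm_of_nonneg (mul_nonneg hk.le (tailKernel_nonneg hmono _))]
      refine (mul_tailKernel_le hmono (h.meanLaw_nonneg hΨ hI _) (h.meanLaw_le_one hΨ hI _)
        hk).trans ?_
      linarith [h.meanLaw_nonneg hΨ hI ⌊r / (x / k)⌋₊ (x / k)]
    · filter_upwards [Fhat.monotone.countable_not_continuousAt.ae_notMem volume] with r hcr hr
      rw [uIoc_of_le hx.le] at hr
      exact X.tendsto_mul_tailKernel_meanLaw hΨ hF hy0 hy hr.1 (by simpa using hcr)
  refine tendsto_nhds_unique (hL.congr' ?_) hR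
  -- The initial lengths are positive, so none lies below `x/k` once `k` is large and the initial
  -- term drops out.
  filter_upwards [eventually_gt_atTop 0, hy.eventually X.eventually_sizeBiased_init_eq_zero]
    with k hk hk0
  have hxk : 0 < x / k := by positivity
  rw [h.integral_chainCdf_eq_sum hΨ hI k hxk, hk0, zero_add,
    ← sum_range_mul_eq_integral (fun n => x / k * tailKernel (μ n) (x / k)) hk x hx]
  exact Finset.sum_congr rfl fun n _ => by ring

/-- The limiting distribution of the process solves the stationary equation. -/
theorem isStationaryProfile (hΨ : IsC1Law Ψ) (X : PsiProcess Ψ P) {Fhat : Profile}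
    (hF : IsLimitingDistribution X Fhat) : IsStationaryProfile Ψ Fhat where
  tendsto_one := hF.tendsto_one
  eq x hx := by
    have hR : ContinuousAt (fun x => ∫ r in (0 : ℝ)..x, r * tailKernel (fun z => Ψ (Fhat z)) r)
        x := by
      have hint := IsStationaryProfile.intervalIntegrable_mul_kernel (Fhat := Fhat) hΨ le_rfl
        (show (0 : ℝ) ≤ x + 1 by linarith)
      have := intervalIntegral.continuousOn_primitive_interval' hint left_mem_uIcc
      rw [uIcc_of_le (by linarith)] at this
      exact this.continuousAt (Icc_mem_nhds hx (by linarith))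
    have hL : Tendsto Fhat (𝓝[>] x) (𝓝 (Fhat x)) :=
      (Fhat.right_continuous x).tendsto.mono_left (nhdsWithin_mono _ Ioi_subset_Ici_self)
    -- Both sides are right-continuous at `x` and agree at the continuity points of `F̂`, which are
    -- dense because their complement is countable.
    refine tendsto_nhds_unique_of_frequently_eq hL
      (hR.tendsto.mono_left (nhdsWithin_le_nhds (s := Ioi x))) ?_
    have hdense := Fhat.monotone.countable_not_continuousAt.dense_compl ℝ
    rw [frequently_iff]
    intro s hs
    obtain ⟨b, hb, hbs⟩ := (mem_nhdsGT_iff_exists_Ioo_subset).1 hs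
    obtain ⟨z, hz, hzb⟩ := hdense.exists_mem_open isOpen_Ioo (nonempty_Ioo.2 hb)
    exact ⟨z, hbs hzb, X.profile_eq_integral_of_continuousAt hΨ hF (hx.trans hzb.1)
      (by simpa using hz)⟩

end PsiProcess

end

theorem mainTheorem3 {Ω : Type*} [MeasurableSpace Ω] (P : Measure Ω) [IsProbabilityMeasure P]
    (Ψ : ℝ → ℝ) (hΨ : IsC1Law Ψ) (X : PsiProcess Ψ P)
    (Fhat : Profile) (hF : IsLimitingDistribution X Fhat)
    (δ : ℝ) (hδ0 : 0 < δ) (hδ1 : δ ≤ 1) (hineq : DensityInequality Ψ Fhat δ)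
    (α : ℝ) (hα0 : 0 ≤ α) (hα1 : α ≤ 1)
    (F : ℝ≥0 → Profile) (hfix : IsFixedPoint Ψ Fhat α F) (t : ℝ≥0) :
    wnorm δ (fun x => F t x - α * Fhat x) ≤
      ENNReal.ofReal (2 * (1 + δ⁻¹) * Real.exp (-δ * t)) := by
  exact wnorm_sub_le_of_isStationaryProfile hΨ (X.isStationaryProfile hΨ hF) hδ0 hδ1 hineq hα1
    hfix t
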